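/- Let $\mathbb T^n=(\mathbb R/\mathbb Z)^n$, let $k>n/2$ be an integer and let $\rho_0\in C^k(\mathbb T^n)$ be real and strictly positive. Let $\mathbb D$ be the space of all $V=(\phi,h)\in L^2(\mathbb T^n)\times L^2(\mathbb T^n)^n$ (real- or complex-valued; all products below are bilinear) with $h=\sqrt{\rho_0}\,\nabla w$ for some $w\in L^2$, and let $\mathcal L(\tau)=(\mathcal L_1(\tau),\mathcal L_2(\tau))=e^{\tau L}$ be the unitary group on $\mathbb D$ generated by $L(\phi,\sqrt{\rho_0}\nabla w)=-(\operatorname{div}(\rho_0\nabla w),\sqrt{\rho_0}\nabla\phi)$, where $\mathcal L_1$ is the first component and $\mathcal L_2$ the remaining $n$ components. For $V_1,V_2\in\mathbb D$ and $s\in\mathbb R$ define the distribution $$B_2^{(s)}(V_1,V_2)=\tfrac12\operatorname{div}\big(\mathcal L_2(s)V_1\otimes\mathcal L_2(s)V_2+\mathcal L_2(s)V_2\otimes\mathcal L_2(s)V_1\big)+\tfrac12\nabla\big(\mathcal L_1(s)V_1\,\mathcal L_1(s)V_2\big).$$ For $f\in L^2(\mathbb T^n)^n$ let $\mathbb H^\perp_{\rho_0}f=\rho_0\nabla\Psi$,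 where $\Psi$ is the weak solution, unique up to a constant, of $\operatorname{div}(\rho_0\nabla\Psi)=\operatorname{div}f$. Put $$\mathcal Q_2(V_1,V_2)=\lim_{\tau\to\infty}\frac1\tau\int_0^\tau\mathcal L(-s)\begin{pmatrix}0\\ \rho_0^{-1/2}\,\mathbb H^\perp_{\rho_0}B_2^{(s)}(V_1,V_2)\end{pmatrix}ds .$$ Then the following hold. 1. Let $t\ge 0$, let $V_1,V_2\in C([0,t];L^2)$ take values in $\mathbb D$, and let $u$ be a real vector field on $[0,t]\times\mathbb T^n$ such that $u$ and $\nabla_x u$ are continuous and $\operatorname{div}(\rho_0u(s))=0$ for all $s$. Then $$\lim_{\varepsilon\to0^+}\int_0^t\int_{\mathbb T^n}B_2^{(s/\varepsilon)}(V_1(s),V_2(s))\cdot u(s)\,dx\,ds=0,$$ where the space integral is the distributional pairing. 2. If $V_1,V_2\in\mathbb D\cap H^k(\mathbb T^n)$, then $B_2^{(s)}(V_1,V_2)$ is an $L^2$ vector field for every $s$, the integrand in the definition of $\mathcal Q_2(V_1,V_2)$ is integrable on bounded intervals, and the limit defining $\mathcal Q_2(V_1,V_2)$ exists in $L^2$.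 Moreover, the limit in 1 also holds for such fixed $V_1,V_2$ and every real $u\in C([0,t];L^2(\mathbb T^n)^n)$ with $\operatorname{div}(\rho_0u(s))=0$ weakly for all $s$. 3. For all $V\in\mathbb D\cap H^k(\mathbb T^n)$, $\displaystyle\int_{\mathbb T^n}\mathcal Q_2(V,V)\cdot V\,dx=0$. 4. For all $V_1,V_2\in\mathbb D\cap H^k(\mathbb T^n)$, $\displaystyle\int_{\mathbb T^n}\big[\mathcal Q_2(V_1,V_1)\cdot V_2+2\,\mathcal Q_2(V_1,V_2)\cdot V_1\big]dx=0$. -/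

import Mathlib

open MeasureTheory Filter Topology Set

noncomputable section

namespace Anelastic

/-- The periodic domain `𝕋ⁿ = (ℝ/ℤ)ⁿ`; its `volume` is the normalized Lebesgue measure. -/
abbrev Torus (n : ℕ) : Type := UnitAddTorus (Fin n)

/-- `C^k` functions on the torus: the periodic lift to `ℝⁿ` is `C^k`. -/
def IsCk {n : ℕ} (k : WithTop ℕ∞) (f : Torus n → ℝ) : Prop :=
  ContDiff ℝ k (fun x : Fin n → ℝ => f (fun i => (x i : UnitAddCircle)))

/-- Smooth functions on the torus (the test functions). -/
abbrev IsSmooth {n : ℕ} (f : Torus n → ℝ) : Prop := IsCk ((⊤ : ℕ∞) : WithTop ℕ∞) f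

/-- The classical partial derivative `∂ⱼ f` on the torus. -/
def pd {n : ℕ} (j : Fin n) (f : Torus n → ℝ) (x : Torus n) : ℝ :=
  deriv (fun t : ℝ => f (x + Pi.single j (t : UnitAddCircle))) 0

/-- `g` is the weak partial derivative `∂ⱼ f`. -/
def HasWeakPartial {n : ℕ} (j : Fin n) (f g : Torus n → ℂ) : Prop :=
  ∀ η : Torus n → ℝ, IsSmooth η →
    ∫ x, f x * ((pd j η x : ℝ) : ℂ) = -∫ x, g x * ((η x : ℝ) : ℂ)

/-- The Sobolev space `H^k(𝕋ⁿ)`: weak derivatives up to order `k` lie in `L²`. -/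
def MemSobolev {n : ℕ} : ℕ → (Torus n → ℂ) → Prop
  | 0, f => MemLp f 2 volume
  | k + 1, f => MemLp f 2 volume ∧ ∀ j : Fin n, ∃ g, HasWeakPartial j f g ∧ MemSobolev k g

/-- Square integrable vector fields `L²(𝕋ⁿ; ℂⁿ)`. -/
abbrev Field (n : ℕ) : Type := Lp (EuclideanSpace ℂ (Fin n)) 2 (volume : Measure (Torus n))

/-- Square integrable fields `V = (φ, h)` with `n + 1` components; `φ` is component `0` and `h`
consists of the components `1, …, n`. Complex values are allowed, because the eigenvectors of the
wave operator are complex. All products of fields below are bilinear (no conjugation). -/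
abbrev State (n : ℕ) : Type :=
  Lp (EuclideanSpace ℂ (Fin (n + 1))) 2 (volume : Measure (Torus n))

/-- The `L²` class of a function (and `0` if the function is not square integrable). -/
def toL2 {n m : ℕ} (f : Torus n → EuclideanSpace ℂ (Fin m)) :
    Lp (EuclideanSpace ℂ (Fin m)) 2 (volume : Measure (Torus n)) :=
  open Classical in if h : MemLp f 2 volume then h.toLp f else 0

/-- The integral over the torus of the dot product of two fields. -/
def dotInt {n m : ℕ} (F G : Torus n → EuclideanSpace ℂ (Fin m)) : ℂ := ∫ x, ∑ i, F x i * G x i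

/-- The space `𝔻` of all `(φ, h)` in `L²` such that `h = √ρ₀ ∇w` for some `w`. -/
def acousticSpace {n : ℕ} (ρ : Torus n → ℝ) : Set (State n) :=
  {V | ∃ w : Lp ℂ 2 (volume : Measure (Torus n)),
    ∀ j : Fin n, HasWeakPartial j w (fun x => V x j.succ / ((Real.sqrt (ρ x) : ℝ) : ℂ))}

/-- `V ∈ H^k(𝕋ⁿ)`, componentwise. -/
def StateMemSobolev {n : ℕ} (k : ℕ) (V : State n) : Prop :=
  ∀ i : Fin (n + 1), MemSobolev k (fun x => V x i)

/-- `W = L V` in the weak sense, for the wave operator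
`L (φ, h) = -(div (√ρ₀ h), √ρ₀ ∇φ)`, where `h = √ρ₀ ∇w`. -/
def IsWaveOperator {n : ℕ} (ρ : Torus n → ℝ) (V W : State n) : Prop :=
  V ∈ acousticSpace ρ ∧
  (∀ η : Torus n → ℝ, IsSmooth η →
    ∫ x, ∑ j : Fin n, ((Real.sqrt (ρ x) : ℝ) : ℂ) * V x j.succ * ((pd j η x : ℝ) : ℂ)
      = ∫ x, W x 0 * ((η x : ℝ) : ℂ)) ∧
  ∀ j : Fin n, HasWeakPartial j (fun x => V x 0)
    (fun x => -(W x j.succ / ((Real.sqrt (ρ x) : ℝ) : ℂ)))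

/-- The eigenspace of `L` for the eigenvalue `i μ`, with `μ` real. -/
def eigenspace {n : ℕ} (ρ : Torus n → ℝ) (μ : ℝ) : Submodule ℂ (State n) :=
  (Submodule.span ℂ
    {V : State n | IsWaveOperator ρ V ((Complex.I * (μ : ℂ)) • V)}).topologicalClosure

instance {n : ℕ} (ρ : Torus n → ℝ) (μ : ℝ) : (eigenspace ρ μ).HasOrthogonalProjection := by
  unfold eigenspace
  infer_instance

/-- The wave group `e^{τL}`, by the spectral decomposition of the skew-adjoint operator `L` on `𝔻`
(which has compact resolvent up to its kernel, hence pure point spectrum): the sum over all real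
`μ` of `e^{iμτ}` times the orthogonal projection onto the eigenspace of `i μ`. -/
def waveGroup {n : ℕ} (ρ : Torus n → ℝ) (τ : ℝ) (V : State n) : State n :=
  ∑' μ : ℝ, Complex.exp (Complex.I * (μ : ℂ) * (τ : ℂ)) • (eigenspace ρ μ).starProjection V

/-- The distribution
`B₂(V₁,V₂) = ½ div (h₁ ⊗ h₂ + h₂ ⊗ h₁) + ½ ∇ (φ₁ φ₂)`, with `(φₐ, hₐ) = e^{sL} Vₐ`,
applied to a vector field `u` of class `C¹`, that is `∫ B₂(V₁,V₂) · u dx` after the derivatives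
have been moved to `u`. The variable `s` is the fast time `t/ε`. -/
def B2pair {n : ℕ} (ρ : Torus n → ℝ) (s : ℝ) (V₁ V₂ : State n) (u : Torus n → Fin n → ℝ) : ℂ :=
  let U₁ := waveGroup ρ s V₁
  let U₂ := waveGroup ρ s V₂;
  -∫ x, ((1 / 2 : ℂ) * ∑ i : Fin n, ∑ j : Fin n,
          (U₁ x i.succ * U₂ x j.succ + U₂ x i.succ * U₁ x j.succ)
            * ((pd j (fun y => u y i) x : ℝ) : ℂ)
        + (1 / 2 : ℂ) * (U₁ x 0 * U₂ x 0) * ∑ i : Fin n, ((pd i (fun y => u y i) x : ℝ) : ℂ))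

/-- The `L²` field `b` is the distribution `B₂(V₁,V₂)` at fast time `s`. -/
def IsB2 {n : ℕ} (ρ : Torus n → ℝ) (s : ℝ) (V₁ V₂ : State n) (b : Field n) : Prop :=
  ∀ u : Torus n → Fin n → ℝ, (∀ i, IsSmooth (fun x => u x i)) →
    ∫ x, ∑ i, b x i * ((u x i : ℝ) : ℂ) = B2pair ρ s V₁ V₂ u

/-- `B₂(V₁,V₂)` at fast time `s` as an `L²` field, if it is one (and `0` otherwise). -/
def B2 {n : ℕ} (ρ : Torus n → ℝ) (s : ℝ) (V₁ V₂ : State n) : Field n :=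
  open Classical in if h : ∃ b, IsB2 ρ s V₁ V₂ b then h.choose else 0

/-- `g = ρ₀ ∇Ψ`, where `Ψ` is a weak solution of `div (ρ₀ ∇Ψ) = div f`; i.e. `g` is the gradient
part of `f` in the weighted Helmholtz decomposition. -/
def IsHelmholtzPerp {n : ℕ} (ρ : Torus n → ℝ) (f g : Field n) : Prop :=
  (∃ Ψ : Lp ℂ 2 (volume : Measure (Torus n)),
    ∀ j : Fin n, HasWeakPartial j Ψ (fun x => g x j / ((ρ x : ℝ) : ℂ))) ∧
  ∀ η : Torus n → ℝ, IsSmooth η →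
    ∫ x, ∑ j, g x j * ((pd j η x : ℝ) : ℂ) = ∫ x, ∑ j, f x j * ((pd j η x : ℝ) : ℂ)

/-- The projection `ℍ^⊥_{ρ₀}` of the weighted Helmholtz decomposition. -/
def helmholtzPerp {n : ℕ} (ρ : Torus n → ℝ) (f : Field n) : Field n :=
  open Classical in if h : ∃ g, IsHelmholtzPerp ρ f g then h.choose else 0

/-- The column vector `(0, ρ₀^{-1/2} ℍ^⊥_{ρ₀} f)`. -/
def forcing {n : ℕ} (ρ : Torus n → ℝ) (f : Field n) : State n :=
  toL2 (fun x => WithLp.toLp 2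
    (Fin.cons 0 (fun j => helmholtzPerp ρ f x j / ((Real.sqrt (ρ x) : ℝ) : ℂ))))

/-- The integrand `e^{-sL} (0, ρ₀^{-1/2} ℍ^⊥_{ρ₀} B₂(V₁,V₂))` of the averaged quadratic term. -/
def Q2integrand {n : ℕ} (ρ : Torus n → ℝ) (V₁ V₂ : State n) (s : ℝ) : State n :=
  waveGroup ρ (-s) (forcing ρ (B2 ρ s V₁ V₂))

/-- The average of the integrand over `[0, τ]`. -/
def Q2average {n : ℕ} (ρ : Torus n → ℝ) (V₁ V₂ : State n) (τ : ℝ) : State n :=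
  τ⁻¹ • ∫ s in (0 : ℝ)..τ, Q2integrand ρ V₁ V₂ s

/-- The averaged quadratic term `𝒬₂(V₁,V₂)`, the `L²` limit of the averages. -/
def Q2 {n : ℕ} (ρ : Torus n → ℝ) (V₁ V₂ : State n) : State n :=
  limUnder atTop (Q2average ρ V₁ V₂)

/-- `div (ρ₀ u) = 0` in the weak sense. -/
def WeightedDivFree {n : ℕ} (ρ : Torus n → ℝ) (u : Torus n → Fin n → ℝ) : Prop :=
  ∀ η : Torus n → ℝ, IsSmooth η → ∫ x, ∑ j, ρ x * u x j * pd j η x = 0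

end Anelastic

end

open MeasureTheory Filter Topology Set

noncomputable section

namespace Anelastic

open UnitAddTorus

/-! Write `g = h/√ρ`, so that `𝔻` consists of the states whose `g` is a gradient. An eigenvector for
`iα` satisfies `div(√ρ h) = -iα φ` and `∇φ = -iα g`. For eigenvectors `U`, `V` with eigenvalues
`iα`, `iβ`, these equations and `curl g = 0` turn the quadratic term into `-(i/2)(α+β)(φ_V g_U + φ_U
g_V) + ½ ρ ∇(g_U · g_V)` (`Rep.exists_quad_eq`).

Both limits against `u` follow. In a nonresonant pair (`α + β ≠ 0`) the factor `e^{i(α+β)s}`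
averages out. In a resonant pair only `ρ` times a gradient is left, and this is orthogonal to every
`u` with `div(ρu) = 0` (`Rep.sum_bil_quad_eq_zero`). A slowly varying parameter is frozen on short
intervals (`tendsto_integral_oscillating`).

For the cubic identities, pair the formula with `g_W`, where `W` has eigenvalue `iγ` and `α + β + γ
= 0`. The result is `(i/2)γ` times an expression symmetric in `U`, `V`, `W`, so the cyclic sum
carries the factor `α + β + γ = 0` (`Rep.sum_bil_quad_cyclic`). The bilinear transpose of `e^{-sL}`
on `𝔻` is `e^{sL}`, hence `∫ 𝒬₂(X,Y)·Z` is the time mean of the cubic form along the three orbits.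
Taking two arguments equal and using the symmetry of the form gives the last assertion, and taking
all three equal gives the one before it.

Passing from eigenvectors to all of `𝔻` needs two facts. The eigenvectors must be complete
(`Density.eq_zero_of_orthogonal`): the scalar resolvent `(1 - div ρ∇)⁻¹`, obtained from the
orthogonal projection onto the graph of `φ ↦ √ρ∇φ`, is compact and symmetric, and each of its
eigenfunctions produces eigenvectors of `L`. The forms must also be bounded in `L²`. For `C¹` test
fields they are, once the derivatives lie on `u`. For states in `H^k` one writes `V = SZ` with `S =
(1-L)^{-k}` on `𝔻`: by elliptic regularity the range of `S` is `𝔻 ∩ H^k`, it commutes with the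
group, and Sobolev embedding with the closed graph theorem makes the quadratic term of `SY`, `SZ` a
bounded bilinear map of `Y`, `Z` in `L²` (`Density.fieldL`). Density of the eigenvectors in the `L²`
norm then suffices throughout.

Weak derivatives are handled as Fourier multipliers, so integration by parts is Parseval's identity.
-/

variable {n : ℕ}

/-! ### Square integrable functions as a module over the continuous ones -/

/-- Scalar square integrable functions on the torus. -/
abbrev ScalarL2 (n : ℕ) : Type := Lp ℂ 2 (volume : Measure (Torus n))

/-- Continuous complex functions on the torus. -/
abbrev Cont (n : ℕ) : Type := C(Torus n, ℂ)

instance : IsProbabilityMeasure (volume : Measure UnitAddCircle) :=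
  ⟨UnitAddCircle.measure_univ⟩

/-- The square integrable class of a continuous function. -/
def cl : Cont n →L[ℂ] ScalarL2 n := ContinuousMap.toLp 2 volume ℂ

/-- Multiplication of a square integrable function by a continuous one. -/
def mulL : Cont n →L[ℂ] ScalarL2 n →L[ℂ] ScalarL2 n :=
  ((ContinuousLinearMap.mul ℂ ℂ).holderL volume ⊤ 2 2).comp
    (ContinuousMap.toLp (⊤ : ENNReal) (volume : Measure (Torus n)) ℂ)

/-- The bilinear pairing `∫ f g` of square integrable functions. -/
def bil : ScalarL2 n →L[ℂ] ScalarL2 n →L[ℂ] ℂ :=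
  (ContinuousLinearMap.mul ℂ ℂ).lpPairing volume 2 2

theorem cl_coeFn (c : Cont n) : cl c =ᵐ[volume] c := ContinuousMap.coeFn_toLp volume c

theorem cl_injective : Function.Injective (cl (n := n)) := ContinuousMap.toLp_injective _

theorem mulL_coeFn (c : Cont n) (f : ScalarL2 n) :
    mulL c f =ᵐ[volume] fun x => c x * f x := by
  have h := (ContinuousLinearMap.mul ℂ ℂ).coeFn_holder (r := 2)
    (ContinuousMap.toLp (⊤ : ENNReal) (volume : Measure (Torus n)) ℂ c) f
  have h2 := ContinuousMap.coeFn_toLp (p := (⊤ : ENNReal)) (𝕜 := ℂ)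
    (volume : Measure (Torus n)) c
  refine Filter.EventuallyEq.trans h ?_
  filter_upwards [h2] with x hx
  rw [ContinuousLinearMap.mul_apply', hx]

theorem bil_eq (f g : ScalarL2 n) : bil f g = ∫ x, f x * g x :=
  (ContinuousLinearMap.mul ℂ ℂ).lpPairing_eq_integral f g

theorem bil_comm (f g : ScalarL2 n) : bil f g = bil g f := by
  simp only [bil_eq, mul_comm]

instance : Module (Cont n) (ScalarL2 n) where
  smul c f := mulL c f
  one_smul f := by
    refine Lp.ext ?_
    filter_upwards [mulL_coeFn 1 f] with x hx
    change mulL 1 f x = f x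
    simpa using hx
  mul_smul c d f := by
    refine Lp.ext ?_
    filter_upwards [mulL_coeFn (c * d) f, mulL_coeFn c (mulL d f), mulL_coeFn d f] with x h1 h2 h3
    change mulL (c * d) f x = mulL c (mulL d f) x
    rw [h1, h2, h3, ContinuousMap.mul_apply, mul_assoc]
  smul_zero c := map_zero (mulL c)
  smul_add c := map_add (mulL c)
  add_smul c d f := by
    change mulL (c + d) f = mulL c f + mulL d f
    simp
  zero_smul f := by
    change mulL 0 f = 0
    simp

theorem cont_smul_def (c : Cont n) (f : ScalarL2 n) : c • f = mulL c f := rfl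

theorem cont_smul_coeFn (c : Cont n) (f : ScalarL2 n) : c • f =ᵐ[volume] fun x => c x * f x :=
  mulL_coeFn c f

instance : IsScalarTower ℂ (Cont n) (ScalarL2 n) where
  smul_assoc a c f := by simp [cont_smul_def]

theorem cont_smul_cl (c d : Cont n) : c • cl d = cl (c * d) := by
  refine Lp.ext ?_
  filter_upwards [cont_smul_coeFn c (cl d), cl_coeFn d, cl_coeFn (c * d)] with x h1 h2 h3
  rw [h1, h2, h3, ContinuousMap.mul_apply]

theorem bil_smul (c : Cont n) (f g : ScalarL2 n) : bil (c • f) g = bil f (c • g) := by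
  rw [bil_eq, bil_eq]
  refine integral_congr_ae ?_
  filter_upwards [cont_smul_coeFn c f, cont_smul_coeFn c g] with x h1 h2
  rw [h1, h2]; ring

/-! ### Fourier series and complex conjugation -/

theorem mFourier_add_apply (m : Fin n → ℤ) (x y : Torus n) :
    mFourier m (x + y) = mFourier m x * mFourier m y := by
  simp [mFourier, Finset.prod_mul_distrib, fourier_apply, smul_add, AddCircle.toCircle_add]

theorem mFourier_single_apply (m : Fin n → ℤ) (i : Fin n) (t : UnitAddCircle) :
    mFourier m (Pi.single i t) = fourier (m i) t := by
  simp only [mFourier, ContinuousMap.coe_mk]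
  rw [Finset.prod_eq_single i]
  · simp
  · intro j _ hj
    simp [Pi.single_eq_of_ne hj]
  · simp

/-- A translation by half a period in a coordinate with `m i ≠ 0` changes the sign of the character
and preserves the integral. -/
theorem integral_mFourier {m : Fin n → ℤ} (hm : m ≠ 0) : ∫ x : Torus n, mFourier m x = 0 := by
  obtain ⟨i, hi⟩ := Function.ne_iff.mp hm
  have hi' : m i ≠ 0 := by simpa using hi
  let a : Torus n := Pi.single i ((1 / 2 / (m i : ℝ) : ℝ) : UnitAddCircle)
  have ha : mFourier m a = -1 := by
    have := fourier_add_half_inv_index (T := 1) hi' one_pos 0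
    rw [mFourier_single_apply]
    simpa using this
  have h := integral_add_right_eq_self (μ := (volume : Measure (Torus n))) (mFourier m) a
  simp only [mFourier_add_apply, ha, mul_neg, mul_one] at h
  rw [integral_neg] at h
  exact self_eq_neg.mp h.symm

/-- The Fourier basis of the square integrable functions. -/
def fourierBasis : HilbertBasis (Fin n → ℤ) ℂ (ScalarL2 n) :=
  HilbertBasis.mk (v := fun m => cl (mFourier m)) (by
    rw [orthonormal_iff_ite]
    intro m k
    have h : inner ℂ (cl (mFourier m)) (cl (mFourier k)) = ∫ x : Torus n, mFourier (k - m) x := by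
      refine (ContinuousMap.inner_toLp (𝕜 := ℂ) volume (mFourier m) (mFourier k)).trans ?_
      refine integral_congr_ae (ae_of_all _ fun x => ?_)
      simp only [sub_eq_add_neg, mFourier_add, mFourier_neg]
    rw [h]
    split_ifs with hmk
    · simp [hmk, mFourier_zero]
    · exact integral_mFourier (sub_ne_zero.mpr (Ne.symm hmk))) (by
    have h := (ContinuousMap.toLp_denseRange ℂ (volume : Measure (Torus n)) ℂ
      (p := 2) (by simp)).topologicalClosure_map_submodule span_mFourier_closure_eq_top
    rw [Submodule.map_span, ← Set.range_comp] at h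
    exact h.ge)

theorem fourierBasis_apply (m : Fin n → ℤ) : fourierBasis m = cl (mFourier (d := Fin n) m) :=
  congrFun (HilbertBasis.coe_mk _ _) m

/-- The Fourier coefficient at frequency `m`. -/
def fc (m : Fin n → ℤ) : ScalarL2 n →L[ℂ] ℂ := bil (cl (mFourier (-m)))

theorem fc_def (m : Fin n → ℤ) (f : ScalarL2 n) : fc m f = bil (cl (mFourier (-m))) f := rfl

/-- Complex conjugation of square integrable functions. -/
def conjL : ScalarL2 n →L[ℝ] ScalarL2 n :=
  ContinuousLinearMap.compLpL 2 volume (Complex.conjCLE : ℂ →L[ℝ] ℂ)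

theorem conjL_coeFn (f : ScalarL2 n) : conjL f =ᵐ[volume] fun x => starRingEnd ℂ (f x) :=
  ContinuousLinearMap.coeFn_compLpL _ f

theorem conjL_conjL (f : ScalarL2 n) : conjL (conjL f) = f := by
  refine Lp.ext ?_
  filter_upwards [conjL_coeFn (conjL f), conjL_coeFn f] with x h1 h2
  rw [h1, h2, Complex.conj_conj]

theorem conjL_smul (a : ℂ) (f : ScalarL2 n) : conjL (a • f) = starRingEnd ℂ a • conjL f := by
  refine Lp.ext ?_
  filter_upwards [conjL_coeFn (a • f), conjL_coeFn f, Lp.coeFn_smul a f,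
    Lp.coeFn_smul (starRingEnd ℂ a) (conjL f)] with x h1 h2 h3 h4
  rw [h1, h3, h4, Pi.smul_apply, Pi.smul_apply, h2]
  simp

theorem conjL_cont_smul (c : Cont n) (f : ScalarL2 n) : conjL (c • f) = star c • conjL f := by
  refine Lp.ext ?_
  filter_upwards [conjL_coeFn (c • f), conjL_coeFn f, cont_smul_coeFn c f,
    cont_smul_coeFn (star c) (conjL f)] with x h1 h2 h3 h4
  rw [h1, h3, h4, h2]
  simp

theorem conjL_cl (c : Cont n) : conjL (cl c) = cl (star c) := by
  refine Lp.ext ?_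
  filter_upwards [conjL_coeFn (cl c), cl_coeFn c, cl_coeFn (star c)] with x h1 h2 h3
  rw [h1, h2, h3]; simp

theorem inner_eq_bil (f g : ScalarL2 n) : inner ℂ f g = bil (conjL f) g := by
  rw [L2.inner_def, bil_eq]
  refine integral_congr_ae ?_
  filter_upwards [conjL_coeFn f] with x h
  rw [h, RCLike.inner_apply, mul_comm]

theorem star_mFourier (m : Fin n → ℤ) : star (mFourier m) = mFourier (-m) := by
  ext x; simp [mFourier_neg]

theorem fc_eq_inner (m : Fin n → ℤ) (f : ScalarL2 n) : fc m f = inner ℂ (fourierBasis m) f := by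
  rw [inner_eq_bil, fourierBasis_apply, conjL_cl, star_mFourier, fc_def]

theorem fc_eq_repr (m : Fin n → ℤ) (f : ScalarL2 n) : fc m f = fourierBasis.repr f m := by
  rw [fc_eq_inner, HilbertBasis.repr_apply_apply]

theorem fc_ext {f g : ScalarL2 n} (h : ∀ m, fc m f = fc m g) : f = g := by
  apply fourierBasis.repr.injective
  ext m
  rw [← fc_eq_repr, ← fc_eq_repr, h]

theorem fc_conjL (m : Fin n → ℤ) (f : ScalarL2 n) :
    fc m (conjL f) = starRingEnd ℂ (fc (-m) f) := by
  rw [fc_def, fc_def, bil_eq, bil_eq, ← integral_conj]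
  refine integral_congr_ae ?_
  filter_upwards [conjL_coeFn f, cl_coeFn (mFourier (d := Fin n) (-m)),
    cl_coeFn (mFourier (d := Fin n) (-(-m)))] with x h1 h2 h3
  rw [h1, h2, h3, mFourier_neg, mFourier_neg, mFourier_neg]; simp

theorem hasSum_inner_fc (f g : ScalarL2 n) :
    HasSum (fun m => starRingEnd ℂ (fc m f) * fc m g) (inner ℂ f g) := by
  have h := fourierBasis.hasSum_inner_mul_inner f g
  refine h.congr_fun fun m => ?_
  rw [fc_eq_inner, fc_eq_inner, inner_conj_symm]

/-- Parseval for the pairing without conjugation: the frequency `m` meets `-m`. -/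
theorem hasSum_bil_fc (f g : ScalarL2 n) :
    HasSum (fun m => fc (-m) f * fc m g) (bil f g) := by
  have h := hasSum_inner_fc (conjL f) g
  rw [inner_eq_bil, conjL_conjL] at h
  refine h.congr_fun fun m => ?_
  rw [fc_conjL, Complex.conj_conj]

theorem hasSum_norm_sq_fc (f : ScalarL2 n) : HasSum (fun m => ‖fc m f‖ ^ 2) (‖f‖ ^ 2) := by
  have h := RCLike.hasSum_re ℂ (hasSum_inner_fc f f)
  rw [← norm_sq_eq_re_inner] at h
  refine h.congr_fun fun m => ?_
  rw [mul_comm, Complex.mul_conj, Complex.normSq_eq_norm_sq]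
  exact (Complex.ofReal_re _).symm

theorem summable_norm_sq_fc (f : ScalarL2 n) : Summable fun m => ‖fc m f‖ ^ 2 :=
  (hasSum_norm_sq_fc f).summable

theorem fc_fourier (m k : Fin n → ℤ) : fc m (cl (mFourier k)) = if m = k then 1 else 0 := by
  rw [fc_eq_inner, ← fourierBasis_apply]
  exact orthonormal_iff_ite.mp fourierBasis.orthonormal m k

theorem exists_fc_eq {a : (Fin n → ℤ) → ℂ} (h : Summable fun m => ‖a m‖ ^ 2) :
    ∃ f : ScalarL2 n, ∀ m, fc m f = a m := by
  have ha : Memℓp a 2 := by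
    rw [memℓp_gen_iff (by norm_num)]
    simpa using h
  refine ⟨fourierBasis.repr.symm ⟨a, ha⟩, fun m => ?_⟩
  rw [fc_eq_repr, LinearIsometryEquiv.apply_symm_apply]

theorem fc_mFourier_smul (m k : Fin n → ℤ) (f : ScalarL2 n) :
    fc m (mFourier k • f) = fc (m - k) f := by
  rw [fc_def, ← bil_smul, cont_smul_cl, fc_def]
  congr 3
  ext x
  rw [ContinuousMap.mul_apply, ← mFourier_add]
  congr 2
  abel_nf

/-! ### Weak derivatives and divergences as Fourier multipliers -/

/-- The Fourier multiplier `2πi mⱼ` of the partial derivative `∂ⱼ`. -/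
def freq (m : Fin n → ℤ) (j : Fin n) : ℂ := 2 * Real.pi * Complex.I * (m j : ℂ)

theorem freq_neg (m : Fin n → ℤ) (j : Fin n) : freq (-m) j = -freq m j := by
  simp [freq]

theorem freq_sub (m k : Fin n → ℤ) (j : Fin n) : freq (m - k) j = freq m j - freq k j := by
  simp [freq]; ring

theorem conj_freq (m : Fin n → ℤ) (j : Fin n) : starRingEnd ℂ (freq m j) = -freq m j := by
  simp only [freq, map_mul, Complex.conj_ofReal, Complex.conj_I, map_intCast, map_ofNat]
  ring

/-- `g` is the weak partial derivative `∂ⱼ f`, in terms of Fourier coefficients. -/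
def WD (j : Fin n) (f g : ScalarL2 n) : Prop := ∀ m, fc m g = freq m j * fc m f

/-- `div F = c` in the weak sense, in terms of Fourier coefficients. -/
def WDiv (F : Fin n → ScalarL2 n) (c : ScalarL2 n) : Prop :=
  ∀ m, ∑ j, freq m j * fc m (F j) = fc m c

theorem WD.unique {j : Fin n} {f g g' : ScalarL2 n} (h : WD j f g) (h' : WD j f g') : g = g' :=
  fc_ext fun m => by rw [h m, h' m]

theorem WD.zero (j : Fin n) : WD j (0 : ScalarL2 n) 0 := fun m => by simp

theorem WD.add {j : Fin n} {f g f' g' : ScalarL2 n} (h : WD j f g) (h' : WD j f' g') :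
    WD j (f + f') (g + g') := fun m => by simp only [map_add, h m, h' m, mul_add]

theorem WD.smul {j : Fin n} {f g : ScalarL2 n} (a : ℂ) (h : WD j f g) :
    WD j (a • f) (a • g) := fun m => by simp only [map_smul, h m, smul_eq_mul]; ring

theorem WD.sub {j : Fin n} {f g f' g' : ScalarL2 n} (h : WD j f g) (h' : WD j f' g') :
    WD j (f - f') (g - g') := fun m => by simp only [map_sub, h m, h' m, mul_sub]

theorem WD.sum {ι : Type*} (s : Finset ι) {j : Fin n} {f g : ι → ScalarL2 n}
    (h : ∀ i ∈ s, WD j (f i) (g i)) : WD j (∑ i ∈ s, f i) (∑ i ∈ s, g i) := fun m => by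
  simp only [map_sum, Finset.mul_sum]
  exact Finset.sum_congr rfl fun i hi => h i hi m

theorem WD.conj {j : Fin n} {f g : ScalarL2 n} (h : WD j f g) : WD j (conjL f) (conjL g) :=
  fun m => by rw [fc_conjL, fc_conjL, h, map_mul, conj_freq, freq_neg, neg_neg]

theorem WD.comm {i j : Fin n} {f gi gj hij hji : ScalarL2 n} (hi : WD i f gi) (hj : WD j f gj)
    (h1 : WD j gi hij) (h2 : WD i gj hji) : hij = hji :=
  fc_ext fun m => by rw [h1, h2, hi, hj]; ring

/-- The multiplier is odd in `m`, and the bilinear Parseval identity pairs `m` with `-m`. -/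
theorem WD.ibp {j : Fin n} {f f' g g' : ScalarL2 n} (hf : WD j f f') (hg : WD j g g') :
    bil f g' = -bil f' g := by
  have h1 := hasSum_bil_fc f g'
  have h2 := (hasSum_bil_fc f' g).neg
  refine h1.unique (h2.congr_fun fun m => ?_)
  rw [hf, hg, freq_neg]; ring

/-- Only the sum of the derivatives of `F` has to be square integrable. This form of Green's formula
serves the wave equation, where `√ρ h` has a divergence but no separate derivatives. -/
theorem WDiv.pair {F : Fin n → ScalarL2 n} {c q : ScalarL2 n} {q' : Fin n → ScalarL2 n}
    (hF : WDiv F c) (hq : ∀ j, WD j q (q' j)) : ∑ j, bil (F j) (q' j) = -bil c q := by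
  have h1 : HasSum (fun m => ∑ j, fc (-m) (F j) * fc m (q' j)) (∑ j, bil (F j) (q' j)) :=
    hasSum_sum fun j _ => hasSum_bil_fc (F j) (q' j)
  have h2 := (hasSum_bil_fc c q).neg
  refine h1.unique (h2.congr_fun fun m => ?_)
  rw [← hF (-m), Finset.sum_mul, ← Finset.sum_neg_distrib]
  refine Finset.sum_congr rfl fun j _ => ?_
  rw [hq, freq_neg]; ring

theorem WDiv.unique {F : Fin n → ScalarL2 n} {c c' : ScalarL2 n}
    (h : WDiv F c) (h' : WDiv F c') : c = c' :=
  fc_ext fun m => by rw [← h, ← h']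

theorem WDiv.of_WD {F : Fin n → ScalarL2 n} {G : Fin n → ScalarL2 n}
    (h : ∀ j, WD j (F j) (G j)) : WDiv F (∑ j, G j) := fun m => by
  rw [map_sum]
  exact Finset.sum_congr rfl fun j _ => (h j m).symm

theorem WDiv.conj {F : Fin n → ScalarL2 n} {c : ScalarL2 n} (h : WDiv F c) :
    WDiv (fun j => conjL (F j)) (conjL c) := fun m => by
  rw [fc_conjL, ← h, map_sum]
  refine Finset.sum_congr rfl fun j _ => ?_
  rw [fc_conjL, map_mul, conj_freq, freq_neg, neg_neg]

theorem WD.mFourier_smul {j : Fin n} {f g : ScalarL2 n} (h : WD j f g) (k : Fin n → ℤ) :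
    WD j (mFourier k • f) (mFourier k • g + freq k j • mFourier (d := Fin n) k • f) := fun m => by
  rw [map_add, ContinuousLinearMap.map_smul, fc_mFourier_smul, fc_mFourier_smul, h, freq_sub, smul_eq_mul]
  ring

theorem fc_cont_smul (m : Fin n → ℤ) (c : Cont n) (f : ScalarL2 n) :
    fc m (c • f) = bil f (mFourier (-m) • cl c) := by
  rw [fc_def, ← bil_smul, cont_smul_cl, bil_comm, cont_smul_cl, mul_comm]

/-- The product rule for two continuous functions with weak derivatives in `L²`. -/
theorem WD.mul {j : Fin n} {c d : Cont n} {c' d' : ScalarL2 n} (hc : WD j (cl c) c')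
    (hd : WD j (cl d) d') : WD j (cl (c * d)) (c • d' + d • c') := fun m => by
  -- Testing `c` against the derivative of `e_{-m} d` produces the coefficient of the product rule
  -- at `m`.
  have h := hc.ibp (hd.mFourier_smul (-m))
  rw [map_add, ContinuousLinearMap.map_smul, freq_neg] at h
  have h1 : fc m (c • d') = bil (cl c) (mFourier (-m) • d') := by
    rw [fc_def, ← bil_smul, cont_smul_cl, mul_comm, ← cont_smul_cl, bil_smul]
  rw [map_add, h1, fc_cont_smul, ← cont_smul_cl, fc_cont_smul, bil_comm (cl d)]
  rw [smul_eq_mul] at h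
  have h2 : bil (mFourier (-m) • cl c) (cl d) = bil (cl c) (mFourier (-m) • cl d) := bil_smul _ _ _
  rw [h2]
  linear_combination h

/-- The product rule for a square integrable and a continuously differentiable function. -/
theorem WD.cont_smul {j : Fin n} {c c' : Cont n} {f g : ScalarL2 n} (hc : WD j (cl c) (cl c'))
    (hf : WD j f g) : WD j (c • f) (c • g + c' • f) := fun m => by
  have h := hf.ibp (hc.mFourier_smul (-m))
  rw [map_add, ContinuousLinearMap.map_smul, freq_neg, smul_eq_mul] at h
  rw [map_add, fc_cont_smul, fc_cont_smul, fc_cont_smul]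
  linear_combination h

/-! ### Classical derivatives are weak derivatives -/

/-- `c'` is the classical partial derivative `∂ⱼ c`. -/
def HasPD (j : Fin n) (c c' : Cont n) : Prop :=
  ∀ x, HasDerivAt (fun t : ℝ => c (x + Pi.single j (t : UnitAddCircle))) (c' x) 0

theorem HasPD.mul {j : Fin n} {c c' d d' : Cont n} (hc : HasPD j c c') (hd : HasPD j d d') :
    HasPD j (c * d) (c' * d + c * d') := fun x => by
  have := (hc x).mul (hd x)
  simp only [AddCircle.coe_zero, Pi.single_zero, add_zero] at this
  exact this

theorem HasPD.hasDerivAt {j : Fin n} {c c' : Cont n} (hc : HasPD j c c') (x : Torus n) (t : ℝ) :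
    HasDerivAt (fun t : ℝ => c (x + Pi.single j (t : UnitAddCircle)))
      (c' (x + Pi.single j (t : UnitAddCircle))) t := by
  have h := hc (x + Pi.single j (t : UnitAddCircle))
  have h2 : HasDerivAt (fun s : ℝ => s - t) 1 t := (hasDerivAt_id t).sub_const t
  have h3 := HasDerivAt.scomp_of_eq t h h2 (sub_self t).symm
  rw [one_smul] at h3
  refine h3.congr_of_eventuallyEq (Eventually.of_forall fun s => ?_)
  simp only [Function.comp]
  rw [add_assoc, ← Pi.single_add, ← AddCircle.coe_add, add_sub_cancel]

/-- Differentiation under the integral sign, with the constant bound as dominating function. -/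
theorem integral_deriv_eq_zero_of_integral_const {α : Type*} [MeasurableSpace α] {μ : Measure α}
    [IsFiniteMeasure μ] {F F' : ℝ → α → ℂ} {C : ℝ} {I : ℂ} (hF : ∀ t, Integrable (F t) μ)
    (hF' : ∀ t, AEStronglyMeasurable (F' t) μ) (hC : ∀ t x, ‖F' t x‖ ≤ C)
    (hd : ∀ t x, HasDerivAt (fun t => F t x) (F' t x) t) (hI : ∀ t, ∫ x, F t x ∂μ = I) :
    ∫ x, F' 0 x ∂μ = 0 := by
  have key := (hasDerivAt_integral_of_dominated_loc_of_deriv_le (μ := μ) (F := F) (F' := F')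
    (x₀ := (0 : ℝ)) (bound := fun _ => C) univ_mem
    (Eventually.of_forall fun t => (hF t).aestronglyMeasurable) (hF 0) (hF' 0)
    (ae_of_all _ fun x t _ => hC t x) (integrable_const _) (ae_of_all _ fun x t _ => hd t x)).2
  simp only [hI] at key
  exact key.unique (hasDerivAt_const _ _)

/-- By translation invariance the integral of `c (x + a t)` does not depend on `t`. -/
theorem integral_eq_zero_of_hasDerivAt_translate {c c' : Cont n} (a : ℝ → Torus n) (ha : a 0 = 0)
    (hd : ∀ t x, HasDerivAt (fun t => c (x + a t)) (c' (x + a t)) t) : ∫ x, c' x = 0 := by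
  have hcont : ∀ d : Cont n, ∀ t : ℝ, Continuous fun x : Torus n => d (x + a t) :=
    fun d t => d.continuous.comp (continuous_id.add continuous_const)
  have h := integral_deriv_eq_zero_of_integral_const (μ := (volume : Measure (Torus n)))
    (F := fun (t : ℝ) (x : Torus n) => c (x + a t))
    (F' := fun (t : ℝ) (x : Torus n) => c' (x + a t)) (C := ‖c'‖) (I := ∫ x, c x)
    (fun t => (hcont c t).integrable_of_hasCompactSupport (HasCompactSupport.of_compactSpace _))
    (fun t => (hcont c' t).aestronglyMeasurable) (fun t x => c'.norm_coe_le_norm _)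
    hd (fun t => integral_add_right_eq_self _ _)
  simpa [ha] using h

theorem HasPD.integral_eq_zero {j : Fin n} {c c' : Cont n} (hc : HasPD j c c') :
    ∫ x, c' x = 0 :=
  integral_eq_zero_of_hasDerivAt_translate (fun t => Pi.single j (t : UnitAddCircle)) (by simp)
    fun t x => hc.hasDerivAt x t

theorem hasPD_mFourier (m : Fin n → ℤ) (j : Fin n) :
    HasPD j (mFourier m) (freq m j • mFourier m) := fun x => by
  simp only [mFourier_add_apply, mFourier_single_apply]
  have h := (hasDerivAt_fourier 1 (m j) 0).const_mul (mFourier m x)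
  refine h.congr_deriv ?_
  simp [freq]
  ring

/-- The derivative of `e_{-m} c` has integral zero; expanding it gives the relation between the
coefficients. -/
theorem HasPD.wd {j : Fin n} {c c' : Cont n} (hc : HasPD j c c') : WD j (cl c) (cl c') := fun m => by
  have h := ((hasPD_mFourier (-m) j).mul hc).integral_eq_zero
  have hb : ∀ d : Cont n, fc m (cl d) = ∫ x, mFourier (-m) x * d x := fun d => by
    rw [fc_def, bil_eq]
    refine integral_congr_ae ?_
    filter_upwards [cl_coeFn (mFourier (d := Fin n) (-m)), cl_coeFn d] with x h1 h2
    rw [h1, h2]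
  have hi : ∀ d : Cont n, Integrable (fun x => mFourier (-m) x * d x) volume := fun d =>
    (Continuous.mul (map_continuous _) (map_continuous _)).integrable_of_hasCompactSupport
      (HasCompactSupport.of_compactSpace _)
  rw [hb, hb, ← integral_const_mul]
  simp only [ContinuousMap.add_apply, ContinuousMap.mul_apply, ContinuousMap.smul_apply,
    freq_neg, smul_eq_mul] at h
  rw [integral_add ((hi c).const_mul (-freq m j) |>.congr (ae_of_all _ fun x => by ring)) (hi c')] at h
  rw [← sub_eq_zero, ← h, sub_eq_add_neg, add_comm, ← integral_neg]
  congr 2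
  ext x
  ring

/-! ### Smooth test functions and the equivalence with distributional derivatives -/

/-- The projection `ℝⁿ → 𝕋ⁿ`. -/
def proj (x : Fin n → ℝ) : Torus n := fun i => (x i : UnitAddCircle)

theorem isOpenQuotientMap_proj : IsOpenQuotientMap (proj (n := n)) :=
  IsOpenQuotientMap.piMap fun _ => QuotientAddGroup.isOpenQuotientMap_mk

theorem proj_surjective : Function.Surjective (proj (n := n)) := isOpenQuotientMap_proj.surjective

theorem proj_add_single (x : Fin n → ℝ) (j : Fin n) (t : ℝ) :
    proj x + Pi.single j (t : UnitAddCircle) = proj (x + t • Pi.single j 1) := by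
  ext i
  rcases eq_or_ne i j with rfl | h
  · simp [proj]
  · simp [proj, h]

theorem IsCk.mono {k l : WithTop ℕ∞} {f : Torus n → ℝ} (hf : IsCk k f) (h : l ≤ k) : IsCk l f :=
  ContDiff.of_le hf h

theorem IsCk.continuous {k : WithTop ℕ∞} {f : Torus n → ℝ} (hf : IsCk k f) : Continuous f :=
  isOpenQuotientMap_proj.isQuotientMap.continuous_iff.mpr (ContDiff.continuous hf)

theorem IsCk.hasDerivAt {f : Torus n → ℝ} (hf : IsCk 1 f) (j : Fin n) (x : Fin n → ℝ) :
    HasDerivAt (fun t : ℝ => f (proj x + Pi.single j (t : UnitAddCircle)))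
      (fderiv ℝ (fun y => f (proj y)) x (Pi.single j 1)) 0 := by
  simp only [proj_add_single]
  have h1 : HasFDerivAt (fun y => f (proj y)) (fderiv ℝ (fun y => f (proj y)) x)
      (x + (0 : ℝ) • Pi.single j 1) := by
    rw [zero_smul, add_zero]
    exact ((ContDiff.differentiable hf one_ne_zero) x).hasFDerivAt
  have h2 : HasDerivAt (fun t : ℝ => x + t • (Pi.single j 1 : Fin n → ℝ)) (Pi.single j 1) 0 := by
    simpa using ((hasDerivAt_id (0 : ℝ)).smul_const (Pi.single j 1 : Fin n → ℝ)).const_add x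
  exact h1.comp_hasDerivAt 0 h2

theorem IsCk.pd_proj {f : Torus n → ℝ} (hf : IsCk 1 f) (j : Fin n) (x : Fin n → ℝ) :
    pd j f (proj x) = fderiv ℝ (fun y => f (proj y)) x (Pi.single j 1) :=
  (hf.hasDerivAt j x).deriv

theorem IsCk.hasDerivAt_pd {f : Torus n → ℝ} (hf : IsCk 1 f) (j : Fin n) (x : Torus n) :
    HasDerivAt (fun t : ℝ => f (x + Pi.single j (t : UnitAddCircle))) (pd j f x) 0 := by
  obtain ⟨x, rfl⟩ := proj_surjective x
  rw [hf.pd_proj]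
  exact hf.hasDerivAt j x

theorem IsCk.pd {k l : WithTop ℕ∞} {f : Torus n → ℝ} (hf : IsCk l f) (h : k + 1 ≤ l) (j : Fin n) :
    IsCk k (pd j f) := by
  have h1 : IsCk 1 f := hf.mono (le_trans le_add_self h)
  have h2 : ContDiff ℝ k fun x => fderiv ℝ (fun y => f (proj y)) x (Pi.single j 1) :=
    (ContDiff.fderiv_right hf h).clm_apply contDiff_const
  have h3 : (fun x => Anelastic.pd j f (proj x))
      = fun x => fderiv ℝ (fun y => f (proj y)) x (Pi.single j 1) := funext fun x => h1.pd_proj j x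
  rw [← h3] at h2
  exact h2

/-- A real function as a continuous complex function (and `0` if it is not continuous). -/
def rc (f : Torus n → ℝ) : Cont n :=
  open Classical in if h : Continuous f then ⟨fun x => (f x : ℂ), Complex.continuous_ofReal.comp h⟩
  else 0

theorem rc_apply {f : Torus n → ℝ} (hf : Continuous f) (x : Torus n) : rc f x = (f x : ℂ) := by
  rw [rc, dif_pos hf]; rfl

theorem star_rc (f : Torus n → ℝ) : star (rc f) = rc f := by
  by_cases hf : Continuous f
  · ext x; simp [rc_apply hf]
  · rw [rc, dif_neg hf, star_zero]

theorem IsCk.hasPD {f : Torus n → ℝ} (hf : IsCk 1 f) (j : Fin n) :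
    HasPD j (rc f) (rc (Anelastic.pd j f)) := fun x => by
  have h0 : IsCk 0 (Anelastic.pd j f) := hf.pd (by simp) j
  simp only [rc_apply hf.continuous, rc_apply h0.continuous]
  exact (hf.hasDerivAt_pd j x).ofReal_comp

theorem integral_mul_real (f : ScalarL2 n) {η : Torus n → ℝ} (hη : Continuous η) :
    ∫ x, f x * ((η x : ℝ) : ℂ) = bil f (cl (rc η)) := by
  rw [bil_eq]
  refine integral_congr_ae ?_
  filter_upwards [cl_coeFn (rc η)] with x h
  rw [h, rc_apply hη]

theorem integrable_mul (f g : ScalarL2 n) : Integrable (fun x => f x * g x) volume :=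
  MemLp.integrable_mul (Lp.memLp f) (Lp.memLp g)

theorem integrable_mul_real (f : ScalarL2 n) {η : Torus n → ℝ} (hη : Continuous η) :
    Integrable (fun x => f x * ((η x : ℝ) : ℂ)) volume := by
  refine (integrable_mul f (cl (rc η))).congr ?_
  filter_upwards [cl_coeFn (rc η)] with x h
  rw [h, rc_apply hη]

theorem contDiff_mFourier_proj (m : Fin n → ℤ) (k : WithTop ℕ∞) :
    ContDiff ℝ k fun x : Fin n → ℝ => mFourier m (proj x) := by
  simp only [mFourier, ContinuousMap.coe_mk, proj, fourier_coe_apply]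
  refine contDiff_prod fun i _ => ContDiff.cexp ?_
  refine ContDiff.div_const (contDiff_const.mul ?_) _
  exact Complex.ofRealCLM.contDiff.comp (contDiff_apply ℝ ℝ i)

theorem isCk_re_mFourier (m : Fin n → ℤ) (k : WithTop ℕ∞) :
    IsCk k fun x => (mFourier m x).re :=
  Complex.reCLM.contDiff.comp (contDiff_mFourier_proj m k)

theorem isCk_im_mFourier (m : Fin n → ℤ) (k : WithTop ℕ∞) :
    IsCk k fun x => (mFourier m x).im :=
  Complex.imCLM.contDiff.comp (contDiff_mFourier_proj m k)

theorem rc_re_add_im (c : Cont n) :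
    rc (fun x => (c x).re) + Complex.I • rc (fun x => (c x).im) = c := by
  ext x
  have h1 : Continuous fun x => (c x).re := Complex.continuous_re.comp c.continuous
  have h2 : Continuous fun x => (c x).im := Complex.continuous_im.comp c.continuous
  rw [ContinuousMap.add_apply, ContinuousMap.smul_apply, rc_apply h1, rc_apply h2, smul_eq_mul, mul_comm]
  exact Complex.re_add_im _

theorem HasPD.pd_re {j : Fin n} {c c' : Cont n} (h : HasPD j c c') (x : Torus n) :
    pd j (fun x => (c x).re) x = (c' x).re :=
  (Complex.reCLM.hasFDerivAt.comp_hasDerivAt (0 : ℝ) (h x)).deriv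

theorem HasPD.pd_im {j : Fin n} {c c' : Cont n} (h : HasPD j c c') (x : Torus n) :
    pd j (fun x => (c x).im) x = (c' x).im :=
  (Complex.imCLM.hasFDerivAt.comp_hasDerivAt (0 : ℝ) (h x)).deriv

theorem rc_pd_re_add_im {j : Fin n} {c c' : Cont n} (h : HasPD j c c') :
    rc (pd j fun x => (c x).re) + Complex.I • rc (pd j fun x => (c x).im) = c' := by
  rw [show (pd j fun x => (c x).re) = _ from funext h.pd_re,
    show (pd j fun x => (c x).im) = _ from funext h.pd_im, rc_re_add_im]

theorem WDiv.test {F : Fin n → ScalarL2 n} {c : ScalarL2 n} (h : WDiv F c) {η : Torus n → ℝ}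
    (hη : IsCk 1 η) : ∑ j, bil (F j) (cl (rc (pd j η))) = -bil c (cl (rc η)) :=
  h.pair fun j => (hη.hasPD j).wd

/-- Test functions are real, so the real and imaginary parts of `e_{-m}` are used separately and
then recombined. -/
theorem wdiv_of_test {F : Fin n → ScalarL2 n} {c : ScalarL2 n}
    (h : ∀ η : Torus n → ℝ, IsSmooth η →
      ∑ j, bil (F j) (cl (rc (pd j η))) = -bil c (cl (rc η))) : WDiv F c := fun m => by
  have h1 := h _ (isCk_re_mFourier (-m) _)
  have h2 := h _ (isCk_im_mFourier (-m) _)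
  have h3 : ∀ j, bil (F j) (cl (rc (pd j fun x => (mFourier (-m) x).re)))
      + Complex.I * bil (F j) (cl (rc (pd j fun x => (mFourier (-m) x).im)))
      = freq (-m) j * fc m (F j) := fun j => by
    rw [← smul_eq_mul, ← ContinuousLinearMap.map_smul, ← ContinuousLinearMap.map_smul, ← map_add,
      ← map_add, rc_pd_re_add_im (hasPD_mFourier (-m) j), ContinuousLinearMap.map_smul,
      ContinuousLinearMap.map_smul, bil_comm]
    rfl
  have h4 : bil c (cl (rc fun x => (mFourier (-m) x).re))
      + Complex.I * bil c (cl (rc fun x => (mFourier (-m) x).im)) = fc m c := by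
    rw [← smul_eq_mul, ← ContinuousLinearMap.map_smul, ← ContinuousLinearMap.map_smul, ← map_add,
      ← map_add, rc_re_add_im, bil_comm]
    rfl
  have h5 := Finset.sum_congr (rfl : (Finset.univ : Finset (Fin n)) = Finset.univ)
    fun j _ => h3 j
  rw [Finset.sum_add_distrib, ← Finset.mul_sum, h1, h2] at h5
  simp only [freq_neg, neg_mul, Finset.sum_neg_distrib] at h5
  linear_combination h4 + h5

theorem wdiv_iff_test (F : Fin n → ScalarL2 n) (c : ScalarL2 n) :
    WDiv F c ↔ ∀ η : Torus n → ℝ, IsSmooth η →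
      ∑ j, bil (F j) (cl (rc (pd j η))) = -bil c (cl (rc η)) :=
  ⟨fun h _ hη => h.test (hη.mono (by norm_cast)), wdiv_of_test⟩

/-- A partial derivative is the divergence of a field with one nonzero component, so one test
criterion covers both notions. -/
theorem wdiv_single_iff (j : Fin n) (f g : ScalarL2 n) : WDiv (Pi.single j f) g ↔ WD j f g := by
  refine forall_congr' fun m => ?_
  rw [Finset.sum_eq_single j, Pi.single_eq_same, eq_comm]
  · intro i _ hi
    rw [Pi.single_eq_of_ne hi, map_zero, mul_zero]
  · simp

theorem hasWeakPartial_iff {j : Fin n} {f g : Torus n → ℂ} {F G : ScalarL2 n}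
    (hf : f =ᵐ[volume] F) (hg : g =ᵐ[volume] G) : HasWeakPartial j f g ↔ WD j F G := by
  rw [← wdiv_single_iff, wdiv_iff_test]
  refine forall₂_congr fun η hη => ?_
  have hη1 : IsCk 1 η := hη.mono (by norm_cast)
  have hpd : Continuous (pd j η) := (hη1.pd (k := 0) (by simp) j).continuous
  rw [Finset.sum_eq_single j, Pi.single_eq_same, ← integral_mul_real _ hpd,
    ← integral_mul_real _ hη1.continuous]
  · rw [integral_congr_ae (hf.mono fun x hx => by simp only [hx] :
        (fun x => f x * ((pd j η x : ℝ) : ℂ)) =ᵐ[volume] fun x => F x * ((pd j η x : ℝ) : ℂ)),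
      integral_congr_ae (hg.mono fun x hx => by simp only [hx] :
        (fun x => g x * ((η x : ℝ) : ℂ)) =ᵐ[volume] fun x => G x * ((η x : ℝ) : ℂ))]
  · intro i _ hi
    rw [Pi.single_eq_of_ne hi, map_zero, zero_apply]
  · simp

/-! ### Sobolev spaces and the Sobolev embedding -/

/-- `k` times continuously differentiable, by iterated classical partial derivatives. -/
def ContDeriv : ℕ → Cont n → Prop
  | 0, _ => True
  | k + 1, c => ∀ j, ∃ c', HasPD j c c' ∧ ContDeriv k c'

theorem IsCk.contDeriv {k : ℕ} : ∀ {f : Torus n → ℝ}, IsCk (k : WithTop ℕ∞) f →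
    ContDeriv k (rc f) := by
  induction k with
  | zero => intro f _; trivial
  | succ k ih =>
    intro f hf j
    have h1 : IsCk 1 f := hf.mono (by norm_cast; simp)
    exact ⟨rc (Anelastic.pd j f), h1.hasPD j, ih (hf.pd (by norm_cast) j)⟩

/-- The Sobolev space `H^k` as a predicate on square integrable classes. -/
def Sob : ℕ → ScalarL2 n → Prop
  | 0, _ => True
  | k + 1, f => ∀ j, ∃ g, WD j f g ∧ Sob k g

theorem MemSobolev.memLp {k : ℕ} {f : Torus n → ℂ} (h : MemSobolev k f) : MemLp f 2 volume := by
  cases k with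
  | zero => exact h
  | succ k => exact h.1

theorem memSobolev_iff {k : ℕ} : ∀ {f : Torus n → ℂ} {F : ScalarL2 n}, f =ᵐ[volume] F →
    (MemSobolev k f ↔ Sob k F) := by
  induction k with
  | zero => exact fun {f F} h => ⟨fun _ => trivial, fun _ => (Lp.memLp F).ae_eq h.symm⟩
  | succ k ih =>
    intro f F h
    constructor
    · rintro ⟨_, hf⟩ j
      obtain ⟨g, hg, hk⟩ := hf j
      have hgG : g =ᵐ[volume] hk.memLp.toLp g := hk.memLp.coeFn_toLp.symm
      exact ⟨hk.memLp.toLp g, (hasWeakPartial_iff h hgG).mp hg, (ih hgG).mp hk⟩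
    · intro hF
      refine ⟨(Lp.memLp F).ae_eq h.symm, fun j => ?_⟩
      obtain ⟨G, hG, hk⟩ := hF j
      exact ⟨G, (hasWeakPartial_iff h EventuallyEq.rfl).mpr hG, (ih EventuallyEq.rfl).mpr hk⟩

theorem Sob.pred {k : ℕ} : ∀ {f : ScalarL2 n}, Sob (k + 1) f → Sob k f := by
  induction k with
  | zero => exact fun _ => trivial
  | succ k ih =>
    intro f h j
    obtain ⟨g, h1, h2⟩ := h j
    exact ⟨g, h1, ih h2⟩

theorem Sob.mono {k l : ℕ} {f : ScalarL2 n} (h : Sob l f) (hkl : k ≤ l) : Sob k f := by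
  induction hkl with
  | refl => exact h
  | step _ ih => exact ih h.pred

theorem Sob.zero (k : ℕ) : Sob k (0 : ScalarL2 n) := by
  induction k with
  | zero => trivial
  | succ k ih => exact fun j => ⟨0, WD.zero j, ih⟩

theorem Sob.add {k : ℕ} : ∀ {f g : ScalarL2 n}, Sob k f → Sob k g → Sob k (f + g) := by
  induction k with
  | zero => exact fun _ _ => trivial
  | succ k ih =>
    intro f g hf hg j
    obtain ⟨f', h1, h2⟩ := hf j
    obtain ⟨g', h3, h4⟩ := hg j
    exact ⟨f' + g', h1.add h3, ih h2 h4⟩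

theorem Sob.smul {k : ℕ} (a : ℂ) : ∀ {f : ScalarL2 n}, Sob k f → Sob k (a • f) := by
  induction k with
  | zero => exact fun _ => trivial
  | succ k ih =>
    intro f hf j
    obtain ⟨f', h1, h2⟩ := hf j
    exact ⟨a • f', h1.smul a, ih h2⟩

theorem Sob.neg {k : ℕ} {f : ScalarL2 n} (h : Sob k f) : Sob k (-f) := by
  simpa using h.smul (-1)

theorem Sob.sub {k : ℕ} {f g : ScalarL2 n} (hf : Sob k f) (hg : Sob k g) : Sob k (f - g) := by
  rw [sub_eq_add_neg]; exact hf.add hg.neg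

theorem Sob.sum {k : ℕ} {ι : Type*} (s : Finset ι) {f : ι → ScalarL2 n}
    (h : ∀ i ∈ s, Sob k (f i)) : Sob k (∑ i ∈ s, f i) :=
  Finset.sum_induction f (Sob k) (fun _ _ => Sob.add) (Sob.zero k) h

theorem ContDeriv.pred {k : ℕ} : ∀ {c : Cont n}, ContDeriv (k + 1) c → ContDeriv k c := by
  induction k with
  | zero => exact fun _ => trivial
  | succ k ih =>
    intro c h j
    obtain ⟨c', h1, h2⟩ := h j
    exact ⟨c', h1, ih h2⟩

theorem Sob.cont_smul {k : ℕ} : ∀ {c : Cont n} {f : ScalarL2 n}, ContDeriv k c → Sob k f →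
    Sob k (c • f) := by
  induction k with
  | zero => exact fun _ _ => trivial
  | succ k ih =>
    intro c f hc hf j
    obtain ⟨c', h1, h2⟩ := hc j
    obtain ⟨g, h3, h4⟩ := hf j
    exact ⟨c • g + c' • f, h1.wd.cont_smul h3, (ih hc.pred h4).add (ih h2 hf.pred)⟩

theorem exists_fc_eq_of_le {f : ScalarL2 n} {a : (Fin n → ℤ) → ℂ} {C : ℝ}
    (h : ∀ m, ‖a m‖ ≤ C * ‖fc m f‖) : ∃ g : ScalarL2 n, ∀ m, fc m g = a m := by
  refine exists_fc_eq (Summable.of_nonneg_of_le (fun m => sq_nonneg _) (fun m => ?_)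
    ((summable_norm_sq_fc f).mul_left (C ^ 2)))
  rw [← mul_pow]
  exact pow_le_pow_left₀ (norm_nonneg _) (h m) 2

/-- Multiplying both coefficients by the multiplier of `∂ⱼ` preserves the domination, so it passes
to all derivatives. -/
theorem Sob.of_le {k : ℕ} : ∀ {f g : ScalarL2 n} {C : ℝ}, Sob k f →
    (∀ m, ‖fc m g‖ ≤ C * ‖fc m f‖) → Sob k g := by
  induction k with
  | zero => exact fun _ _ => trivial
  | succ k ih =>
    intro f g C hf h j
    obtain ⟨f', h1, h2⟩ := hf j
    have h3 : ∀ m, ‖freq m j * fc m g‖ ≤ C * ‖fc m f'‖ := fun m => by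
      rw [h1, norm_mul, norm_mul, mul_left_comm]
      exact mul_le_mul_of_nonneg_left (h m) (norm_nonneg _)
    obtain ⟨g', hg'⟩ := exists_fc_eq_of_le h3
    exact ⟨g', hg', ih h2 fun m => by rw [hg']; exact h3 m⟩

/-- The Fourier weight `1 + |2πm|²`. -/
def weight (m : Fin n → ℤ) : ℝ := 1 + ∑ j, ‖freq m j‖ ^ 2

theorem weight_pos (m : Fin n → ℤ) : 0 < weight m := by unfold weight; positivity

theorem abs_le_norm_freq (m : Fin n → ℤ) (j : Fin n) : |(m j : ℝ)| ≤ ‖freq m j‖ := by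
  have h : ‖freq m j‖ = 2 * Real.pi * |(m j : ℝ)| := by
    simp [freq, abs_of_pos Real.pi_pos]
  rw [h]
  nlinarith [abs_nonneg (m j : ℝ), Real.pi_gt_three]

theorem norm_sq_le_weight (m : Fin n → ℤ) : ‖fun i => (m i : ℝ)‖ ^ 2 ≤ weight m := by
  rw [← Real.le_sqrt (norm_nonneg _) (weight_pos m).le]
  refine (pi_norm_le_iff_of_nonneg (Real.sqrt_nonneg _)).mpr fun i => ?_
  rw [Real.norm_eq_abs]
  refine Real.le_sqrt_of_sq_le ?_
  have h1 : |(m i : ℝ)| ^ 2 ≤ ‖freq m i‖ ^ 2 :=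
    pow_le_pow_left₀ (abs_nonneg _) (abs_le_norm_freq m i) 2
  have h2 := Finset.single_le_sum (f := fun j => ‖freq m j‖ ^ 2) (fun j _ => sq_nonneg _)
    (Finset.mem_univ i)
  unfold weight
  linarith

/-- The weight dominates `|m|²` in the sup norm, and `|m|^{-2k}` is summable over a lattice of rank
`n < 2k`. -/
theorem summable_weight {k : ℕ} (hk : n < 2 * k) :
    Summable fun m : Fin n → ℤ => (weight m ^ k)⁻¹ := by
  let b := Pi.basisFun ℝ (Fin n)
  let Λ : Submodule ℤ (Fin n → ℝ) := Submodule.span ℤ (Set.range b)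
  have hr : Module.finrank ℤ Λ = n := by
    rw [ZLattice.rank ℝ Λ]; simp
  have hs := ZLattice.summable_norm_pow_inv Λ (2 * k) (by rw [hr]; exact hk)
  have hmem : ∀ m : Fin n → ℤ, (fun i => (m i : ℝ)) ∈ Λ := fun m => by
    rw [Module.Basis.mem_span_iff_repr_mem]
    intro i
    exact ⟨m i, by simp [b]⟩
  let e : (Fin n → ℤ) → Λ := fun m => ⟨fun i => (m i : ℝ), hmem m⟩
  have he : Function.Injective e := fun m m' h => by
    have := congrArg Subtype.val h
    ext i
    have h2 : (m i : ℝ) = m' i := congrFun this i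
    exact_mod_cast h2
  -- The comparison fails only at `m = 0`, where `0⁻¹ = 0` makes the lattice term vanish.
  refine Summable.of_norm_bounded_eventually (hs.comp_injective he) ?_
  refine (Set.finite_singleton (0 : Fin n → ℤ)).subset fun m hm => ?_
  by_contra hne
  apply hm
  have hpos : 0 < ‖fun i => (m i : ℝ)‖ := by
    rw [norm_pos_iff]
    intro h0
    exact hne (by ext i; have := congrFun h0 i; simpa using this)
  have hw : 0 ≤ (weight m ^ k)⁻¹ := by have := weight_pos m; positivity
  change ‖(weight m ^ k)⁻¹‖ ≤ _
  rw [Real.norm_of_nonneg hw]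
  change _ ≤ (‖fun i => (m i : ℝ)‖⁻¹) ^ (2 * k)
  rw [inv_pow, pow_mul]
  gcongr
  exact norm_sq_le_weight m

/-- One more factor of the weight adds the contributions of the first derivatives to that of `f`. -/
theorem Sob.summable {k : ℕ} : ∀ {f : ScalarL2 n}, Sob k f →
    Summable fun m => weight m ^ k * ‖fc m f‖ ^ 2 := by
  induction k with
  | zero => intro f _; simpa using summable_norm_sq_fc f
  | succ k ih =>
    intro f hf
    choose g hg hk using hf
    have h := (ih (f := f) (Sob.pred fun j => ⟨g j, hg j, hk j⟩)).add
      (summable_sum fun j (_ : j ∈ Finset.univ) => ih (hk j))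
    refine h.congr fun m => ?_
    rw [pow_succ (weight m)]
    simp only [hg _ m, norm_mul, mul_pow]
    rw [show weight m ^ k * weight m = weight m ^ k * (1 + ∑ j, ‖freq m j‖ ^ 2) from rfl]
    rw [← Finset.mul_sum, ← Finset.sum_mul]
    ring

/-- With `A = weight⁻ᵏ` and `B = weightᵏ |f̂|²`, both summable, `|f̂|² = A B ≤ (A + B)²`. -/
theorem Sob.summable_norm_fc {k : ℕ} (hk : n < 2 * k) {f : ScalarL2 n} (hf : Sob k f) :
    Summable fun m => ‖fc m f‖ := by
  refine Summable.of_nonneg_of_le (fun m => norm_nonneg _) (fun m => ?_)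
    ((summable_weight hk).add hf.summable)
  have hw : 0 < weight m ^ k := pow_pos (weight_pos m) k
  have h1 : weight m ^ k * (weight m ^ k)⁻¹ = 1 := mul_inv_cancel₀ hw.ne'
  have h2 : 0 < (weight m ^ k)⁻¹ := inv_pos.mpr hw
  have h3 : ‖fc m f‖ ^ 2 = (weight m ^ k)⁻¹ * (weight m ^ k * ‖fc m f‖ ^ 2) := by
    rw [← mul_assoc, inv_mul_cancel₀ hw.ne', one_mul]
  have h4 : 0 ≤ weight m ^ k * ‖fc m f‖ ^ 2 := by positivity
  refine abs_le_of_sq_le_sq' (a := ‖fc m f‖) ?_ (by positivity) |>.2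
  generalize weight m ^ k * ‖fc m f‖ ^ 2 = B at h3 h4 ⊢
  rw [h3]
  nlinarith [mul_nonneg h2.le h4]

/-- The Sobolev embedding: `H^k` functions have continuous representatives when `k > n / 2`. -/
theorem Sob.exists_cl {k : ℕ} (hk : n < 2 * k) {f : ScalarL2 n} (hf : Sob k f) :
    ∃ c : Cont n, cl c = f := by
  have hs : Summable fun m => fc m f • (mFourier m : Cont n) := by
    refine Summable.of_norm ?_
    simpa [norm_smul, mFourier_norm] using hf.summable_norm_fc hk
  refine ⟨∑' m, fc m f • (mFourier m : Cont n), fc_ext fun m => ?_⟩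
  have h := (fc m).hasSum (cl.hasSum hs.hasSum)
  refine h.unique ?_
  have h2 := hasSum_ite_eq m (fc m f)
  refine h2.congr_fun fun l => ?_
  simp only [ContinuousLinearMap.map_smul, fc_fourier]
  rcases eq_or_ne l m with rfl | h
  · simp
  · simp [h, h.symm]

/-! ### Vector fields, the acoustic space and the eigenspaces of the wave operator -/

section

/-- Square integrable fields with `m` components. -/
abbrev VectorL2 (n m : ℕ) : Type := Lp (EuclideanSpace ℂ (Fin m)) 2 (volume : Measure (Torus n))

variable {m : ℕ}

/-- The `i`-th component of a square integrable field. -/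
def comp (i : Fin m) : VectorL2 n m →L[ℂ] ScalarL2 n :=
  ContinuousLinearMap.compLpL 2 volume (EuclideanSpace.proj (𝕜 := ℂ) i)

/-- The field whose `i`-th component is given and whose other components vanish. -/
def emb (i : Fin m) : ScalarL2 n →L[ℂ] VectorL2 n m :=
  ContinuousLinearMap.compLpL 2 volume
    (ContinuousLinearMap.toSpanSingleton ℂ (EuclideanSpace.single i (1 : ℂ)))

theorem comp_coeFn (i : Fin m) (V : VectorL2 n m) : comp i V =ᵐ[volume] fun x => V x i :=
  ContinuousLinearMap.coeFn_compLpL _ V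

theorem emb_coeFn (i : Fin m) (f : ScalarL2 n) :
    emb i f =ᵐ[volume] fun x => f x • EuclideanSpace.single i (1 : ℂ) :=
  ContinuousLinearMap.coeFn_compLpL _ f

theorem comp_ext {V W : VectorL2 n m} (h : ∀ i, comp i V = comp i W) : V = W := by
  refine Lp.ext ?_
  have h1 : ∀ᵐ x : Torus n, ∀ i, comp i V x = V x i := ae_all_iff.mpr fun i => comp_coeFn i V
  have h2 : ∀ᵐ x : Torus n, ∀ i, comp i W x = W x i := ae_all_iff.mpr fun i => comp_coeFn i W
  filter_upwards [h1, h2] with x h1 h2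
  ext i
  rw [← h1, ← h2, h]

theorem comp_emb (i j : Fin m) (f : ScalarL2 n) : comp i (emb j f) = if i = j then f else 0 := by
  refine Lp.ext ?_
  split_ifs with hij
  · filter_upwards [comp_coeFn i (emb j f), emb_coeFn j f] with x h1 h2
    rw [h1, h2, hij]; simp
  · filter_upwards [comp_coeFn i (emb j f), emb_coeFn j f,
      Lp.coeFn_zero ℂ 2 (volume : Measure (Torus n))] with x h1 h2 h3
    rw [h1, h2, h3]; simp [hij]

/-- The field with given components. -/
def ofComp (F : Fin m → ScalarL2 n) : VectorL2 n m := ∑ i, emb i (F i)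

theorem comp_ofComp (i : Fin m) (F : Fin m → ScalarL2 n) : comp i (ofComp F) = F i := by
  simp [ofComp, map_sum, comp_emb]

theorem inner_eq_sum (V W : VectorL2 n m) :
    inner ℂ V W = ∑ i, inner ℂ (comp i V) (comp i W) := by
  simp only [inner_eq_bil, bil_eq]
  rw [L2.inner_def, ← integral_finsetSum _ fun i _ => integrable_mul _ _]
  refine integral_congr_ae ?_
  have h1 : ∀ᵐ x : Torus n, ∀ i, comp i V x = V x i := ae_all_iff.mpr fun i => comp_coeFn i V
  have h2 : ∀ᵐ x : Torus n, ∀ i, comp i W x = W x i := ae_all_iff.mpr fun i => comp_coeFn i W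
  have h3 : ∀ᵐ x : Torus n, ∀ i, conjL (comp i V) x = starRingEnd ℂ (comp i V x) :=
    ae_all_iff.mpr fun i => conjL_coeFn _
  filter_upwards [h1, h2, h3] with x h1 h2 h3
  rw [PiLp.inner_apply]
  refine Finset.sum_congr rfl fun i _ => ?_
  rw [h3, h1, h2, RCLike.inner_apply, mul_comm]

theorem dotInt_eq (V W : VectorL2 n m) : dotInt V W = ∑ i, bil (comp i V) (comp i W) := by
  simp only [bil_eq]
  rw [dotInt, ← integral_finsetSum _ fun i _ => integrable_mul _ _]
  refine integral_congr_ae ?_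
  have h1 : ∀ᵐ x : Torus n, ∀ i, comp i V x = V x i := ae_all_iff.mpr fun i => comp_coeFn i V
  have h2 : ∀ᵐ x : Torus n, ∀ i, comp i W x = W x i := ae_all_iff.mpr fun i => comp_coeFn i W
  filter_upwards [h1, h2] with x h1 h2
  exact Finset.sum_congr rfl fun i _ => by rw [h1, h2]

/-- The bilinear pairing `∫ V · W` of fields. -/
def dotL : VectorL2 n m →L[ℂ] VectorL2 n m →L[ℂ] ℂ :=
  ∑ i, bil.bilinearComp (comp i) (comp i)

theorem dotL_apply (V W : VectorL2 n m) : dotL V W = ∑ i, bil (comp i V) (comp i W) := by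
  simp [dotL]

theorem dotInt_eq_dotL (V W : VectorL2 n m) : dotInt V W = dotL V W := by
  rw [dotInt_eq, dotL_apply]

theorem dotL_comm (V W : VectorL2 n m) : dotL V W = dotL W V := by
  simp only [dotL_apply]
  exact Finset.sum_congr rfl fun i _ => bil_comm _ _

/-- Complex conjugation of fields. -/
def conjV : VectorL2 n m →L[ℝ] VectorL2 n m :=
  ∑ i, ((emb i).restrictScalars ℝ).comp (conjL.comp ((comp i).restrictScalars ℝ))

theorem comp_conjV (i : Fin m) (V : VectorL2 n m) : comp i (conjV V) = conjL (comp i V) := by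
  have h : conjV V = ofComp fun i => conjL (comp i V) := by simp [conjV, ofComp]
  rw [h, comp_ofComp]

theorem inner_eq_dotL (V W : VectorL2 n m) : inner ℂ V W = dotL (conjV V) W := by
  simp only [inner_eq_sum, dotL_apply, comp_conjV, inner_eq_bil]

theorem conjV_conjV (V : VectorL2 n m) : conjV (conjV V) = V :=
  comp_ext fun i => by rw [comp_conjV, comp_conjV, conjL_conjL]

/-- The square root `s = √ρ` of a positive `C^k` density and its inverse `r`. -/
structure Density (n k : ℕ) where
  s : Cont n
  r : Cont n
  s_mul_r : s * r = 1
  star_s : star s = s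
  star_r : star r = r
  contDeriv_s : ContDeriv k s
  contDeriv_r : ContDeriv k r

variable {k : ℕ} (P : Density n k)

theorem Density.r_mul_s : P.r * P.s = 1 := by rw [mul_comm, P.s_mul_r]

/-- The density of a positive `C^k` function. -/
def Density.of (ρ : Torus n → ℝ) (hρ : IsCk (k : WithTop ℕ∞) ρ) (hpos : ∀ x, 0 < ρ x) :
    Density n k where
  s := rc fun x => Real.sqrt (ρ x)
  r := rc fun x => (Real.sqrt (ρ x))⁻¹
  s_mul_r := by
    have h1 : Continuous fun x => Real.sqrt (ρ x) := Real.continuous_sqrt.comp hρ.continuous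
    have h0 : ∀ x, Real.sqrt (ρ x) ≠ 0 := fun x => (Real.sqrt_pos.mpr (hpos x)).ne'
    have h2 : Continuous fun x => (Real.sqrt (ρ x))⁻¹ := h1.inv₀ h0
    ext x
    rw [ContinuousMap.mul_apply, rc_apply h1, rc_apply h2, ← Complex.ofReal_mul,
      mul_inv_cancel₀ (h0 x)]
    simp
  star_s := star_rc _
  star_r := star_rc _
  contDeriv_s := IsCk.contDeriv (ContDiff.sqrt hρ fun x => (hpos _).ne')
  contDeriv_r := IsCk.contDeriv (ContDiff.inv (ContDiff.sqrt hρ fun x => (hpos _).ne')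
    fun x => (Real.sqrt_pos.mpr (hpos _)).ne')

/-- The `j`-th component of the gradient field `g = h / √ρ` of `V = (φ, h)`. -/
def Density.g (j : Fin n) : State n →L[ℂ] ScalarL2 n := (mulL P.r).comp (comp j.succ)

theorem Density.g_apply (j : Fin n) (V : State n) : P.g j V = P.r • comp j.succ V := rfl

theorem Density.s_smul_g (j : Fin n) (V : State n) : P.s • P.g j V = comp j.succ V := by
  rw [P.g_apply, ← mul_smul, P.s_mul_r, one_smul]

theorem Density.g_conjV (j : Fin n) (V : State n) : P.g j (conjV V) = conjL (P.g j V) := by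
  rw [P.g_apply, P.g_apply, comp_conjV, conjL_cont_smul, P.star_r]

theorem fc_zero_of_WD {j : Fin n} {f g : ScalarL2 n} (h : WD j f g) : fc 0 g = 0 := by
  rw [h]; simp [freq]

/-- A curl-free field with zero mean is a gradient. -/
theorem exists_potential {F : Fin n → ScalarL2 n}
    (h : ∀ i j m, freq m i * fc m (F j) = freq m j * fc m (F i)) (h0 : ∀ j, fc 0 (F j) = 0) :
    ∃ w : ScalarL2 n, fc 0 w = 0 ∧ ∀ j, WD j w (F j) := by
  let S : (Fin n → ℤ) → ℝ := fun m => ∑ j, ‖freq m j‖ ^ 2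
  have hS : ∀ m : Fin n → ℤ, m ≠ 0 → 1 ≤ S m := fun m hm => by
    obtain ⟨i, hi⟩ := Function.ne_iff.mp hm
    have h1 : (1 : ℝ) ≤ |(m i : ℝ)| := by
      have : (1 : ℤ) ≤ |m i| := Int.one_le_abs (by simpa using hi)
      exact_mod_cast this
    have h2 := h1.trans (abs_le_norm_freq m i)
    have h3 := Finset.single_le_sum (f := fun j => ‖freq m j‖ ^ 2) (fun j _ => sq_nonneg _)
      (Finset.mem_univ i)
    exact le_trans (by nlinarith) h3
  -- The coefficient is the component of `F̂(m)` along the frequency vector, divided by the length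
  -- of that vector. Curl-freeness makes `F̂(m)` parallel to the frequency, so nothing is lost. The
  -- value at `0` fixes the mean of the potential.
  let a : (Fin n → ℤ) → ℂ := fun m =>
    if m = 0 then 0 else (∑ j, starRingEnd ℂ (freq m j) * fc m (F j)) / (S m : ℂ)
  have ha : ∀ m, ‖a m‖ ≤ ∑ j, ‖fc m (F j)‖ := fun m => by
    by_cases hm : m = 0
    · simp only [a, hm, if_true, norm_zero]
      exact Finset.sum_nonneg fun j _ => norm_nonneg _
    · have hSm := hS m hm
      simp only [a, hm, if_false]
      rw [norm_div, Complex.norm_of_nonneg (by linarith), div_le_iff₀ (by linarith), Finset.sum_mul]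
      refine (norm_sum_le _ _).trans (Finset.sum_le_sum fun j _ => ?_)
      rw [norm_mul, RCLike.norm_conj, mul_comm]
      refine mul_le_mul_of_nonneg_left ?_ (norm_nonneg _)
      have h3 : ‖freq m j‖ ^ 2 ≤ S m := Finset.single_le_sum (f := fun j => ‖freq m j‖ ^ 2)
        (fun j _ => sq_nonneg _) (Finset.mem_univ j)
      nlinarith [norm_nonneg (freq m j)]
  obtain ⟨w, hw⟩ := exists_fc_eq (a := a) (by
    refine Summable.of_nonneg_of_le (fun m => sq_nonneg _) (fun m => ?_)
      ((summable_sum fun j (_ : j ∈ Finset.univ) => summable_norm_sq_fc (F j)).mul_left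
        ((Finset.univ : Finset (Fin n)).card : ℝ))
    exact (pow_le_pow_left₀ (norm_nonneg _) (ha m) 2).trans sq_sum_le_card_mul_sum_sq)
  refine ⟨w, by rw [hw]; simp [a], fun j m => ?_⟩
  rw [hw]
  by_cases hm : m = 0
  · simp [a, hm, h0]
  · have hSm : (S m : ℂ) ≠ 0 := by
      have := hS m hm
      exact_mod_cast (by linarith : S m ≠ 0)
    simp only [a, hm, if_false]
    rw [← mul_div_assoc, eq_div_iff hSm, Finset.mul_sum]
    simp only [S, Complex.ofReal_sum, Finset.mul_sum]
    refine Finset.sum_congr rfl fun i _ => ?_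
    rw [mul_left_comm, h j i m, Complex.ofReal_pow, ← Complex.conj_mul']
    ring

/-- The acoustic space as a submodule. -/
def Density.acoustic : Submodule ℂ (State n) where
  carrier := {V | ∃ w, ∀ j, WD j w (P.g j V)}
  zero_mem' := ⟨0, fun j => by rw [map_zero]; exact WD.zero j⟩
  add_mem' := by
    rintro V W ⟨v, hv⟩ ⟨w, hw⟩
    exact ⟨v + w, fun j => by rw [map_add]; exact (hv j).add (hw j)⟩
  smul_mem' := by
    rintro a V ⟨v, hv⟩
    exact ⟨a • v, fun j => by rw [ContinuousLinearMap.map_smul]; exact (hv j).smul a⟩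

/-- The existence of a potential becomes a family of continuous linear equations, which is why the
acoustic space is closed. -/
theorem Density.mem_acoustic_iff {V : State n} : V ∈ P.acoustic ↔
    (∀ i j m, freq m i * fc m (P.g j V) = freq m j * fc m (P.g i V)) ∧
      ∀ j, fc 0 (P.g j V) = 0 := by
  constructor
  · rintro ⟨w, hw⟩
    refine ⟨fun i j m => ?_, fun j => fc_zero_of_WD (hw j)⟩
    rw [hw, hw]; ring
  · rintro ⟨h1, h2⟩
    obtain ⟨w, _, hw⟩ := exists_potential h1 h2
    exact ⟨w, hw⟩

theorem Density.exists_potential {V : State n} (hV : V ∈ P.acoustic) :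
    ∃ w : ScalarL2 n, fc 0 w = 0 ∧ ∀ j, WD j w (P.g j V) :=
  Anelastic.exists_potential (P.mem_acoustic_iff.mp hV).1 (P.mem_acoustic_iff.mp hV).2

theorem Density.isClosed_acoustic : IsClosed (P.acoustic : Set (State n)) := by
  have h : (P.acoustic : Set (State n)) =
      {V | (∀ i j m, freq m i * fc m (P.g j V) = freq m j * fc m (P.g i V)) ∧
        ∀ j, fc 0 (P.g j V) = 0} := Set.ext fun V => P.mem_acoustic_iff
  rw [h]
  simp only [ofPred_and, ofPred_forall]
  refine IsClosed.inter ?_ ?_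
  · exact isClosed_iInter fun i => isClosed_iInter fun j => isClosed_iInter fun m =>
      isClosed_eq (by fun_prop) (by fun_prop)
  · exact isClosed_iInter fun j => isClosed_eq (by fun_prop) (by fun_prop)

theorem Density.conjV_mem_acoustic {V : State n} (hV : V ∈ P.acoustic) :
    conjV V ∈ P.acoustic := by
  obtain ⟨w, hw⟩ := hV
  exact ⟨conjL w, fun j => by rw [P.g_conjV]; exact (hw j).conj⟩

/-- `W = L V` for the wave operator `L`. -/
def Density.Wave (V W : State n) : Prop :=
  V ∈ P.acoustic ∧ WDiv (fun j => P.s • comp j.succ V) (-comp 0 W) ∧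
    ∀ j, WD j (comp 0 V) (-P.g j W)

/-- The eigenspace of the wave operator for the eigenvalue `iμ`. -/
def Density.eigen (μ : ℝ) : Submodule ℂ (State n) where
  carrier := {V | P.Wave V ((Complex.I * (μ : ℂ)) • V)}
  zero_mem' := ⟨P.acoustic.zero_mem, fun m => by simp, fun j m => by simp⟩
  add_mem' := by
    rintro V W ⟨h1, h2, h3⟩ ⟨h1', h2', h3'⟩
    refine ⟨P.acoustic.add_mem h1 h1', fun m => ?_, fun j => ?_⟩
    · simp only [smul_add, map_add, neg_add, mul_add, Finset.sum_add_distrib, h2 m, h2' m]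
    · simp only [smul_add, map_add, neg_add]
      exact (h3 j).add (h3' j)
  smul_mem' := by
    rintro a V ⟨h1, h2, h3⟩
    refine ⟨P.acoustic.smul_mem a h1, fun m => ?_, fun j => ?_⟩
    · have h : ∀ j : Fin n, freq m j * fc m (P.s • comp j.succ (a • V))
          = a * (freq m j * fc m (P.s • comp j.succ V)) := fun j => by
        rw [ContinuousLinearMap.map_smul, cont_smul_def, ContinuousLinearMap.map_smul,
          ContinuousLinearMap.map_smul, smul_eq_mul]
        simp only [cont_smul_def]
        ring
      simp only [h]
      rw [← Finset.mul_sum, h2 m, smul_comm]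
      simp only [ContinuousLinearMap.map_smul, map_neg, smul_eq_mul]
      ring
    · have := (h3 j).smul a
      rw [smul_comm]
      simpa only [ContinuousLinearMap.map_smul, smul_neg] using this

theorem Density.isClosed_eigen (μ : ℝ) : IsClosed (P.eigen μ : Set (State n)) := by
  have h : (P.eigen μ : Set (State n)) = (P.acoustic : Set (State n)) ∩
      ({V | ∀ m, ∑ j : Fin n, freq m j * fc m (mulL P.s (comp j.succ V))
        = fc m (-comp 0 ((Complex.I * (μ : ℂ)) • V))} ∩
      {V | ∀ j m, fc m (-P.g j ((Complex.I * (μ : ℂ)) • V)) = freq m j * fc m (comp 0 V)}) := rfl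
  rw [h]
  refine P.isClosed_acoustic.inter (IsClosed.inter ?_ ?_)
  · simp only [ofPred_forall]
    exact isClosed_iInter fun m => isClosed_eq (by fun_prop) (by fun_prop)
  · simp only [ofPred_forall]
    exact isClosed_iInter fun j => isClosed_iInter fun m =>
      isClosed_eq (by fun_prop) (by fun_prop)

end

/-! ### Skew symmetry of the wave operator and its resolvent -/

section

variable {k : ℕ} (P : Density n k)

theorem bil_s_smul_g (F V : State n) (j : Fin n) :
    bil (P.s • comp j.succ F) (P.g j V) = bil (comp j.succ F) (comp j.succ V) := by
  rw [bil_smul, P.s_smul_g]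

theorem dotL_state (V W : State n) :
    dotL V W = bil (comp 0 V) (comp 0 W) + ∑ j : Fin n, bil (comp j.succ V) (comp j.succ W) := by
  rw [dotL_apply, Fin.sum_univ_succ]

variable {P}

/-- Green's formula for the two pairs (divergence of one state, gradient of the other). The pairing
carries no conjugation because `L` has real coefficients. -/
theorem Density.Wave.skew {V V' W W' : State n} (hV : P.Wave V V') (hW : P.Wave W W') :
    dotL V' W = -dotL V W' := by
  have h1 := hV.2.1.pair hW.2.2
  have h2 := hW.2.1.pair hV.2.2
  simp only [map_neg, neg_apply, neg_neg, bil_s_smul_g, Finset.sum_neg_distrib] at h1 h2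
  rw [dotL_state, dotL_state, ← h1, bil_comm (comp 0 V), ← h2]
  simp only [bil_comm (comp _ V') (comp _ W)]
  ring

/-- Skewness gives `i(α + β)` times the pairing equal to zero. With the bilinear pairing it is
opposite eigenvalues that interact. -/
theorem Density.dotL_eq_zero {α β : ℝ} {V W : State n} (hV : V ∈ P.eigen α) (hW : W ∈ P.eigen β)
    (h : α + β ≠ 0) : dotL V W = 0 := by
  have h1 := Density.Wave.skew hV hW
  rw [ContinuousLinearMap.map_smul, ContinuousLinearMap.map_smul, smul_apply,
    smul_eq_mul, smul_eq_mul] at h1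
  have h2 : (Complex.I * ((α + β : ℝ) : ℂ)) * dotL V W = 0 := by
    push_cast
    linear_combination h1
  refine (mul_eq_zero.mp h2).resolve_left (mul_ne_zero Complex.I_ne_zero ?_)
  exact_mod_cast h

theorem Density.conjV_mem_eigen {α : ℝ} {V : State n} (hV : V ∈ P.eigen α) :
    conjV V ∈ P.eigen (-α) := by
  have hc : ∀ i, comp i ((Complex.I * ((-α : ℝ) : ℂ)) • conjV V)
      = conjL (comp i ((Complex.I * (α : ℂ)) • V)) := fun i => by
    rw [ContinuousLinearMap.map_smul, ContinuousLinearMap.map_smul, conjL_smul, comp_conjV]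
    simp
  refine ⟨P.conjV_mem_acoustic hV.1, ?_, fun j => ?_⟩
  · rw [hc, ← map_neg]
    have := hV.2.1.conj
    simpa only [conjL_cont_smul, P.star_s, comp_conjV] using this
  · have := (hV.2.2 j).conj
    rw [P.g_apply, hc, comp_conjV]
    rwa [map_neg, P.g_apply, conjL_cont_smul, P.star_r] at this

/-- Conjugation maps the eigenvalue `iα` to `-iα` and turns the inner product into the bilinear
pairing. -/
theorem Density.eigen_orthogonal {α β : ℝ} (h : α ≠ β) {V W : State n} (hV : V ∈ P.eigen α)
    (hW : W ∈ P.eigen β) : inner ℂ V W = 0 := by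
  rw [inner_eq_dotL]
  exact P.dotL_eq_zero (P.conjV_mem_eigen hV) hW fun h' => h (by linarith)

variable (P)

/-- The graph of `φ ↦ √ρ ∇φ`. -/
def Density.graph : Submodule ℂ (State n) where
  carrier := {F | ∀ j, WD j (comp 0 F) (P.g j F)}
  zero_mem' := fun j => by simp only [map_zero]; exact WD.zero j
  add_mem' := fun h h' j => by simp only [map_add]; exact (h j).add (h' j)
  smul_mem' := fun a F h j => by
    simp only [ContinuousLinearMap.map_smul]; exact (h j).smul a

theorem Density.isClosed_graph : IsClosed (P.graph : Set (State n)) := by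
  have h : (P.graph : Set (State n)) =
      {F | ∀ j m, fc m (P.g j F) = freq m j * fc m (comp 0 F)} := rfl
  rw [h]
  simp only [ofPred_forall]
  exact isClosed_iInter fun j => isClosed_iInter fun m =>
      isClosed_eq (by fun_prop) (by fun_prop)

instance : P.graph.HasOrthogonalProjection :=
  haveI := P.isClosed_graph.completeSpace_coe
  inferInstance

/-- `V = (1 - L)⁻¹ F` in the weak sense. -/
def Density.IsResolvent (V F : State n) : Prop :=
  WDiv (fun j => P.s • comp j.succ V) (comp 0 F - comp 0 V) ∧ ∀ j, WD j (comp 0 V) (P.g j (F - V))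

/-- The resolvent `(1 - L)⁻¹`, from the projection to the graph of `φ ↦ √ρ ∇φ`. -/
def Density.resolvent : State n →L[ℂ] State n :=
  ((emb 0).comp (comp 0)).comp P.graph.starProjection +
    (∑ j : Fin n, (emb j.succ).comp (comp j.succ)).comp
      (ContinuousLinearMap.id ℂ (State n) - P.graph.starProjection)

theorem Density.comp_zero_resolvent (F : State n) :
    comp 0 (P.resolvent F) = comp 0 (P.graph.starProjection F) := by
  simp [Density.resolvent, map_sum, comp_emb, (Fin.succ_ne_zero _).symm]

theorem Density.comp_succ_resolvent (F : State n) (j : Fin n) :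
    comp j.succ (P.resolvent F) = comp j.succ (F - P.graph.starProjection F) := by
  simp [Density.resolvent, map_sum, comp_emb, Fin.succ_ne_zero]

/-- Let `q = (φ, √ρ∇φ)` be the projection of `F` to the graph. Setting `h = F_h - √ρ∇φ` solves the
second equation, and orthogonality of `F - q` to the graph is the weak form of the first one,
`div(√ρ h) = F₀ - φ`. -/
theorem Density.isResolvent_resolvent (F : State n) : P.IsResolvent (P.resolvent F) F := by
  have hmem : P.graph.starProjection F ∈ P.graph := Submodule.starProjection_apply_mem _ _
  refine ⟨fun m => ?_, fun j => ?_⟩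
  -- The graph element over the character `e_m` extracts the Fourier coefficient at `m`.
  · let q : State n := ofComp (Fin.cons (cl (mFourier m))
      fun j => freq m j • P.s • cl (mFourier m))
    have hq0 : comp 0 q = cl (mFourier m) := by simp [q, comp_ofComp]
    have hqs : ∀ j : Fin n, comp j.succ q = freq m j • P.s • cl (mFourier m) := fun j => by
      simp [q, comp_ofComp]
    have hq : q ∈ P.graph := fun j => by
      rw [hq0, P.g_apply, hqs, smul_comm, ← mul_smul, P.r_mul_s, one_smul]
      have := (hasPD_mFourier m j).wd
      rwa [ContinuousLinearMap.map_smul] at this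
    have h0 : inner ℂ q (F - P.graph.starProjection F) = 0 :=
      Submodule.inner_right_of_mem_orthogonal hq (Submodule.sub_starProjection_mem_orthogonal F)
    rw [inner_eq_sum, Fin.sum_univ_succ, hq0, ← fourierBasis_apply, ← fc_eq_inner] at h0
    have h1 : ∀ j : Fin n, inner ℂ (comp j.succ q) (comp j.succ (F - P.graph.starProjection F))
        = -(freq m j * fc m (P.s • comp j.succ (P.resolvent F))) := fun j => by
      rw [hqs, inner_smul_left, conj_freq, P.comp_succ_resolvent, fc_eq_inner, inner_eq_bil,
        inner_eq_bil, conjL_cont_smul, P.star_s, bil_smul, fourierBasis_apply]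
      ring
    simp only [h1, Finset.sum_neg_distrib] at h0
    rw [P.comp_zero_resolvent, ← map_sub]
    linear_combination -h0
  · have := hmem j
    rw [P.comp_zero_resolvent]
    have h2 : P.g j (F - P.resolvent F) = P.g j (P.graph.starProjection F) := by
      rw [map_sub, P.g_apply j (P.resolvent F), P.comp_succ_resolvent, ← P.g_apply, ← map_sub,
        sub_sub_cancel]
    rwa [h2]

/-- For any solution, `(φ, F_h - h)` lies in the graph and differs from `F` by a vector orthogonal
to it, so it is the projection of `F`. -/
theorem Density.IsResolvent.eq {P : Density n k} {V F : State n} (h : P.IsResolvent V F) :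
    V = P.resolvent F := by
  let q : State n := ofComp (Fin.cons (comp 0 V) fun j => comp j.succ (F - V))
  have hq0 : comp 0 q = comp 0 V := by simp [q, comp_ofComp]
  have hqs : ∀ j : Fin n, comp j.succ q = comp j.succ (F - V) := fun j => by
    simp [q, comp_ofComp]
  have hq : q ∈ P.graph := fun j => by
    rw [hq0, P.g_apply, hqs]; exact h.2 j
  have hp : P.graph.starProjection F = q := by
    refine Submodule.eq_starProjection_of_mem_of_inner_eq_zero hq fun w hw => ?_
    have hw' : ∀ j, WD j (conjL (comp 0 w)) (conjL (P.g j w)) := fun j => (hw j).conj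
    have h1 := h.1.pair hw'
    rw [← inner_conj_symm, inner_eq_sum, Fin.sum_univ_succ, map_sub (comp 0), hq0,
      inner_eq_bil, bil_comm, ← neg_eq_iff_eq_neg.mpr h1, neg_add_eq_zero.mpr, map_zero]
    refine Finset.sum_congr rfl fun j _ => ?_
    rw [map_sub, hqs, map_sub, sub_sub_cancel, inner_eq_bil, P.g_apply, conjL_cont_smul, P.star_r,
      bil_smul, ← mul_smul, P.s_mul_r, one_smul, bil_comm]
  refine comp_ext fun i => ?_
  refine Fin.cases ?_ (fun j => ?_) i
  · rw [P.comp_zero_resolvent, hp, hq0]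
  · rw [P.comp_succ_resolvent, hp, map_sub, hqs, map_sub, sub_sub_cancel]

/-- The new gradient field is that of `F` minus `∇φ`. -/
theorem Density.resolvent_mem_acoustic {F : State n} (hF : F ∈ P.acoustic) :
    P.resolvent F ∈ P.acoustic := by
  obtain ⟨w, hw⟩ := hF
  have h := (P.isResolvent_resolvent F).2
  refine ⟨w - comp 0 (P.resolvent F), fun j => ?_⟩
  have := (hw j).sub (h j)
  rwa [map_sub, sub_sub_cancel] at this

theorem Density.resolvent_eigen {α : ℝ} {V : State n} (hV : V ∈ P.eigen α) :
    P.resolvent V = (1 - Complex.I * (α : ℂ))⁻¹ • V := by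
  have h : (1 - Complex.I * (α : ℂ)) ≠ 0 := fun h => by
    have := congrArg Complex.re h
    simp at this
  have h1 : P.IsResolvent V ((1 - Complex.I * (α : ℂ)) • V) := by
    refine ⟨?_, fun j => ?_⟩
    · have := hV.2.1
      rwa [show comp 0 ((1 - Complex.I * (α : ℂ)) • V) - comp 0 V
        = -comp 0 ((Complex.I * (α : ℂ)) • V) by
          simp only [ContinuousLinearMap.map_smul]; module]
    · have := hV.2.2 j
      rwa [show (1 - Complex.I * (α : ℂ)) • V - V = -((Complex.I * (α : ℂ)) • V) by module, map_neg]
  have h2 := h1.eq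
  rw [ContinuousLinearMap.map_smul] at h2
  rw [eq_inv_smul_iff₀ h]
  exact h2.symm

end

/-! ### Compactness and completeness of the eigenvectors -/

section

variable {k : ℕ} (P : Density n k)

theorem hasSum_weight_fc {f : ScalarL2 n} {f' : Fin n → ScalarL2 n} (h : ∀ j, WD j f (f' j)) :
    HasSum (fun m => weight m * ‖fc m f‖ ^ 2) (‖f‖ ^ 2 + ∑ j, ‖f' j‖ ^ 2) := by
  have h1 := (hasSum_norm_sq_fc f).add
    (hasSum_sum fun j (_ : j ∈ Finset.univ) => hasSum_norm_sq_fc (f' j))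
  refine h1.congr_fun fun m => ?_
  simp only [h _ m, norm_mul, mul_pow, weight, add_mul, one_mul, Finset.sum_mul]

/-- The truncation of the Fourier series to a finite set of frequencies. -/
def truncate (s : Finset (Fin n → ℤ)) : ScalarL2 n →L[ℂ] ScalarL2 n :=
  ∑ m ∈ s, (fc m).smulRight (cl (mFourier m))

theorem truncate_apply (s : Finset (Fin n → ℤ)) (f : ScalarL2 n) :
    truncate s f = ∑ m ∈ s, fc m f • cl (mFourier (d := Fin n) m) := by
  simp [truncate]

theorem isCompactOperator_truncate (s : Finset (Fin n → ℤ)) :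
    IsCompactOperator (truncate s) := by
  have h : FiniteDimensional ℂ (Submodule.span ℂ
      (((fun m => cl (mFourier (d := Fin n) m)) '' (s : Set (Fin n → ℤ))))) :=
    FiniteDimensional.span_of_finite ℂ (s.finite_toSet.image _)
  set E := Submodule.span ℂ (((fun m => cl (mFourier (d := Fin n) m)) '' (s : Set (Fin n → ℤ))))
  have hmem : ∀ f, truncate s f ∈ E := fun f => by
    rw [truncate_apply]
    exact Submodule.sum_mem _ fun m hm => Submodule.smul_mem _ _ (Submodule.subset_span ⟨m, hm, rfl⟩)
  have : ProperSpace E := FiniteDimensional.proper ℂ E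
  have h2 : IsCompactOperator ((truncate s).codRestrict E hmem) :=
    isCompactOperator_of_locallyCompactSpace_dom _
  exact h2.clm_comp E.subtypeL

theorem fc_truncate (s : Finset (Fin n → ℤ)) (f : ScalarL2 n) (m : Fin n → ℤ) :
    fc m (truncate s f) = if m ∈ s then fc m f else 0 := by
  rw [truncate_apply, map_sum]
  simp only [ContinuousLinearMap.map_smul, fc_fourier, smul_eq_mul, mul_ite, mul_one, mul_zero]
  rw [Finset.sum_ite_eq]

/-- Every discarded frequency has weight at least `1/δ`, so the tail is controlled by the `H¹` norm.
-/
theorem norm_sub_truncate_le {s : Finset (Fin n → ℤ)} {δ : ℝ} (hδ : 0 ≤ δ)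
    (hs : ∀ m ∉ s, (weight m)⁻¹ ≤ δ) {f : ScalarL2 n} {f' : Fin n → ScalarL2 n}
    (h : ∀ j, WD j f (f' j)) :
    ‖f - truncate s f‖ ^ 2 ≤ δ * (‖f‖ ^ 2 + ∑ j, ‖f' j‖ ^ 2) := by
  refine hasSum_le (fun m => ?_) (hasSum_norm_sq_fc _) ((hasSum_weight_fc h).mul_left δ)
  rw [map_sub, fc_truncate]
  have hw := weight_pos m
  split_ifs with hm
  · simp only [sub_self, norm_zero]
    have : 0 ≤ weight m * ‖fc m f‖ ^ 2 := by positivity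
    simpa using mul_nonneg hδ this
  · rw [sub_zero, ← mul_assoc]
    refine le_mul_of_one_le_left (sq_nonneg _) ?_
    have := mul_le_mul_of_nonneg_right (hs m hm) hw.le
    rwa [inv_mul_cancel₀ hw.ne'] at this

/-- The weights tend to infinity because a power of their inverses is summable; the exponent `n + 1`
is one that meets `n < 2k`. -/
theorem exists_weight_inv_le {δ : ℝ} (hδ : 0 < δ) :
    ∃ s : Finset (Fin n → ℤ), ∀ m ∉ s, (weight m)⁻¹ ≤ δ := by
  have h := (summable_weight (n := n) (k := n + 1) (by omega)).tendsto_cofinite_zero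
  have h2 := (tendsto_order.mp h).2 (δ ^ (n + 1)) (by positivity)
  rw [Filter.eventually_cofinite] at h2
  refine ⟨h2.toFinset, fun m hm => ?_⟩
  simp only [Set.Finite.mem_toFinset, Set.mem_ofPred_eq, not_not, ← inv_pow] at hm
  exact (lt_of_pow_lt_pow_left₀ (n + 1) hδ.le hm).le

/-- A bounded operator to `L²` whose values have bounded weak gradients is compact. -/
theorem isCompactOperator_of_wd {E : Type*} [NormedAddCommGroup E] [NormedSpace ℂ E]
    (T : E →L[ℂ] ScalarL2 n) (T' : Fin n → E →L[ℂ] ScalarL2 n)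
    (h : ∀ j x, WD j (T x) (T' j x)) : IsCompactOperator T := by
  let C : ℝ := ‖T‖ ^ 2 + ∑ j, ‖T' j‖ ^ 2
  have hC : 0 ≤ C := by positivity
  -- Fourier truncations of finite rank converge to `T` in operator norm; here with tolerance `δ =
  -- 1/(N+1)`.
  have key : ∀ N : ℕ, ∃ s : Finset (Fin n → ℤ),
      ‖(truncate s).comp T - T‖ ≤ Real.sqrt (1 / (N + 1) * C) := fun N => by
    obtain ⟨s, hs⟩ := exists_weight_inv_le (n := n) (δ := 1 / (N + 1)) (by positivity)
    refine ⟨s, ContinuousLinearMap.opNorm_le_bound _ (Real.sqrt_nonneg _) fun x => ?_⟩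
    have h1 := norm_sub_truncate_le (by positivity) hs (fun j => h j x)
    have h2 : ‖T x‖ ^ 2 + ∑ j, ‖T' j x‖ ^ 2 ≤ C * ‖x‖ ^ 2 := by
      rw [add_mul, Finset.sum_mul]
      refine add_le_add ?_ (Finset.sum_le_sum fun j _ => ?_)
      · rw [← mul_pow]; exact pow_le_pow_left₀ (norm_nonneg _) (T.le_opNorm x) 2
      · rw [← mul_pow]; exact pow_le_pow_left₀ (norm_nonneg _) ((T' j).le_opNorm x) 2
    rw [sub_apply, ContinuousLinearMap.comp_apply, norm_sub_rev]
    refine abs_le_of_sq_le_sq' ?_ (by positivity) |>.2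
    rw [mul_pow, Real.sq_sqrt (by positivity), mul_assoc]
    exact h1.trans (mul_le_mul_of_nonneg_left h2 (by positivity))
  choose s hs using key
  refine isCompactOperator_of_tendsto (l := atTop) (F := fun N => (truncate (s N)).comp T) ?_
    (Eventually.of_forall fun N => (isCompactOperator_truncate (s N)).comp_clm T)
  rw [tendsto_iff_norm_sub_tendsto_zero]
  refine squeeze_zero (fun N => norm_nonneg _) hs ?_
  have h1 := (tendsto_one_div_add_atTop_nhds_zero_nat (𝕜 := ℝ)).mul_const C
  have h2 := (Real.continuous_sqrt.tendsto _).comp h1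
  simpa [Function.comp_def] using h2

/-- The scalar resolvent `φ ↦ (1 - div (ρ ∇))⁻¹ φ`. -/
def Density.scalarResolvent : ScalarL2 n →L[ℂ] ScalarL2 n :=
  (comp 0).comp (P.graph.starProjection.comp (emb 0))

theorem inner_emb (i : Fin (n + 1)) (f : ScalarL2 n) (V : State n) :
    inner ℂ (emb i f) V = inner ℂ f (comp i V) := by
  rw [inner_eq_sum, Finset.sum_eq_single i]
  · rw [comp_emb, if_pos rfl]
  · intro j _ hj
    rw [comp_emb, if_neg hj, inner_zero_left]
  · simp

theorem Density.isSymmetric_scalarResolvent :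
    (P.scalarResolvent : ScalarL2 n →ₗ[ℂ] ScalarL2 n).IsSymmetric := fun f h => by
  change inner ℂ (comp 0 (P.graph.starProjection (emb 0 f))) h
    = inner ℂ f (comp 0 (P.graph.starProjection (emb 0 h)))
  rw [← inner_conj_symm, ← inner_emb, inner_conj_symm, ← inner_emb]
  exact P.graph.starProjection_isSymmetric (emb 0 f) (emb 0 h)

/-- A projection onto the graph delivers its gradient together with the function, with a bound by
the data. -/
theorem Density.isCompactOperator_scalarResolvent : IsCompactOperator P.scalarResolvent :=
  isCompactOperator_of_wd _ (fun j => (P.g j).comp (P.graph.starProjection.comp (emb 0)))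
    fun j f => (P.graph.starProjection_apply_mem (emb 0 f)) j

/-- This is `(1 - L)V = (f, 0)`: the second component of `V` is `-√ρ∇φ`, and substituting it leaves
`φ - div(ρ∇φ) = f`. -/
theorem Density.scalarResolvent_spec (f : ScalarL2 n) : ∃ G : Fin n → ScalarL2 n,
    WDiv (fun j => P.s • P.s • G j) (P.scalarResolvent f - f) ∧
      ∀ j, WD j (P.scalarResolvent f) (G j) := by
  have h := P.isResolvent_resolvent (emb 0 f)
  have h0 : comp 0 (P.resolvent (emb 0 f)) = P.scalarResolvent f := P.comp_zero_resolvent _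
  refine ⟨fun j => P.g j (emb 0 f - P.resolvent (emb 0 f)), fun m => ?_, fun j => h0 ▸ h.2 j⟩
  have h1 : ∀ j, P.s • P.s • P.g j (emb 0 f - P.resolvent (emb 0 f))
      = -(P.s • comp j.succ (P.resolvent (emb 0 f))) := fun j => by
    rw [P.s_smul_g, map_sub, comp_emb, if_neg (Fin.succ_ne_zero j), zero_sub, smul_neg]
  have h2 := h.1 m
  rw [h0, comp_emb, if_pos rfl] at h2
  simp only [h1, map_neg, mul_neg, Finset.sum_neg_distrib, h2]
  rw [← map_neg, neg_sub]

/-- Scalar eigenfunctions give eigenvectors of the wave operator. -/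
theorem Density.mem_eigen_of_scalar {ψ : ScalarL2 n} {G : Fin n → ScalarL2 n} {ν : ℝ} (hν : ν ≠ 0)
    (h1 : WDiv (fun j => P.s • P.s • G j) (-((ν : ℂ) ^ 2 • ψ))) (h2 : ∀ j, WD j ψ (G j)) :
    (ofComp (Fin.cons ψ fun j => (Complex.I / (ν : ℂ)) • P.s • G j) : State n) ∈ P.eigen ν := by
  have hν' : (ν : ℂ) ≠ 0 := by exact_mod_cast hν
  -- The second component is forced by `∇ψ = -iν g`.
  set V : State n := ofComp (Fin.cons ψ fun j => (Complex.I / (ν : ℂ)) • P.s • G j) with hV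
  have h0 : comp 0 V = ψ := by simp [hV, comp_ofComp]
  have hs : ∀ j : Fin n, comp j.succ V = (Complex.I / (ν : ℂ)) • P.s • G j := fun j => by
    simp [hV, comp_ofComp]
  have hg : ∀ j : Fin n, P.g j V = (Complex.I / (ν : ℂ)) • G j := fun j => by
    rw [P.g_apply, hs, smul_comm, ← mul_smul, P.r_mul_s, one_smul]
  have hI : Complex.I * (ν : ℂ) * (Complex.I / (ν : ℂ)) = -1 := by
    field_simp; simp
  refine ⟨⟨(Complex.I / (ν : ℂ)) • ψ, fun j => ?_⟩, fun m => ?_, fun j => ?_⟩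
  · rw [hg]; exact (h2 j).smul _
  · have h3 : ∀ j : Fin n, P.s • comp j.succ V = (Complex.I / (ν : ℂ)) • P.s • P.s • G j :=
      fun j => by rw [hs, smul_comm]
    simp only [h3, ContinuousLinearMap.map_smul, h0, smul_eq_mul, mul_left_comm (freq m _)]
    rw [← Finset.mul_sum, h1 m, map_neg, map_neg, ContinuousLinearMap.map_smul,
      ContinuousLinearMap.map_smul, smul_eq_mul, smul_eq_mul]
    field_simp
  · rw [h0, ContinuousLinearMap.map_smul, hg, smul_smul, hI, neg_smul, one_smul, neg_neg]
    exact h2 j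

theorem Density.mem_eigen_zero {ψ : ScalarL2 n} (h : ∀ j, WD j ψ 0) :
    emb 0 ψ ∈ P.eigen 0 := by
  have hs : ∀ j : Fin n, comp j.succ (emb 0 ψ : State n) = 0 := fun j => by
    rw [comp_emb, if_neg (Fin.succ_ne_zero j)]
  refine ⟨⟨0, fun j => ?_⟩, fun m => ?_, fun j => ?_⟩
  · rw [P.g_apply, hs, smul_zero]; exact WD.zero j
  · simp [hs]
  · rw [comp_emb, if_pos rfl]; simpa using h j

theorem inner_ofComp_cons (ψ : ScalarL2 n) (F : Fin n → ScalarL2 n) (V : State n) :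
    inner ℂ (ofComp (Fin.cons ψ F) : State n) V
      = inner ℂ ψ (comp 0 V) + ∑ j : Fin n, inner ℂ (F j) (comp j.succ V) := by
  rw [inner_eq_sum, Fin.sum_univ_succ]
  simp [comp_ofComp]

/-- Pair the equation `-div(ρ∇ψ) = qψ` with the conjugate of `ψ`. It follows that `q` is real and
nonnegative when `ψ ≠ 0`. -/
theorem Density.scalar_energy {ψ : ScalarL2 n} {G : Fin n → ScalarL2 n} {q : ℂ}
    (h1 : WDiv (fun j => P.s • P.s • G j) (-(q • ψ))) (h2 : ∀ j, WD j ψ (G j)) :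
    ((∑ j, ‖P.s • G j‖ ^ 2 : ℝ) : ℂ) = q * ((‖ψ‖ ^ 2 : ℝ) : ℂ) := by
  have h := h1.pair fun j => (h2 j).conj
  simp only [map_neg, neg_apply, neg_neg, ContinuousLinearMap.map_smul, smul_apply,
    smul_eq_mul] at h
  have h3 : ∀ f : ScalarL2 n, ((‖f‖ ^ 2 : ℝ) : ℂ) = bil f (conjL f) := fun f => by
    rw [bil_comm, ← inner_eq_bil, inner_self_eq_norm_sq_to_K]; simp
  rw [h3, ← h, Complex.ofReal_sum]
  refine Finset.sum_congr rfl fun j _ => ?_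
  rw [h3, conjL_cont_smul, P.star_s, bil_smul P.s (P.s • G j)]

theorem Density.exists_sq_eq {ψ : ScalarL2 n} (hψ : ψ ≠ 0) {G : Fin n → ScalarL2 n} {q : ℂ}
    (h1 : WDiv (fun j => P.s • P.s • G j) (-(q • ψ))) (h2 : ∀ j, WD j ψ (G j)) :
    ∃ μ : ℝ, (μ : ℂ) ^ 2 = q := by
  have hE := P.scalar_energy h1 h2
  have hnorm : (0 : ℝ) < ‖ψ‖ ^ 2 := pow_pos (norm_pos_iff.mpr hψ) 2
  have h0 : ((‖ψ‖ ^ 2 : ℝ) : ℂ) ≠ 0 := by exact_mod_cast hnorm.ne'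
  have hS : 0 ≤ ∑ j, ‖P.s • G j‖ ^ 2 := Finset.sum_nonneg fun _ _ => sq_nonneg _
  generalize ∑ j, ‖P.s • G j‖ ^ 2 = S at hE hS
  refine ⟨Real.sqrt (S / ‖ψ‖ ^ 2), ?_⟩
  rw [← Complex.ofReal_pow, Real.sq_sqrt (div_nonneg hS hnorm.le), Complex.ofReal_div, hE,
    mul_div_cancel_right₀ _ h0]

/-- Zero energy forces `ψ` to be constant. Then `(ψ, 0)` lies in the kernel of `L`, and `w` has mean
zero. -/
theorem Density.inner_eigenfunction_zero {V : State n} (hV : ∀ U ∈ P.eigen 0, inner ℂ U V = 0)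
    {w : ScalarL2 n} (hw0 : fc 0 w = 0) {ψ : ScalarL2 n} {G : Fin n → ScalarL2 n}
    (h1 : WDiv (fun j => P.s • P.s • G j) 0) (h2 : ∀ j, WD j ψ (G j)) :
    inner ℂ ψ (comp 0 V) = 0 ∧ inner ℂ ψ w = 0 := by
  have hE := P.scalar_energy (q := 0) (by simpa using h1) h2
  rw [zero_mul] at hE
  have hsum : ∑ j, ‖P.s • G j‖ ^ 2 = 0 := by exact_mod_cast hE
  have hG0 : ∀ j, G j = 0 := fun j => by
    have h3 := (Finset.sum_eq_zero_iff_of_nonneg fun j _ => sq_nonneg _).mp hsum j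
      (Finset.mem_univ j)
    have h4 : P.s • G j = 0 := norm_eq_zero.mp (pow_eq_zero_iff two_ne_zero |>.mp h3)
    rw [← one_smul (Cont n) (G j), ← P.r_mul_s, mul_smul, h4, smul_zero]
  have hψ2 : ∀ j, WD j ψ 0 := fun j => hG0 j ▸ h2 j
  refine ⟨?_, ?_⟩
  · rw [← inner_emb]; exact hV _ (P.mem_eigen_zero hψ2)
  · refine (hasSum_inner_fc ψ w).unique ?_
    refine hasSum_zero.congr_fun fun m => ?_
    by_cases hm : m = 0
    · rw [hm, hw0, mul_zero]
    · obtain ⟨i, hi⟩ := Function.ne_iff.mp hm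
      have h3 := hψ2 i m
      rw [map_zero] at h3
      have h4 : freq m i ≠ 0 := by
        have hi' : (m i : ℂ) ≠ 0 := by exact_mod_cast hi
        exact mul_ne_zero (mul_ne_zero (mul_ne_zero two_ne_zero
          (by exact_mod_cast Real.pi_ne_zero)) Complex.I_ne_zero) hi'
      rw [(mul_eq_zero.mp h3.symm).resolve_left h4, map_zero, zero_mul]

/-- The function `ψ` gives eigenvectors for both `iμ` and `-iμ`. They differ in the sign of the
second component, so the sum and the difference of the two orthogonality relations separate `φ` from
`w`. -/
theorem Density.inner_eigenfunction_pos {V : State n}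
    (hV : ∀ μ, ∀ U ∈ P.eigen μ, inner ℂ U V = 0)
    {w : ScalarL2 n} (hw : ∀ j, WD j w (P.g j V)) {ψ : ScalarL2 n} {G : Fin n → ScalarL2 n} {μ : ℝ}
    (hμ : μ ≠ 0) (h1 : WDiv (fun j => P.s • P.s • G j) (-((μ : ℂ) ^ 2 • ψ)))
    (h2 : ∀ j, WD j ψ (G j)) : inner ℂ ψ (comp 0 V) = 0 ∧ inner ℂ ψ w = 0 := by
  have hμ' : (μ : ℂ) ≠ 0 := by exact_mod_cast hμ
  have e1 := hV μ _ (P.mem_eigen_of_scalar hμ h1 h2)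
  have e2 := hV (-μ) _ (P.mem_eigen_of_scalar (neg_ne_zero.mpr hμ)
    (by rw [Complex.ofReal_neg, neg_sq]; exact h1) h2)
  rw [inner_ofComp_cons] at e1 e2
  simp only [inner_smul_left] at e1 e2
  rw [← Finset.mul_sum] at e1 e2
  have hA : ∑ j : Fin n, inner ℂ (P.s • G j) (comp j.succ V)
      = starRingEnd ℂ ((μ : ℂ) ^ 2) * inner ℂ ψ w := by
    -- Green's formula moves the gradient from the potential `w` to the equation for `ψ`.
    have h := h1.conj.pair hw
    simp only [conjL_cont_smul, P.star_s, map_neg, neg_apply, neg_neg, conjL_smul,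
      ContinuousLinearMap.map_smul, smul_apply, smul_eq_mul] at h
    rw [inner_eq_bil, ← h]
    refine Finset.sum_congr rfl fun j _ => ?_
    rw [inner_eq_bil, conjL_cont_smul, P.star_s, bil_smul P.s (P.s • conjL (G j)), P.s_smul_g]
  rw [hA] at e1 e2
  have hc : starRingEnd ℂ (Complex.I / ((-μ : ℝ) : ℂ)) = -starRingEnd ℂ (Complex.I / (μ : ℂ)) := by
    rw [Complex.ofReal_neg, div_neg, map_neg]
  rw [hc] at e2
  refine ⟨by linear_combination (e1 + e2) / 2, ?_⟩
  have h3 : starRingEnd ℂ (Complex.I / (μ : ℂ)) * starRingEnd ℂ ((μ : ℂ) ^ 2) * inner ℂ ψ w = 0 := by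
    linear_combination (e1 - e2) / 2
  refine (mul_eq_zero.mp h3).resolve_left (mul_ne_zero ?_ ?_)
  · exact (map_ne_zero _).mpr (div_ne_zero Complex.I_ne_zero hμ')
  · exact (map_ne_zero _).mpr (pow_ne_zero 2 hμ')

/-- The scalar resolvent is injective, which settles `a = 0`. For `a ≠ 0`, the function `ψ = aφ`
satisfies `-div(ρ∇ψ) = (a⁻¹ - 1)ψ`, and the energy identity writes `a⁻¹ - 1` as `μ²`. -/
theorem Density.inner_eigenfunction {V : State n} (hV : ∀ μ, ∀ U ∈ P.eigen μ, inner ℂ U V = 0)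
    {w : ScalarL2 n} (hw0 : fc 0 w = 0) (hw : ∀ j, WD j w (P.g j V)) {φ : ScalarL2 n} {a : ℂ}
    (hφ : P.scalarResolvent φ = a • φ) : inner ℂ φ (comp 0 V) = 0 ∧ inner ℂ φ w = 0 := by
  obtain ⟨G, hG1, hG2⟩ := P.scalarResolvent_spec φ
  rw [hφ] at hG1 hG2
  by_cases ha : a = 0
  · have hG0 : ∀ j, G j = 0 := fun j => (hG2 j).unique (by rw [ha, zero_smul]; exact WD.zero j)
    have hφ0 : φ = 0 := fc_ext fun m => by
      have := hG1 m
      simp only [hG0, smul_zero, map_zero, mul_zero, Finset.sum_const_zero, ha, zero_smul,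
        zero_sub, map_neg] at this
      rw [map_zero]
      exact neg_eq_zero.mp this.symm
    simp [hφ0]
  by_cases hφ0 : φ = 0
  · simp [hφ0]
  obtain ⟨ψ, hψ⟩ : ∃ ψ, ψ = a • φ := ⟨_, rfl⟩
  have hψ0 : ψ ≠ 0 := hψ ▸ smul_ne_zero ha hφ0
  rw [← hψ] at hG1 hG2
  have hψφ : φ = a⁻¹ • ψ := by rw [hψ, smul_smul, inv_mul_cancel₀ ha, one_smul]
  have h1 : WDiv (fun j => P.s • P.s • G j) (-((a⁻¹ - 1) • ψ)) := by
    have : ψ - φ = -((a⁻¹ - 1) • ψ) := by rw [hψφ]; module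
    rwa [this] at hG1
  suffices h : inner ℂ ψ (comp 0 V) = 0 ∧ inner ℂ ψ w = 0 by
    rw [hψφ, inner_smul_left, inner_smul_left, h.1, h.2]; simp
  obtain ⟨μ, hμ⟩ := P.exists_sq_eq hψ0 h1 hG2
  rw [← hμ] at h1
  by_cases hμ0 : μ = 0
  · refine P.inner_eigenfunction_zero (hV 0) hw0 ?_ hG2
    simpa [hμ0] using h1
  · exact P.inner_eigenfunction_pos hV hw hμ0 h1 hG2

/-- The eigenspaces of the wave operator span the acoustic space. -/
theorem Density.eq_zero_of_orthogonal {V : State n} (hVa : V ∈ P.acoustic)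
    (hV : ∀ μ, ∀ U ∈ P.eigen μ, inner ℂ U V = 0) : V = 0 := by
  obtain ⟨w, hw0, hw⟩ := P.exists_potential hVa
  -- By the spectral theorem for compact symmetric operators, the first component of `V` and its
  -- potential both vanish once they are orthogonal to all scalar eigenfunctions.
  have h := ContinuousLinearMap.orthogonalComplement_iSup_eigenspaces_eq_bot
    P.isCompactOperator_scalarResolvent P.isSymmetric_scalarResolvent
  have key : ∀ f : ScalarL2 n, (∀ φ : ScalarL2 n, ∀ a : ℂ, P.scalarResolvent φ = a • φ →
      inner ℂ φ f = 0) → f = 0 := fun f hf => by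
    have : f ∈ (⨆ μ, Module.End.eigenspace
        (P.scalarResolvent : Module.End ℂ (ScalarL2 n)) μ)ᗮ := by
      rw [← Submodule.iInf_orthogonal, Submodule.mem_iInf]
      intro μ
      rw [Submodule.mem_orthogonal]
      intro φ hφ
      exact hf φ μ (Module.End.mem_eigenspace_iff.mp hφ)
    rw [h] at this
    exact (Submodule.mem_bot ℂ).mp this
  have h0 := key _ fun φ a hφ => (P.inner_eigenfunction hV hw0 hw hφ).1
  have h1 := key _ fun φ a hφ => (P.inner_eigenfunction hV hw0 hw hφ).2
  refine comp_ext fun i => ?_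
  refine Fin.cases ?_ (fun j => ?_) i
  · rw [h0, map_zero]
  · have hg : P.g j V = 0 := (hw j).unique (by rw [h1]; exact WD.zero j)
    rw [← P.s_smul_g, hg, smul_zero, map_zero]

end

/-! ### Elliptic regularity and the smoothing operator -/

section

variable {k : ℕ} (P : Density n k)

theorem ContDeriv.mono {k l : ℕ} {c : Cont n} (h : ContDeriv l c) (hkl : k ≤ l) :
    ContDeriv k c := by
  induction hkl with
  | refl => exact h
  | step _ ih => exact ih h.pred

theorem WDiv.cont_smul {F : Fin n → ScalarL2 n} {c : ScalarL2 n} (h : WDiv F c) {a : Cont n}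
    {a' : Fin n → Cont n} (ha : ∀ j, HasPD j a (a' j)) :
    WDiv (fun j => a • F j) (a • c + ∑ j, a' j • F j) := fun m => by
  have h1 := h.pair fun j => (ha j).wd.mFourier_smul (-m)
  simp only [map_add, ContinuousLinearMap.map_smul, freq_neg, smul_eq_mul,
    Finset.sum_add_distrib, neg_mul, Finset.sum_neg_distrib] at h1
  simp only [map_add, map_sum, fc_cont_smul]
  linear_combination -h1

/-- The components of a field lie in `H^j`. -/
def StateSob (j : ℕ) (V : State n) : Prop := ∀ i, Sob j (comp i V)

theorem StateSob.mono {i j : ℕ} {V : State n} (h : StateSob j V) (hij : i ≤ j) : StateSob i V :=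
  fun l => (h l).mono hij

theorem StateSob.sub {j : ℕ} {V W : State n} (hV : StateSob j V) (hW : StateSob j W) :
    StateSob j (V - W) := fun i => by rw [map_sub]; exact (hV i).sub (hW i)

variable {P} in
theorem StateSob.g {j : ℕ} (hj : j ≤ k) {V : State n} (h : StateSob j V) (i : Fin n) :
    Sob j (P.g i V) := (h i.succ).cont_smul (P.contDeriv_r.mono hj)

/-- Elliptic regularity for gradient fields with given divergence. -/
theorem Sob.of_div {j : ℕ} {w d : ScalarL2 n} {g : Fin n → ScalarL2 n} (hw : ∀ i, WD i w (g i))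
    (hg : WDiv g d) (hd : Sob j d) (i : Fin n) : Sob (j + 1) (g i) := fun l => by
  -- The divergence has symbol `-|2πm|²` acting on `w`, which dominates the symbol of every second
  -- derivative.
  have hle : ∀ m, ‖freq m l * fc m (g i)‖ ≤ 1 * ‖fc m d‖ := fun m => by
    have h1 : fc m d = -((∑ a, ‖freq m a‖ ^ 2 : ℝ) : ℂ) * fc m w := by
      rw [← hg m, Complex.ofReal_sum, ← Finset.sum_neg_distrib, Finset.sum_mul]
      refine Finset.sum_congr rfl fun a _ => ?_
      rw [hw a, Complex.ofReal_pow, ← Complex.mul_conj', conj_freq]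
      ring
    have h2 : ‖fc m d‖ = (∑ a, ‖freq m a‖ ^ 2) * ‖fc m w‖ := by
      rw [h1, norm_mul, norm_neg, Complex.norm_of_nonneg (Finset.sum_nonneg fun _ _ => sq_nonneg _)]
    rw [h2, hw i, ← mul_assoc, norm_mul, norm_mul, one_mul]
    refine mul_le_mul_of_nonneg_right ?_ (norm_nonneg _)
    have h3 : ∀ a, ‖freq m a‖ ^ 2 ≤ ∑ a, ‖freq m a‖ ^ 2 := fun a =>
      Finset.single_le_sum (f := fun a => ‖freq m a‖ ^ 2) (fun _ _ => sq_nonneg _)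
        (Finset.mem_univ a)
    nlinarith [h3 l, h3 i, sq_nonneg (‖freq m l‖ - ‖freq m i‖)]
  obtain ⟨G, hG⟩ := exists_fc_eq_of_le hle
  exact ⟨G, hG, hd.of_le fun m => by rw [hG]; exact hle m⟩

/-- Since `g = ρ⁻¹ √ρ h`, the product rule expresses `div g` by `div(√ρ h)` and terms of order zero
in `h`. The flat estimate for gradient fields then gains one derivative. -/
theorem Density.sob_of_div {j : ℕ} (hj : j + 1 ≤ k) {V : State n} (hV : V ∈ P.acoustic)
    (hVj : StateSob j V) {c : ScalarL2 n} (hc : Sob j c)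
    (hdiv : WDiv (fun i => P.s • comp i.succ V) c) (i : Fin n) : Sob (j + 1) (comp i.succ V) := by
  choose r' hr' hr'j using P.contDeriv_r.mono hj
  obtain ⟨w, hw⟩ := hV
  have hr := P.contDeriv_r.mono (Nat.le_of_succ_le hj)
  have hs := P.contDeriv_s.mono (Nat.le_of_succ_le hj)
  have h1 := (hdiv.cont_smul hr').cont_smul hr'
  have h2 : (fun i : Fin n => P.r • P.r • P.s • comp i.succ V) = fun i => P.g i V := by
    ext1 i
    rw [← mul_smul P.r P.s, P.r_mul_s, one_smul, P.g_apply]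
  rw [h2] at h1
  have h3 : Sob (j + 1) (P.g i V) := Sob.of_div hw h1 (by
    refine Sob.add (Sob.cont_smul hr (Sob.add (Sob.cont_smul hr hc) ?_)) ?_
    · exact Sob.sum _ fun a _ => Sob.cont_smul (hr'j a) (Sob.cont_smul hs (hVj _))
    · exact Sob.sum _ fun a _ => Sob.cont_smul (hr'j a)
        (Sob.cont_smul hr (Sob.cont_smul hs (hVj _)))) i
  rw [← P.s_smul_g]
  exact h3.cont_smul (P.contDeriv_s.mono hj)

/-- Bootstrapping: both resolvent equations gain a derivative as soon as `F` and the resolvent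
itself lie in `H^j`. The smoothness of `ρ` limits this to `j + 1 ≤ k`. -/
theorem Density.resolvent_sob {j : ℕ} : j + 1 ≤ k → ∀ {F : State n}, F ∈ P.acoustic → StateSob j F →
    StateSob (j + 1) (P.resolvent F) := by
  have key : ∀ j, j + 1 ≤ k → ∀ F : State n, F ∈ P.acoustic → StateSob j F →
      StateSob j (P.resolvent F) → StateSob (j + 1) (P.resolvent F) := by
    intro j hj F hF hFj hR i
    have h := P.isResolvent_resolvent F
    refine Fin.cases ?_ (fun i => ?_) i
    · exact fun l => ⟨_, h.2 l, (hFj.sub hR).g (Nat.le_of_succ_le hj) l⟩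
    · exact P.sob_of_div hj (P.resolvent_mem_acoustic hF) hR ((hFj 0).sub (hR 0)) h.1 i
  induction j with
  | zero => exact fun hj F hF hFj => key 0 hj F hF hFj fun _ => trivial
  | succ j ih =>
    exact fun hj F hF hFj => key (j + 1) hj F hF hFj
      (ih (Nat.le_of_succ_le hj) hF (hFj.mono (Nat.le_succ j)))

/-- Take `F = (1 - L)V`, which costs one derivative and has the potential `w + φ`. -/
theorem Density.exists_resolvent_eq {j : ℕ} (hj : j + 1 ≤ k) {V : State n} (hV : V ∈ P.acoustic)
    (hVj : StateSob (j + 1) V) : ∃ F ∈ P.acoustic, StateSob j F ∧ V = P.resolvent F := by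
  have hs := P.contDeriv_s.mono hj
  choose e he hej using fun i : Fin n => (hVj i.succ).cont_smul hs i
  choose f hf hfj using hVj 0
  obtain ⟨w, hw⟩ := hV
  let F : State n := ofComp (Fin.cons (comp 0 V + ∑ i, e i) fun i => comp i.succ V + P.s • f i)
  have hF0 : comp 0 F = comp 0 V + ∑ i, e i := by simp [F, comp_ofComp]
  have hFs : ∀ i : Fin n, comp i.succ F = comp i.succ V + P.s • f i := fun i => by
    simp [F, comp_ofComp]
  have hg : ∀ i : Fin n, P.g i F = P.g i V + f i := fun i => by
    rw [P.g_apply, hFs, smul_add, ← mul_smul, P.r_mul_s, one_smul, P.g_apply]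
  refine ⟨F, ⟨w + comp 0 V, fun i => by rw [hg]; exact (hw i).add (hf i)⟩, fun i => ?_, ?_⟩
  · refine Fin.cases ?_ (fun i => ?_) i
    · rw [hF0]; exact (hVj 0).pred.add (Sob.sum _ fun i _ => hej i)
    · rw [hFs]
      exact (hVj _).pred.add ((hfj i).cont_smul (P.contDeriv_s.mono (Nat.le_of_succ_le hj)))
  · refine Density.IsResolvent.eq ⟨?_, fun i => ?_⟩
    · rw [hF0, add_sub_cancel_left]; exact WDiv.of_WD he
    · rw [map_sub, hg, add_sub_cancel_left]; exact hf i

instance : P.acoustic.HasOrthogonalProjection :=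
  haveI := P.isClosed_acoustic.completeSpace_coe
  inferInstance

theorem Density.resolvent_pow_mem {F : State n} (hF : F ∈ P.acoustic) (j : ℕ) :
    (P.resolvent ^ j) F ∈ P.acoustic := by
  induction j with
  | zero => simpa using hF
  | succ j ih =>
    rw [pow_succ', mul_apply_eq_comp]
    exact P.resolvent_mem_acoustic ih

theorem Density.resolvent_pow_sob {F : State n} (hF : F ∈ P.acoustic) {j : ℕ} (hj : j ≤ k) :
    StateSob j ((P.resolvent ^ j) F) := by
  induction j with
  | zero => exact fun _ => trivial
  | succ j ih =>
    rw [pow_succ', mul_apply_eq_comp]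
    exact P.resolvent_sob hj (P.resolvent_pow_mem hF j) (ih (Nat.le_of_succ_le hj))

theorem Density.exists_resolvent_pow_eq {j : ℕ} : j ≤ k → ∀ {V : State n}, V ∈ P.acoustic →
    StateSob j V → ∃ F ∈ P.acoustic, V = (P.resolvent ^ j) F := by
  induction j with
  | zero => exact fun _ V hV _ => ⟨V, hV, by simp⟩
  | succ j ih =>
    intro hj V hV hVj
    obtain ⟨F, hF, hFj, rfl⟩ := P.exists_resolvent_eq hj hV hVj
    obtain ⟨G, hG, rfl⟩ := ih (Nat.le_of_succ_le hj) hF hFj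
    exact ⟨G, hG, by rw [pow_succ', mul_apply_eq_comp]⟩

/-- The `k`-th power of the resolvent on the acoustic space; its range is `𝔻 ∩ H^k`. -/
def Density.smoothing : State n →L[ℂ] State n := (P.resolvent ^ k).comp P.acoustic.starProjection

theorem Density.smoothing_mem (Z : State n) : P.smoothing Z ∈ P.acoustic :=
  P.resolvent_pow_mem (Submodule.starProjection_apply_mem _ _) k

theorem Density.smoothing_sob (Z : State n) : StateSob k (P.smoothing Z) :=
  P.resolvent_pow_sob (Submodule.starProjection_apply_mem _ _) le_rfl

theorem Density.smoothing_of_mem {Z : State n} (hZ : Z ∈ P.acoustic) :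
    P.smoothing Z = (P.resolvent ^ k) Z := by
  rw [Density.smoothing, ContinuousLinearMap.comp_apply, Submodule.starProjection_eq_self_iff.mpr hZ]

theorem Density.exists_smoothing_eq {V : State n} (hV : V ∈ P.acoustic) (hVk : StateSob k V) :
    ∃ Z ∈ P.acoustic, P.smoothing Z = V := by
  obtain ⟨Z, hZ, rfl⟩ := P.exists_resolvent_pow_eq le_rfl hV hVk
  exact ⟨Z, hZ, P.smoothing_of_mem hZ⟩

theorem one_sub_I_mul_ne_zero (α : ℝ) : (1 - Complex.I * (α : ℂ)) ≠ 0 := fun h => by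
  have := congrArg Complex.re h
  simp at this

theorem Density.smoothing_eigen {α : ℝ} {V : State n} (hV : V ∈ P.eigen α) :
    P.smoothing V = ((1 - Complex.I * (α : ℂ))⁻¹ ^ k) • V := by
  rw [P.smoothing_of_mem hV.1]
  have key : ∀ j : ℕ, (P.resolvent ^ j) V = ((1 - Complex.I * (α : ℂ))⁻¹ ^ j) • V := fun j => by
    induction j with
    | zero => simp
    | succ j ih =>
      rw [pow_succ', mul_apply_eq_comp, ih, ContinuousLinearMap.map_smul,
        P.resolvent_eigen hV, smul_smul, pow_succ]
  exact key k

theorem Density.smoothing_eigen_mem {α : ℝ} {V : State n} (hV : V ∈ P.eigen α) :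
    P.smoothing V ∈ P.eigen α := by
  rw [P.smoothing_eigen hV]; exact Submodule.smul_mem _ _ hV

/-- Eigenvectors lie in the range of the smoothing operator, so they are regular enough for the
pointwise product rules. -/
theorem Density.eq_smul_smoothing {α : ℝ} {V : State n} (hV : V ∈ P.eigen α) :
    V = P.smoothing (((1 - Complex.I * (α : ℂ)) ^ k) • V) := by
  rw [ContinuousLinearMap.map_smul, P.smoothing_eigen hV, smul_smul, ← mul_pow,
    mul_inv_cancel₀ (one_sub_I_mul_ne_zero α), one_pow, one_smul]

end

/-! ### The wave group as a spectral series -/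

section

section Spectral

variable {E : Type*} [NormedAddCommGroup E] [InnerProductSpace ℂ E] {ι : Type*}
  {K : ι → Submodule ℂ E} [∀ i, (K i).HasOrthogonalProjection]

/-- Bessel's inequality: the partial sum `p` satisfies `⟨p, v⟩ = ‖p‖²`, and Cauchy–Schwarz
concludes. -/
theorem summable_norm_sq_starProjection
    (hK : OrthogonalFamily ℂ (fun i => K i) fun i => (K i).subtypeₗᵢ) (v : E) (t : Finset ι) :
    ∑ i ∈ t, ‖(K i).starProjection v‖ ^ 2 ≤ ‖v‖ ^ 2 := by
  have h1 : ‖∑ i ∈ t, (K i).starProjection v‖ ^ 2 = ∑ i ∈ t, ‖(K i).starProjection v‖ ^ 2 :=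
    hK.norm_sum (fun i => (K i).orthogonalProjectionOnto v) t
  have h2 : inner ℂ (∑ i ∈ t, (K i).starProjection v) v
      = ((∑ i ∈ t, ‖(K i).starProjection v‖ ^ 2 : ℝ) : ℂ) := by
    rw [sum_inner, Complex.ofReal_sum]
    refine Finset.sum_congr rfl fun i _ => ?_
    have h3 : inner ℂ ((K i).starProjection v) v
        = inner ℂ ((K i).starProjection v) ((K i).starProjection v) := by
      rw [← sub_eq_zero, ← inner_sub_right]
      exact Submodule.inner_right_of_mem_orthogonal (Submodule.starProjection_apply_mem _ _)
        (Submodule.sub_starProjection_mem_orthogonal v)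
    rw [h3, inner_self_eq_norm_sq_to_K]
    simp
  have h3 := norm_inner_le_norm (𝕜 := ℂ) (∑ i ∈ t, (K i).starProjection v) v
  rw [h2, ← h1, Complex.norm_of_nonneg (sq_nonneg _)] at h3
  rw [← h1]
  nlinarith [norm_nonneg (∑ i ∈ t, (K i).starProjection v), norm_nonneg v]

variable [CompleteSpace E]

theorem summable_smul_starProjection
    (hK : OrthogonalFamily ℂ (fun i => K i) fun i => (K i).subtypeₗᵢ) {c : ι → ℂ}
    (hc : ∀ i, ‖c i‖ = 1) (v : E) : Summable fun i => c i • (K i).starProjection v := by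
  refine (hK.summable_iff_norm_sq_summable
    (fun i => c i • (K i).orthogonalProjectionOnto v)).mpr ?_
  refine summable_of_sum_le (c := ‖v‖ ^ 2) (fun i => sq_nonneg _) fun t => ?_
  simp only [norm_smul, hc, one_mul]
  exact summable_norm_sq_starProjection hK v t

theorem norm_tsum_smul_starProjection_le
    (hK : OrthogonalFamily ℂ (fun i => K i) fun i => (K i).subtypeₗᵢ) {c : ι → ℂ}
    (hc : ∀ i, ‖c i‖ = 1) (v : E) : ‖∑' i, c i • (K i).starProjection v‖ ≤ ‖v‖ := by
  refine le_of_tendsto (summable_smul_starProjection hK hc v).hasSum.norm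
    (Eventually.of_forall fun t => ?_)
  have h1 : ‖∑ i ∈ t, c i • (K i).starProjection v‖ ^ 2
      = ∑ i ∈ t, ‖c i • (K i).orthogonalProjectionOnto v‖ ^ 2 :=
    hK.norm_sum (fun i => c i • (K i).orthogonalProjectionOnto v) t
  simp only [norm_smul, hc, one_mul] at h1
  refine abs_le_of_sq_le_sq' ?_ (norm_nonneg v) |>.2
  rw [h1]
  exact summable_norm_sq_starProjection hK v t

end Spectral

variable {k : ℕ} (P : Density n k)

instance (μ : ℝ) : (P.eigen μ).HasOrthogonalProjection :=
  haveI := (P.isClosed_eigen μ).completeSpace_coe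
  inferInstance

theorem Density.orthogonalFamily_eigen :
    OrthogonalFamily ℂ (fun μ => P.eigen μ) fun μ => (P.eigen μ).subtypeₗᵢ :=
  fun _ _ h v w => P.eigen_orthogonal h v.2 w.2

/-- The phase `e^{iμs}`. -/
def phase (μ s : ℝ) : ℂ := Complex.exp (Complex.I * (μ : ℂ) * (s : ℂ))

theorem norm_phase (μ s : ℝ) : ‖phase μ s‖ = 1 := by
  rw [phase, mul_assoc, ← Complex.ofReal_mul, mul_comm, Complex.norm_exp_ofReal_mul_I]

theorem phase_add (μ ν s : ℝ) : phase (μ + ν) s = phase μ s * phase ν s := by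
  rw [phase, phase, phase, ← Complex.exp_add]
  congr 1
  push_cast
  ring

theorem phase_neg (μ s : ℝ) : phase μ (-s) = phase (-μ) s := by
  rw [phase, phase]
  congr 1
  push_cast
  ring

theorem phase_zero (s : ℝ) : phase 0 s = 1 := by simp [phase]

theorem continuous_phase (μ : ℝ) : Continuous (phase μ) := by
  unfold phase; fun_prop

/-- The wave group as a bounded operator. -/
def Density.group (s : ℝ) : State n →L[ℂ] State n :=
  LinearMap.mkContinuous
    { toFun := fun V => ∑' μ : ℝ, phase μ s • (P.eigen μ).starProjection V
      map_add' := fun V W => by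
        simp only [map_add, smul_add]
        exact (summable_smul_starProjection P.orthogonalFamily_eigen (fun μ => norm_phase μ s)
          V).tsum_add (summable_smul_starProjection P.orthogonalFamily_eigen
            (fun μ => norm_phase μ s) W)
      map_smul' := fun a V => by
        simp only [ContinuousLinearMap.map_smul, smul_comm _ a, RingHom.id_apply]
        exact (summable_smul_starProjection P.orthogonalFamily_eigen
          (fun μ => norm_phase μ s) V).tsum_const_smul a } 1 fun V => by
    rw [one_mul]
    exact norm_tsum_smul_starProjection_le P.orthogonalFamily_eigen (fun μ => norm_phase μ s) V

theorem Density.group_apply (s : ℝ) (V : State n) :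
    P.group s V = ∑' μ : ℝ, phase μ s • (P.eigen μ).starProjection V := rfl

theorem Density.norm_group_le (s : ℝ) : ‖P.group s‖ ≤ 1 :=
  LinearMap.mkContinuous_norm_le _ zero_le_one _

theorem Density.norm_group_apply_le (s : ℝ) (V : State n) : ‖P.group s V‖ ≤ ‖V‖ := by
  simpa using (P.group s).le_of_opNorm_le (P.norm_group_le s) V

theorem Density.eigen_le_acoustic (μ : ℝ) : P.eigen μ ≤ P.acoustic := fun _ hV => hV.1

theorem Density.group_eigen (s : ℝ) {μ : ℝ} {V : State n} (hV : V ∈ P.eigen μ) :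
    P.group s V = phase μ s • V := by
  rw [P.group_apply, tsum_eq_single μ, Submodule.starProjection_eq_self_iff.mpr hV]
  intro ν hν
  have : (P.eigen ν).starProjection V = 0 := by
    rw [Submodule.starProjection_apply_eq_zero_iff, Submodule.mem_orthogonal]
    exact fun u hu => P.eigen_orthogonal hν hu hV
  rw [this, smul_zero]

theorem Density.group_of_orthogonal (s : ℝ) {V : State n} (hV : V ∈ P.acousticᗮ) :
    P.group s V = 0 := by
  rw [P.group_apply]
  have : ∀ μ, phase μ s • (P.eigen μ).starProjection V = 0 := fun μ => by
    have : (P.eigen μ).starProjection V = 0 := by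
      rw [Submodule.starProjection_apply_eq_zero_iff]
      exact Submodule.orthogonal_le (P.eigen_le_acoustic μ) hV
    rw [this, smul_zero]
  simp only [this, tsum_zero]

/-- The group annihilates the complement of the acoustic space, because all eigenspaces lie inside
it. -/
theorem Density.group_proj (s : ℝ) (V : State n) :
    P.group s (P.acoustic.starProjection V) = P.group s V := by
  have := P.group_of_orthogonal s (Submodule.sub_starProjection_mem_orthogonal (K := P.acoustic) V)
  rw [map_sub, sub_eq_zero] at this
  exact this.symm

/-- A closed subspace that contains all eigenvectors contains the acoustic space. -/
theorem Density.acoustic_le {M : Submodule ℂ (State n)} (hM : IsClosed (M : Set (State n)))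
    (h : ∀ μ, P.eigen μ ≤ M) : P.acoustic ≤ M := by
  intro V hV
  have hN : IsClosed ((M ⊓ P.acoustic : Submodule ℂ (State n)) : Set (State n)) :=
    hM.inter P.isClosed_acoustic
  have : CompleteSpace (M ⊓ P.acoustic : Submodule ℂ (State n)) := hN.completeSpace_coe
  -- The remainder of `V` after this projection is an acoustic state orthogonal to every
  -- eigenvector, hence zero by completeness.
  have hmem := Submodule.starProjection_apply_mem (M ⊓ P.acoustic) V
  have h0 : V - (M ⊓ P.acoustic).starProjection V = 0 :=
    P.eq_zero_of_orthogonal (P.acoustic.sub_mem hV hmem.2) fun μ U hU =>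
      Submodule.inner_right_of_mem_orthogonal (K := M ⊓ P.acoustic)
        (Submodule.mem_inf.mpr ⟨h μ hU, P.eigen_le_acoustic μ hU⟩)
        (Submodule.sub_starProjection_mem_orthogonal V)
  rw [sub_eq_zero.mp h0]
  exact hmem.1

theorem Density.group_mem_acoustic (s : ℝ) (V : State n) : P.group s V ∈ P.acoustic := by
  rw [P.group_apply]
  refine P.isClosed_acoustic.mem_of_tendsto (summable_smul_starProjection P.orthogonalFamily_eigen
    (fun μ => norm_phase μ s) V).hasSum (Eventually.of_forall fun t => ?_)
  exact Submodule.sum_mem _ fun μ _ => Submodule.smul_mem _ _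
    (P.eigen_le_acoustic μ (Submodule.starProjection_apply_mem _ _))

theorem isClosed_setOf_continuous {E X : Type*} [NormedAddCommGroup E] [NormedSpace ℂ E]
    [NormedAddCommGroup X] [NormedSpace ℂ X] {A : ℝ → E →L[ℂ] X} {C : ℝ} (hC : ∀ s, ‖A s‖ ≤ C) :
    IsClosed {V | Continuous fun s => A s V} := by
  refine isClosed_of_closure_subset fun V hV => ?_
  refine continuous_of_uniform_approx_of_continuous fun u hu => ?_
  obtain ⟨ε, hε, hu⟩ := Metric.mem_uniformity_dist.mp hu
  have hC0 : 0 ≤ C := (norm_nonneg _).trans (hC 0)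
  obtain ⟨W, hW, hd⟩ := Metric.mem_closure_iff.mp hV (ε / (C + 1)) (by positivity)
  refine ⟨fun s => A s W, hW, fun s => hu ?_⟩
  rw [dist_eq_norm, ← map_sub]
  rw [dist_eq_norm] at hd
  calc ‖A s (V - W)‖ ≤ C * ‖V - W‖ := (A s).le_of_opNorm_le (hC s) _
    _ ≤ C * (ε / (C + 1)) := by gcongr
    _ < ε := by
      rw [mul_div_assoc', div_lt_iff₀ (by positivity)]; nlinarith

/-- The vectors with continuous orbits. -/
def continuousSubmodule {E X : Type*} [NormedAddCommGroup E] [NormedSpace ℂ E]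
    [NormedAddCommGroup X] [NormedSpace ℂ X] (A : ℝ → E →L[ℂ] X) : Submodule ℂ E where
  carrier := {V | Continuous fun s => A s V}
  zero_mem' := by simpa using continuous_const
  add_mem' := fun {V W} hV hW => by
    have h : Continuous fun s => A s V + A s W := Continuous.add hV hW
    simpa only [Set.mem_ofPred_eq, map_add] using h
  smul_mem' := fun a V hV => by
    have h : Continuous fun s => a • A s V := Continuous.const_smul hV a
    simpa only [Set.mem_ofPred_eq, ContinuousLinearMap.map_smul] using h

theorem Density.continuous_group (V : State n) : Continuous fun s => P.group s V := by
  have h := P.acoustic_le (M := continuousSubmodule P.group)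
    (isClosed_setOf_continuous P.norm_group_le) fun μ U hU => by
      change Continuous fun s => P.group s U
      simp only [P.group_eigen _ hU]
      exact (continuous_phase μ).smul continuous_const
  have h' : Continuous fun s => P.group s (P.acoustic.starProjection V) :=
    h (Submodule.starProjection_apply_mem P.acoustic V)
  simpa only [P.group_proj] using h'

/-- Strong continuity in time and the contraction bound together give joint continuity. -/
theorem Density.continuous_group_apply {α : Type*} [TopologicalSpace α] {t : α → ℝ}
    {x : α → State n} (ht : Continuous t) (hx : Continuous x) :
    Continuous fun a => P.group (t a) (x a) := by
  rw [continuous_iff_continuousAt]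
  intro a
  rw [ContinuousAt, tendsto_iff_norm_sub_tendsto_zero]
  have h1 : Tendsto (fun b => ‖x b - x a‖ + ‖P.group (t b) (x a) - P.group (t a) (x a)‖) (𝓝 a)
      (𝓝 0) := by
    have e1 := (tendsto_iff_norm_sub_tendsto_zero.mp (hx.tendsto a))
    have e2 := tendsto_iff_norm_sub_tendsto_zero.mp
      (((P.continuous_group (x a)).comp ht).tendsto a)
    simpa using e1.add e2
  refine squeeze_zero (fun _ => norm_nonneg _) (fun b => ?_) h1
  have : P.group (t b) (x b) - P.group (t a) (x a) = P.group (t b) (x b - x a)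
      + (P.group (t b) (x a) - P.group (t a) (x a)) := by rw [map_sub]; abel
  rw [this]
  exact (norm_add_le _ _).trans (add_le_add_left (P.norm_group_apply_le _ _) _)

theorem isClosed_eqLocus {E X : Type*} [NormedAddCommGroup E] [NormedSpace ℂ E]
    [NormedAddCommGroup X] [NormedSpace ℂ X] (A B : E →L[ℂ] X) :
    IsClosed ((LinearMap.eqLocus (A : E →ₗ[ℂ] X) (B : E →ₗ[ℂ] X) : Submodule ℂ E) : Set E) :=
  isClosed_eq A.continuous B.continuous

/-- Bounded operators that agree on the eigenvectors agree on the acoustic space. -/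
theorem Density.eq_of_eigen {X : Type*} [NormedAddCommGroup X] [NormedSpace ℂ X]
    {A B : State n →L[ℂ] X} (h : ∀ μ, ∀ U ∈ P.eigen μ, A U = B U) {V : State n}
    (hV : V ∈ P.acoustic) : A V = B V :=
  P.acoustic_le (isClosed_eqLocus A B) (fun μ U hU => h μ U hU) hV

theorem Density.smoothing_proj (V : State n) :
    P.smoothing (P.acoustic.starProjection V) = P.smoothing V := by
  rw [Density.smoothing, ContinuousLinearMap.comp_apply, ContinuousLinearMap.comp_apply,
    Submodule.starProjection_eq_self_iff.mpr (Submodule.starProjection_apply_mem _ _)]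

theorem Density.smoothing_group (s : ℝ) (V : State n) :
    P.smoothing (P.group s V) = P.group s (P.smoothing V) := by
  have := P.eq_of_eigen (A := P.smoothing.comp (P.group s)) (B := (P.group s).comp P.smoothing)
    (fun μ U hU => by
      simp only [ContinuousLinearMap.comp_apply]
      rw [P.group_eigen s hU, P.group_eigen s (P.smoothing_eigen_mem hU),
        ContinuousLinearMap.map_smul]) (Submodule.starProjection_apply_mem P.acoustic V)
  simpa only [ContinuousLinearMap.comp_apply, P.group_proj, P.smoothing_proj] using this

/-- The pairing vanishes unless `β = -α`, and in that case the two phases coincide. -/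
theorem Density.dotL_eigen_group (s : ℝ) {α β : ℝ} {X Y : State n} (hX : X ∈ P.eigen α)
    (hY : Y ∈ P.eigen β) : dotL (P.group (-s) X) Y = dotL X (P.group s Y) := by
  rw [P.group_eigen _ hX, P.group_eigen _ hY, ContinuousLinearMap.map_smul,
    ContinuousLinearMap.map_smul, smul_apply]
  by_cases h : α + β = 0
  · rw [phase_neg, show -α = β by linarith]
  · rw [P.dotL_eq_zero hX hY h, smul_zero, smul_zero]

theorem Density.dotL_of_orthogonal {X Y : State n} (hX : X ∈ P.acousticᗮ) (hY : Y ∈ P.acoustic) :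
    dotL X Y = 0 := by
  rw [dotL_comm, ← conjV_conjV Y, ← inner_eq_dotL]
  exact Submodule.inner_right_of_mem_orthogonal (P.conjV_mem_acoustic hY) hX

/-- The bilinear transpose of the wave group. -/
theorem Density.dotL_group (s : ℝ) (X : State n) {Y : State n} (hY : Y ∈ P.acoustic) :
    dotL (P.group (-s) X) Y = dotL X (P.group s Y) := by
  have h1 : ∀ α, ∀ U ∈ P.eigen α, dotL (P.group (-s) U) Y = dotL U (P.group s Y) :=
    fun α U hU => P.eq_of_eigen (A := dotL (P.group (-s) U)) (B := (dotL U).comp (P.group s))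
      (fun β V hV => P.dotL_eigen_group s hU hV) hY
  have h2 := P.eq_of_eigen (A := (dotL.flip Y).comp (P.group (-s))) (B := dotL.flip (P.group s Y))
    (fun α U hU => h1 α U hU) (Submodule.starProjection_apply_mem P.acoustic X)
  simp only [ContinuousLinearMap.comp_apply, ContinuousLinearMap.flip_apply, P.group_proj] at h2
  rw [h2, eq_comm, ← sub_eq_zero, ← sub_apply, ← map_sub]
  exact P.dotL_of_orthogonal (Submodule.sub_starProjection_mem_orthogonal X)
    (P.group_mem_acoustic s Y)

end

/-! ### Time averages and oscillatory integrals -/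

section

section Mean

theorem exists_mul_norm_sub_lt {E : Type*} [NormedAddCommGroup E] {s : Set E} {V : E} (hV : V ∈ closure s) (C : ℝ) {ε : ℝ}
    (hε : 0 < ε) : ∃ W ∈ s, C * ‖V - W‖ < ε := by
  obtain ⟨W, hW, hd⟩ := Metric.mem_closure_iff.mp hV (ε / (|C| + 1)) (by positivity)
  refine ⟨W, hW, ?_⟩
  rw [dist_eq_norm, lt_div_iff₀ (by positivity)] at hd
  nlinarith [le_abs_self C, norm_nonneg (V - W)]

variable {E X : Type*} [NormedAddCommGroup E] [NormedSpace ℂ E]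
    [NormedAddCommGroup X] [NormedSpace ℂ X]

/-- The average of a function over `[0, τ]`. -/
def average (f : ℝ → X) (τ : ℝ) : X := τ⁻¹ • ∫ s in (0 : ℝ)..τ, f s

/-- The averages over `[0, τ]` converge to `l` as `τ → ∞`. -/
def HasMean (f : ℝ → X) (l : X) : Prop := Tendsto (average f) atTop (𝓝 l)

theorem average_add {f g : ℝ → X} (hf : Continuous f) (hg : Continuous g) (τ : ℝ) :
    average (fun s => f s + g s) τ = average f τ + average g τ := by
  rw [average, intervalIntegral.integral_add (hf.intervalIntegrable _ _)
    (hg.intervalIntegrable _ _), smul_add]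
  rfl

theorem average_smul (c : ℂ) (f : ℝ → X) (τ : ℝ) :
    average (fun s => c • f s) τ = c • average f τ := by
  rw [average, intervalIntegral.integral_smul, smul_comm]
  rfl

theorem norm_average_le {f : ℝ → X} {C : ℝ} (h : ∀ s, ‖f s‖ ≤ C) (τ : ℝ) :
    ‖average f τ‖ ≤ C := by
  have hC : 0 ≤ C := (norm_nonneg _).trans (h 0)
  have h1 := intervalIntegral.norm_integral_le_of_norm_le_const (a := 0) (b := τ)
    (C := C) (f := f) fun s _ => h s
  rw [sub_zero] at h1
  rw [average, norm_smul, norm_inv, Real.norm_eq_abs]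
  rcases eq_or_ne τ 0 with rfl | h0
  · simpa using hC
  · have : 0 < |τ| := abs_pos.mpr h0
    calc |τ|⁻¹ * _ ≤ |τ|⁻¹ * (C * |τ|) := by gcongr
      _ = C := by field_simp

theorem HasMean.add {f g : ℝ → X} {l m : X} (hf : HasMean f l) (hg : HasMean g m)
    (hfc : Continuous f) (hgc : Continuous g) : HasMean (fun s => f s + g s) (l + m) := by
  have : average (fun s => f s + g s) = fun τ => average f τ + average g τ :=
    funext fun τ => average_add hfc hgc τ
  rw [HasMean, this]
  exact Tendsto.add hf hg

theorem HasMean.const_smul {f : ℝ → X} {l : X} (hf : HasMean f l) (c : ℂ) :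
    HasMean (fun s => c • f s) (c • l) := by
  have : average (fun s => c • f s) = fun τ => c • average f τ :=
    funext fun τ => average_smul c f τ
  rw [HasMean, this]
  exact Tendsto.const_smul hf c

theorem hasMean_zero : HasMean (fun _ : ℝ => (0 : X)) 0 := by
  have : average (fun _ : ℝ => (0 : X)) = fun _ => 0 := by
    funext τ
    simp [average]
  rw [HasMean, this]
  exact tendsto_const_nhds

theorem HasMean.map {Y : Type*} [NormedAddCommGroup Y] [NormedSpace ℂ Y] [CompleteSpace X]
    [CompleteSpace Y] {f : ℝ → X} {l : X} (hf : HasMean f l) (hfc : Continuous f)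
    (T : X →L[ℂ] Y) : HasMean (fun s => T (f s)) (T l) := by
  have : average (fun s => T (f s)) = fun τ => T (average f τ) := by
    funext τ
    rw [average, average, T.intervalIntegral_comp_comm (hfc.intervalIntegrable _ _)]
    rw [map_real_smul T T.continuous]
  rw [HasMean, this]
  exact (T.continuous.tendsto l).comp hf

/-- For `α ≠ 0` the primitive of the phase is bounded by `2/|α|`, so the averages decay like `1/τ`.
-/
theorem hasMean_phase_smul [CompleteSpace X] (α : ℝ) (x : X) :
    HasMean (fun s => phase α s • x) (if α = 0 then x else 0) := by
  split_ifs with h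
  · subst h
    simp only [phase_zero, one_smul]
    refine tendsto_const_nhds.congr' ?_
    filter_upwards [eventually_gt_atTop 0] with τ hτ
    rw [average, intervalIntegral.integral_const, sub_zero, smul_smul, inv_mul_cancel₀ hτ.ne',
      one_smul]
  · have hα : Complex.I * (α : ℂ) ≠ 0 :=
      mul_ne_zero Complex.I_ne_zero (Complex.ofReal_ne_zero.mpr h)
    have h1 : ∀ τ, average (fun s => phase α s • x) τ
        = (τ⁻¹ : ℝ) • (((phase α τ - 1) / (Complex.I * (α : ℂ))) • x) := fun τ => by
      rw [average, intervalIntegral.integral_smul_const]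
      unfold phase
      rw [integral_exp_mul_complex hα]
      simp
    refine squeeze_zero_norm (a := fun τ : ℝ => |τ|⁻¹ * (2 / |α| * ‖x‖)) (fun τ => ?_) ?_
    · rw [h1, norm_smul, norm_smul, norm_inv, Real.norm_eq_abs, norm_div, norm_mul,
        Complex.norm_I, one_mul, Complex.norm_real, Real.norm_eq_abs]
      gcongr
      refine (norm_sub_le _ _).trans ?_
      rw [norm_phase, norm_one]
      norm_num
    · have : Tendsto (fun τ : ℝ => |τ|⁻¹) atTop (𝓝 0) :=
        tendsto_inv_atTop_zero.comp tendsto_abs_atTop_atTop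
      simpa using this.mul_const (2 / |α| * ‖x‖)

variable {A : ℝ → E →L[ℂ] X} {C : ℝ}

theorem norm_average_sub_le (hA : ∀ V, Continuous fun s => A s V)
    (hC : ∀ s V, ‖A s V‖ ≤ C * ‖V‖) (V W : E) (τ : ℝ) :
    ‖average (fun s => A s V) τ - average (fun s => A s W) τ‖ ≤ C * ‖V - W‖ := by
  have h : (fun s => A s V) = fun s => A s (V - W) + A s W := by
    funext s
    rw [map_sub, sub_add_cancel]
  rw [h, average_add (hA _) (hA _), add_sub_cancel_right]
  exact norm_average_le (fun s => hC s _) τ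

/-- The vectors whose orbit has a mean. -/
def meanSubmodule (A : ℝ → E →L[ℂ] X) (hA : ∀ V, Continuous fun s => A s V) : Submodule ℂ E where
  carrier := {V | ∃ l, HasMean (fun s => A s V) l}
  zero_mem' := ⟨0, by simpa using hasMean_zero⟩
  add_mem' := by
    rintro V W ⟨l, hl⟩ ⟨m, hm⟩
    exact ⟨l + m, by simpa only [map_add] using hl.add hm (hA V) (hA W)⟩
  smul_mem' := by
    rintro c V ⟨l, hl⟩
    exact ⟨c • l, by simpa only [ContinuousLinearMap.map_smul] using hl.const_smul c⟩

/-- The vectors whose orbit has mean zero. -/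
def meanZeroSubmodule (A : ℝ → E →L[ℂ] X) (hA : ∀ V, Continuous fun s => A s V) :
    Submodule ℂ E where
  carrier := {V | HasMean (fun s => A s V) 0}
  zero_mem' := by simpa using hasMean_zero
  add_mem' := fun {V W} hV hW => by
    have := HasMean.add hV hW (hA V) (hA W)
    rw [add_zero] at this
    simpa only [Set.mem_ofPred_eq, map_add] using this
  smul_mem' := fun c V hV => by
    have := HasMean.const_smul hV c
    rw [smul_zero] at this
    simpa only [Set.mem_ofPred_eq, ContinuousLinearMap.map_smul] using this

/-- Each average is `C`-Lipschitz in the vector, uniformly in `τ`, so the Cauchy property passes to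
limits. -/
theorem isClosed_meanSubmodule [CompleteSpace X] (hA : ∀ V, Continuous fun s => A s V)
    (hC : ∀ s V, ‖A s V‖ ≤ C * ‖V‖) : IsClosed (meanSubmodule A hA : Set E) := by
  refine isClosed_of_closure_subset fun V hV => ?_
  refine cauchySeq_tendsto_of_complete (Metric.cauchySeq_iff'.mpr fun ε hε => ?_)
  obtain ⟨W, ⟨l, hW⟩, hd⟩ := exists_mul_norm_sub_lt hV C (ε := ε / 3) (by positivity)
  obtain ⟨N, hN⟩ := Metric.cauchySeq_iff'.mp (Tendsto.cauchySeq hW) (ε / 3) (by positivity)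
  refine ⟨N, fun τ hτ => ?_⟩
  have h1 := norm_average_sub_le hA hC V W τ
  have h2 := norm_average_sub_le hA hC V W N
  have h3 := hN τ hτ
  rw [← dist_eq_norm] at h1 h2
  have h4 := dist_triangle4_right (average (fun s => A s V) τ) (average (fun s => A s V) N)
    (average (fun s => A s W) τ) (average (fun s => A s W) N)
  linarith

theorem isClosed_meanZeroSubmodule (hA : ∀ V, Continuous fun s => A s V)
    (hC : ∀ s V, ‖A s V‖ ≤ C * ‖V‖) : IsClosed (meanZeroSubmodule A hA : Set E) := by
  refine isClosed_of_closure_subset fun V hV => ?_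
  refine Metric.tendsto_nhds.mpr fun ε hε => ?_
  obtain ⟨W, hW, hd⟩ := exists_mul_norm_sub_lt hV C (ε := ε / 2) (by positivity)
  filter_upwards [Metric.tendsto_nhds.mp hW (ε / 2) (by positivity)] with τ hτ
  have h1 := norm_average_sub_le hA hC V W τ
  rw [← dist_eq_norm] at h1
  have := dist_triangle (average (fun s => A s V) τ) (average (fun s => A s W) τ) 0
  linarith

end Mean

section Oscillation

open scoped BoundedContinuousFunction

theorem integral_comp_div_eq (g : ℝ → ℂ) (a : ℝ) {ε : ℝ} (hε : ε ≠ 0) :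
    ∫ s in (0 : ℝ)..a, g (s / ε) = a • average g (a / ε) := by
  rw [intervalIntegral.integral_comp_div _ hε, average, smul_smul, zero_div]
  rcases eq_or_ne a 0 with rfl | ha
  · simp
  · congr 1
    field_simp

/-- After rescaling, the integral over `[0, c]` is `c` times the average over `[0, c/ε]`. -/
theorem tendsto_integral_comp_div {g : ℝ → ℂ} (hg : Continuous g) (h : HasMean g 0) {a b : ℝ}
    (ha : 0 ≤ a) (hb : 0 ≤ b) :
    Tendsto (fun ε : ℝ => ∫ s in a..b, g (s / ε)) (𝓝[>] 0) (𝓝 0) := by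
  have h1 : ∀ c : ℝ, 0 ≤ c → Tendsto (fun ε : ℝ => ∫ s in (0 : ℝ)..c, g (s / ε)) (𝓝[>] 0)
      (𝓝 0) := fun c hc => by
    rcases hc.eq_or_lt with rfl | hc
    · simp
    have e1 : Tendsto (fun ε : ℝ => c / ε) (𝓝[>] 0) atTop := by
      simpa only [div_eq_mul_inv] using tendsto_inv_nhdsGT_zero.const_mul_atTop hc
    have e2 := (Tendsto.comp h e1).const_smul c
    rw [smul_zero] at e2
    refine e2.congr' ?_
    filter_upwards [self_mem_nhdsWithin] with ε hε
    exact (integral_comp_div_eq g c (ne_of_gt hε)).symm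
  have h2 := (h1 b hb).sub (h1 a ha)
  rw [sub_zero] at h2
  refine h2.congr fun ε => ?_
  have hc : Continuous fun s => g (s / ε) := hg.comp (continuous_id.div_const ε)
  exact intervalIntegral.integral_interval_sub_left (hc.intervalIntegrable _ _)
    (hc.intervalIntegrable _ _)

/-- Integrals of a slowly varying function with fast mean zero tend to zero. -/
theorem tendsto_integral_oscillating {G : ℝ → ℝ →ᵇ ℂ} (hG : Continuous G)
    (h : ∀ s, HasMean (G s) 0) {t : ℝ} (ht : 0 ≤ t) :
    Tendsto (fun ε : ℝ => ∫ s in (0 : ℝ)..t, G s (s / ε)) (𝓝[>] 0) (𝓝 0) := by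
  rw [Metric.tendsto_nhds]
  intro η hη
  -- On intervals shorter than `δ` the slow variable is frozen at the left endpoint. The tolerance
  -- makes the total error at most `η/2 · t/(t+1)`.
  obtain ⟨δ, hδ, hu⟩ := Metric.uniformContinuousOn_iff.mp
    ((isCompact_Icc (a := 0) (b := t)).uniformContinuousOn_of_continuous hG.continuousOn)
    (η / (2 * (t + 1))) (by positivity)
  obtain ⟨N, hN⟩ := exists_nat_gt (t / δ)
  have hN0 : (0 : ℝ) < N := lt_of_le_of_lt (by positivity) hN
  have hstep : t / N < δ := by rwa [div_lt_iff₀ hN0, mul_comm, ← div_lt_iff₀ hδ]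
  have ha0 : ∀ i : ℕ, 0 ≤ (i : ℝ) * (t / N) := fun i => by positivity
  have hcont : ∀ ε, Continuous fun s => G s (s / ε) := fun ε => by
    have : Continuous fun p : (ℝ →ᵇ ℂ) × ℝ => p.1 p.2 := continuous_eval
    exact this.comp (hG.prodMk (continuous_id.div_const ε))
  have hcont' : ∀ c ε, Continuous fun s => G c (s / ε) := fun c ε =>
    (G c).continuous.comp (continuous_id.div_const ε)
  -- The number `N` of intervals is fixed before `ε`, so finitely many frozen integrals tend to zero
  -- together.
  have hlim : Tendsto (fun ε : ℝ => ∑ i ∈ Finset.range N,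
      ‖∫ s in ((i : ℝ) * (t / N))..(((i + 1 : ℕ) : ℝ) * (t / N)), G ((i : ℝ) * (t / N)) (s / ε)‖)
      (𝓝[>] 0) (𝓝 0) := by
    have := tendsto_finsetSum (Finset.range N) fun i _ =>
      (tendsto_integral_comp_div (G ((i : ℝ) * (t / N))).continuous (h _) (ha0 i)
        (ha0 (i + 1))).norm
    simpa using this
  filter_upwards [Metric.tendsto_nhds.mp hlim (η / 2) (by positivity)] with ε hε
  rw [Real.dist_eq, sub_zero] at hε
  rw [dist_zero_right]
  have hsum : ∫ s in (0 : ℝ)..t, G s (s / ε) = ∑ i ∈ Finset.range N,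
      ∫ s in ((i : ℝ) * (t / N))..(((i + 1 : ℕ) : ℝ) * (t / N)), G s (s / ε) := by
    rw [intervalIntegral.sum_integral_adjacent_intervals fun i _ =>
      (hcont ε).intervalIntegrable _ _]
    rw [Nat.cast_zero, zero_mul, mul_div_cancel₀ _ hN0.ne']
  have hpiece : ∀ i ∈ Finset.range N,
      ‖∫ s in ((i : ℝ) * (t / N))..(((i + 1 : ℕ) : ℝ) * (t / N)), G s (s / ε)‖
        ≤ η / (2 * (t + 1)) * (t / N)
          + ‖∫ s in ((i : ℝ) * (t / N))..(((i + 1 : ℕ) : ℝ) * (t / N)),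
            G ((i : ℝ) * (t / N)) (s / ε)‖ := fun i hi => by
    have hle : (i : ℝ) * (t / N) ≤ ((i + 1 : ℕ) : ℝ) * (t / N) := by
      push_cast
      nlinarith [ha0 1]
    have hlen : ((i + 1 : ℕ) : ℝ) * (t / N) - (i : ℝ) * (t / N) = t / N := by
      push_cast
      ring
    have htop : ((i + 1 : ℕ) : ℝ) * (t / N) ≤ t := by
      have : ((i + 1 : ℕ) : ℝ) ≤ N := by exact_mod_cast Finset.mem_range.mp hi
      calc ((i + 1 : ℕ) : ℝ) * (t / N) ≤ N * (t / N) := by gcongr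
        _ = t := mul_div_cancel₀ _ hN0.ne'
    have hdiff := intervalIntegral.norm_integral_le_of_norm_le_const
      (a := (i : ℝ) * (t / N)) (b := ((i + 1 : ℕ) : ℝ) * (t / N)) (C := η / (2 * (t + 1)))
      (f := fun s => G s (s / ε) - G ((i : ℝ) * (t / N)) (s / ε)) fun s hs => by
        rw [uIoc_of_le hle] at hs
        have := hu s ⟨(ha0 i).trans hs.1.le, hs.2.trans htop⟩ _ ⟨ha0 i, hle.trans htop⟩ (by
          rw [Real.dist_eq, abs_of_nonneg (by linarith [hs.1])]
          linarith [hs.2])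
        rw [← dist_eq_norm]
        exact (BoundedContinuousFunction.dist_coe_le_dist _).trans this.le
    rw [hlen, abs_of_nonneg (by positivity), intervalIntegral.integral_sub
      ((hcont ε).intervalIntegrable _ _) ((hcont' _ ε).intervalIntegrable _ _)] at hdiff
    exact (norm_le_norm_add_norm_sub' _ _).trans
      (by rw [add_comm]; exact add_le_add_left hdiff _)
  rw [hsum]
  refine (norm_sum_le _ _).trans_lt ((Finset.sum_le_sum hpiece).trans_lt ?_)
  rw [Finset.sum_add_distrib, Finset.sum_const, Finset.card_range, nsmul_eq_mul]
  have h1 : (N : ℝ) * (η / (2 * (t + 1)) * (t / N)) ≤ η / 2 := by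
    rw [show (N : ℝ) * (η / (2 * (t + 1)) * (t / N)) = η / 2 * (t / (t + 1)) by field_simp]
    exact mul_le_of_le_one_right (by positivity) ((div_le_one (by positivity)).mpr (by linarith))
  have h2 := (le_abs_self _).trans_lt hε
  linarith

end Oscillation

end

/-! ### Reduction of averages along the wave group to eigenvectors -/

section

set_option maxSynthPendingDepth 3

variable {k : ℕ} (P : Density n k)

/-- A closed condition that holds for all pairs of eigenvectors and is linear in each argument
holds for all pairs of acoustic states. -/
theorem Density.forall_mem_acoustic_two {p : State n → State n → Prop}
    (h1 : ∀ V, ∃ M : Submodule ℂ (State n), IsClosed (M : Set (State n)) ∧ ∀ U, U ∈ M ↔ p U V)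
    (h2 : ∀ U, ∃ M : Submodule ℂ (State n), IsClosed (M : Set (State n)) ∧ ∀ V, V ∈ M ↔ p U V)
    (h : ∀ α β, ∀ U ∈ P.eigen α, ∀ V ∈ P.eigen β, p U V) {U V : State n}
    (hU : U ∈ P.acoustic) (hV : V ∈ P.acoustic) : p U V := by
  have e1 : ∀ α, ∀ U ∈ P.eigen α, p U V := fun α U hU => by
    obtain ⟨M, hM, hp⟩ := h2 U
    exact (hp V).mp (P.acoustic_le hM (fun β W hW => (hp W).mpr (h α β U hU W hW)) hV)
  obtain ⟨M, hM, hp⟩ := h1 V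
  exact (hp U).mp (P.acoustic_le hM (fun α W hW => (hp W).mpr (e1 α W hW)) hU)

/-- On an eigenvector for `iμ` the orbit is the single phase `γ - μ`. The uniform bound extends this
to the acoustic space, and the group does not see the rest of `Y`. -/
theorem Density.exists_hasMean_phase_group (γ : ℝ) (Y : State n) :
    ∃ l, HasMean (fun s => phase γ s • P.group (-s) Y) l := by
  let A : ℝ → State n →L[ℂ] State n := fun s => phase γ s • P.group (-s)
  have hA : ∀ V, Continuous fun s => A s V := fun V =>
    (continuous_phase γ).smul (P.continuous_group_apply continuous_neg continuous_const)
  have hC : ∀ s V, ‖A s V‖ ≤ 1 * ‖V‖ := fun s V => by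
    change ‖phase γ s • P.group (-s) V‖ ≤ _
    rw [norm_smul, norm_phase, one_mul, one_mul]
    exact P.norm_group_apply_le _ _
  have h := P.acoustic_le (isClosed_meanSubmodule hA hC) (fun μ U hU => by
    change ∃ l, HasMean (fun s => phase γ s • P.group (-s) U) l
    simp only [P.group_eigen _ hU, smul_smul, phase_neg, ← phase_add]
    exact ⟨_, hasMean_phase_smul _ _⟩) (Submodule.starProjection_apply_mem P.acoustic Y)
  obtain ⟨l, hl⟩ := h
  refine ⟨l, ?_⟩
  change HasMean (fun s => phase γ s • P.group (-s) (P.acoustic.starProjection Y)) l at hl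
  simpa only [P.group_proj] using hl

section Bilinear

variable {X : Type*} [NormedAddCommGroup X] [NormedSpace ℂ X]

theorem Density.continuous_bilinear_group (K : State n →L[ℂ] State n →L[ℂ] X) (U V : State n) :
    Continuous fun s => K (P.group s U) (P.group s V) :=
  (K.continuous.comp (P.continuous_group U)).clm_apply (P.continuous_group V)

theorem Density.norm_bilinear_group_le (K : State n →L[ℂ] State n →L[ℂ] X) (s : ℝ)
    (U V : State n) : ‖K (P.group s U) (P.group s V)‖ ≤ ‖K‖ * ‖U‖ * ‖V‖ := by
  refine (K.le_opNorm₂ _ _).trans ?_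
  gcongr
  · exact P.norm_group_apply_le _ _
  · exact P.norm_group_apply_le _ _

end Bilinear

/-- Conjugated quadratic terms have averages. -/
theorem Density.exists_hasMean_group_bilinear (K : State n →L[ℂ] State n →L[ℂ] State n)
    {U V : State n} (hU : U ∈ P.acoustic) (hV : V ∈ P.acoustic) :
    ∃ l, HasMean (fun s => P.group (-s) (K (P.group s U) (P.group s V))) l := by
  have hcont : ∀ U V, Continuous fun s => P.group (-s) (K (P.group s U) (P.group s V)) :=
    fun U V => P.continuous_group_apply continuous_neg (P.continuous_bilinear_group K U V)
  have hbd : ∀ s U V, ‖P.group (-s) (K (P.group s U) (P.group s V))‖ ≤ ‖K‖ * ‖U‖ * ‖V‖ :=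
    fun s U V => (P.norm_group_apply_le _ _).trans (P.norm_bilinear_group_le K s U V)
  refine P.forall_mem_acoustic_two (p := fun U V => ∃ l,
    HasMean (fun s => P.group (-s) (K (P.group s U) (P.group s V))) l) (fun V => ?_) (fun U => ?_)
    (fun α β U hU V hV => ?_) hU hV
  · let A : ℝ → State n →L[ℂ] State n := fun s =>
      (P.group (-s)).comp ((K.flip (P.group s V)).comp (P.group s))
    exact ⟨meanSubmodule A fun U => hcont U V, isClosed_meanSubmodule (C := ‖K‖ * ‖V‖) _
      fun s U => (hbd s U V).trans_eq (by ring), fun U => Iff.rfl⟩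
  · let A : ℝ → State n →L[ℂ] State n := fun s =>
      (P.group (-s)).comp ((K (P.group s U)).comp (P.group s))
    exact ⟨meanSubmodule A fun V => hcont U V, isClosed_meanSubmodule _ fun s V => hbd s U V,
      fun V => Iff.rfl⟩
  -- For two eigenvectors the quadratic term is a fixed state `K U V` times the phase `α + β`.
  · simp only [P.group_eigen _ hU, P.group_eigen _ hV, ContinuousLinearMap.map_smul, smul_apply,
      smul_smul, ← phase_add]
    exact P.exists_hasMean_phase_group _ _

/-- A bilinear form that vanishes on resonant pairs of eigenvectors has mean zero along the wave
group. -/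
theorem Density.hasMean_bilinear_group (K : State n →L[ℂ] State n →L[ℂ] ℂ)
    (hK : ∀ α β, α + β = 0 → ∀ U ∈ P.eigen α, ∀ V ∈ P.eigen β, K U V = 0)
    {U V : State n} (hU : U ∈ P.acoustic) (hV : V ∈ P.acoustic) :
    HasMean (fun s => K (P.group s U) (P.group s V)) 0 := by
  refine P.forall_mem_acoustic_two (p := fun U V =>
    HasMean (fun s => K (P.group s U) (P.group s V)) 0) (fun V => ?_) (fun U => ?_)
    (fun α β U hU V hV => ?_) hU hV
  · let A : ℝ → State n →L[ℂ] ℂ := fun s => (K.flip (P.group s V)).comp (P.group s)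
    exact ⟨meanZeroSubmodule A fun U => P.continuous_bilinear_group K U V,
      isClosed_meanZeroSubmodule (C := ‖K‖ * ‖V‖) _
        fun s U => (P.norm_bilinear_group_le K s U V).trans_eq (by ring), fun U => Iff.rfl⟩
  · let A : ℝ → State n →L[ℂ] ℂ := fun s => (K (P.group s U)).comp (P.group s)
    exact ⟨meanZeroSubmodule A fun V => P.continuous_bilinear_group K U V,
      isClosed_meanZeroSubmodule _ fun s V => P.norm_bilinear_group_le K s U V, fun V => Iff.rfl⟩
  · simp only [P.group_eigen _ hU, P.group_eigen _ hV, ContinuousLinearMap.map_smul, smul_apply,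
      smul_smul, ← phase_add]
    -- A nonzero `α + β` averages out; for `α + β = 0` the constant itself vanishes by `hK`.
    have := hasMean_phase_smul (α + β) (K U V)
    rw [ite_eq_right_iff.mpr fun h => hK α β h U hU V hV] at this
    simpa only [add_comm] using this

/-- A trilinear form that vanishes on resonant triples of eigenvectors has mean zero along the
wave group. -/
theorem Density.hasMean_trilinear_group (T : State n →L[ℂ] State n →L[ℂ] State n →L[ℂ] ℂ)
    (hT : ∀ α β γ, α + β + γ = 0 → ∀ U ∈ P.eigen α, ∀ V ∈ P.eigen β, ∀ W ∈ P.eigen γ,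
      T U V W = 0)
    {U V W : State n} (hU : U ∈ P.acoustic) (hV : V ∈ P.acoustic) (hW : W ∈ P.acoustic) :
    HasMean (fun s => T (P.group s U) (P.group s V) (P.group s W)) 0 := by
  have hcont : ∀ U V W, Continuous fun s => T (P.group s U) (P.group s V) (P.group s W) :=
    fun U V W => (P.continuous_bilinear_group T U V).clm_apply (P.continuous_group W)
  have hbd : ∀ s U V W, ‖T (P.group s U) (P.group s V) (P.group s W)‖
      ≤ ‖T‖ * ‖U‖ * ‖V‖ * ‖W‖ := fun s U V W => by
    refine ((T _ _).le_opNorm _).trans ?_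
    gcongr
    · exact P.norm_bilinear_group_le T s U V
    · exact P.norm_group_apply_le _ _
  have h3 : ∀ α β, ∀ U ∈ P.eigen α, ∀ V ∈ P.eigen β,
      HasMean (fun s => T (P.group s U) (P.group s V) (P.group s W)) 0 := by
    intro α β U hU V hV
    let A : ℝ → State n →L[ℂ] ℂ := fun s =>
      (T (P.group s U) (P.group s V)).comp (P.group s)
    refine P.acoustic_le (M := meanZeroSubmodule A fun W => hcont U V W)
      (isClosed_meanZeroSubmodule _ fun s W => hbd s U V W) (fun γ W hW => ?_) hW
    change HasMean (fun s => T (P.group s U) (P.group s V) (P.group s W)) 0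
    simp only [P.group_eigen _ hU, P.group_eigen _ hV, P.group_eigen _ hW,
      ContinuousLinearMap.map_smul, smul_apply, smul_smul, ← phase_add]
    have := hasMean_phase_smul (α + β + γ) (T U V W)
    rwa [ite_eq_right_iff.mpr fun h => hT α β γ h U hU V hV W hW] at this
  refine P.forall_mem_acoustic_two (p := fun U V =>
    HasMean (fun s => T (P.group s U) (P.group s V) (P.group s W)) 0) (fun V => ?_) (fun U => ?_)
    h3 hU hV
  · let A : ℝ → State n →L[ℂ] ℂ := fun s =>
      ((T.flip (P.group s V)).flip (P.group s W)).comp (P.group s)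
    exact ⟨meanZeroSubmodule A fun U => hcont U V W,
      isClosed_meanZeroSubmodule (C := ‖T‖ * ‖V‖ * ‖W‖) _
        fun s U => (hbd s U V W).trans_eq (by ring), fun U => Iff.rfl⟩
  · let A : ℝ → State n →L[ℂ] ℂ := fun s => ((T (P.group s U)).flip (P.group s W)).comp (P.group s)
    exact ⟨meanZeroSubmodule A fun V => hcont U V W,
      isClosed_meanZeroSubmodule (C := ‖T‖ * ‖U‖ * ‖W‖) _
        fun s V => (hbd s U V W).trans_eq (by ring), fun V => Iff.rfl⟩

section Slow

open scoped BoundedContinuousFunction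

variable {D : Type*} [NormedAddCommGroup D] [NormedSpace ℂ D]

/-- The fast orbit of a form with parameters. -/
def Density.orbit (b : D →L[ℂ] State n →L[ℂ] State n →L[ℂ] ℂ) (d : D) (U V : State n) : ℝ →ᵇ ℂ :=
  BoundedContinuousFunction.ofNormedAddCommGroup (fun σ => b d (P.group σ U) (P.group σ V))
    (P.continuous_bilinear_group (b d) U V) (‖b d‖ * ‖U‖ * ‖V‖)
    fun σ => P.norm_bilinear_group_le (b d) σ U V

theorem Density.orbit_apply (b : D →L[ℂ] State n →L[ℂ] State n →L[ℂ] ℂ) (d : D) (U V : State n)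
    (σ : ℝ) : P.orbit b d U V σ = b d (P.group σ U) (P.group σ V) := rfl

theorem Density.norm_orbit_le (b : D →L[ℂ] State n →L[ℂ] State n →L[ℂ] ℂ) (d : D)
    (U V : State n) : ‖P.orbit b d U V‖ ≤ ‖b‖ * ‖d‖ * ‖U‖ * ‖V‖ := by
  refine (BoundedContinuousFunction.norm_le (by positivity)).mpr fun σ => ?_
  refine (P.norm_bilinear_group_le (b d) σ U V).trans ?_
  gcongr
  exact b.le_opNorm d

theorem Density.continuous_orbit (b : D →L[ℂ] State n →L[ℂ] State n →L[ℂ] ℂ) {d : ℝ → D}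
    {U V : ℝ → State n} (hd : Continuous d) (hU : Continuous U) (hV : Continuous V) :
    Continuous fun s => P.orbit b (d s) (U s) (V s) := by
  rw [continuous_iff_continuousAt]
  intro a
  rw [ContinuousAt, tendsto_iff_norm_sub_tendsto_zero]
  have e1 := tendsto_iff_norm_sub_tendsto_zero.mp (hd.tendsto a)
  have e2 := tendsto_iff_norm_sub_tendsto_zero.mp (hU.tendsto a)
  have e3 := tendsto_iff_norm_sub_tendsto_zero.mp (hV.tendsto a)
  have h := (((e1.const_mul ‖b‖).mul (hU.norm.tendsto a)).mul (hV.norm.tendsto a)).add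
    (((e2.const_mul (‖b‖ * ‖d a‖)).mul (hV.norm.tendsto a)).add
      (e3.const_mul (‖b‖ * ‖d a‖ * ‖U a‖)))
  simp only [mul_zero, zero_mul, add_zero] at h
  refine squeeze_zero (fun _ => norm_nonneg _) (fun s => ?_) h
  have : P.orbit b (d s) (U s) (V s) - P.orbit b (d a) (U a) (V a)
      = P.orbit b (d s - d a) (U s) (V s) + (P.orbit b (d a) (U s - U a) (V s)
        + P.orbit b (d a) (U a) (V s - V a)) := by
    ext σ
    simp only [BoundedContinuousFunction.sub_apply, BoundedContinuousFunction.add_apply,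
      P.orbit_apply, map_sub, sub_apply]
    ring
  rw [this]
  exact (norm_add_le _ _).trans (add_le_add (P.norm_orbit_le b _ _ _)
    ((norm_add_le _ _).trans (add_le_add (P.norm_orbit_le b _ _ _) (P.norm_orbit_le b _ _ _))))

/-- Fast oscillations average out a form that vanishes on resonant pairs of eigenvectors. -/
theorem Density.tendsto_integral_orbit (b : D →L[ℂ] State n →L[ℂ] State n →L[ℂ] ℂ) {t : ℝ}
    (ht : 0 ≤ t) {d : ℝ → D} {U V : ℝ → State n} (hd : ContinuousOn d (Icc 0 t))
    (hU : ContinuousOn U (Icc 0 t)) (hV : ContinuousOn V (Icc 0 t))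
    (hUa : ∀ s ∈ Icc 0 t, U s ∈ P.acoustic) (hVa : ∀ s ∈ Icc 0 t, V s ∈ P.acoustic)
    (hb : ∀ s ∈ Icc 0 t, ∀ α β, α + β = 0 → ∀ X ∈ P.eigen α, ∀ Y ∈ P.eigen β, b (d s) X Y = 0) :
    Tendsto (fun ε : ℝ => ∫ s in (0 : ℝ)..t, b (d s) (P.group (s / ε) (U s))
      (P.group (s / ε) (V s))) (𝓝[>] 0) (𝓝 0) := by
  -- Clamping time to `[0, t]` extends the data continuously to the whole line without changing the
  -- integral.
  have hc : Continuous fun s : ℝ => ((projIcc 0 t ht s : Icc 0 t) : ℝ) :=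
    continuous_subtype_val.comp continuous_projIcc
  have hmem : ∀ s : ℝ, ((projIcc 0 t ht s : Icc 0 t) : ℝ) ∈ Icc 0 t := fun s => Subtype.prop _
  have key := tendsto_integral_oscillating (P.continuous_orbit b (hd.comp_continuous hc hmem)
    (hU.comp_continuous hc hmem) (hV.comp_continuous hc hmem)) (fun s =>
      P.hasMean_bilinear_group (b (d (projIcc 0 t ht s))) (hb _ (hmem s)) (hUa _ (hmem s))
        (hVa _ (hmem s))) ht
  refine key.congr fun ε => intervalIntegral.integral_congr fun s hs => ?_
  rw [uIcc_of_le ht] at hs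
  simp only [P.orbit_apply, Function.comp_apply, projIcc_of_mem ht hs]

end Slow

end

/-! ### Algebra of the quadratic term on eigenvectors -/

section

set_option maxSynthPendingDepth 3

theorem cont_smul_smul (c : Cont n) (a : ℂ) (f : ScalarL2 n) : c • a • f = a • c • f :=
  ContinuousLinearMap.map_smul (mulL c) a f

theorem cont_smul_cl_comm (c d : Cont n) : c • cl d = d • cl c := by
  rw [cont_smul_cl, cont_smul_cl, mul_comm]

theorem bil_cont_smul_cl (a c d : Cont n) : bil (a • cl c) (cl d) = bil (cl (c * d)) (cl a) := by
  rw [bil_smul, cont_smul_cl_comm, ← bil_smul, cont_smul_cl, mul_comm]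

/-- Continuous representatives and weak derivatives of the components of a field. -/
structure Rep (U : State n) where
  c : Fin (n + 1) → Cont n
  d : Fin n → Fin (n + 1) → ScalarL2 n
  cl_c : ∀ a, cl (c a) = comp a U
  wd : ∀ j a, WD j (comp a U) (d j a)

namespace Rep

variable {U V W : State n} (R : Rep U) (S : Rep V) (T : Rep W)

/-- The weak derivative `∂ⱼ (U_a V_b)` by the product rule. -/
def prodDeriv (a b : Fin (n + 1)) (j : Fin n) : ScalarL2 n := R.c a • S.d j b + S.c b • R.d j a

theorem wd_prodDeriv (a b : Fin (n + 1)) (j : Fin n) :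
    WD j (cl (R.c a * S.c b)) (R.prodDeriv S a b j) :=
  WD.mul (by rw [R.cl_c]; exact R.wd j a) (by rw [S.cl_c]; exact S.wd j b)

theorem prodDeriv_comm (a b : Fin (n + 1)) (j : Fin n) :
    R.prodDeriv S a b j = S.prodDeriv R b a j := add_comm _ _

/-- The field `½ div (h₁ ⊗ h₂ + h₂ ⊗ h₁) + ½ ∇ (φ₁ φ₂)`. -/
def quad (i : Fin n) : ScalarL2 n :=
  (1 / 2 : ℂ) • (∑ j : Fin n, (R.prodDeriv S i.succ j.succ j + R.prodDeriv S j.succ i.succ j)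
    + R.prodDeriv S 0 0 i)

theorem quad_comm (i : Fin n) : R.quad S i = S.quad R i := by
  unfold quad
  rw [R.prodDeriv_comm S 0 0 i]
  congr 2
  refine Finset.sum_congr rfl fun j _ => ?_
  rw [R.prodDeriv_comm, R.prodDeriv_comm S j.succ, add_comm]

theorem bil_prodDeriv (a b : Fin (n + 1)) (j : Fin n) {f f' : ScalarL2 n} (hf : WD j f f') :
    bil (R.prodDeriv S a b j) f = -bil (cl (R.c a * S.c b)) f' := by
  rw [(R.wd_prodDeriv S a b j).ibp hf, neg_neg]

theorem sum_bil_quad {u : Fin n → ScalarL2 n} {u' : Fin n → Fin n → ScalarL2 n}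
    (hu : ∀ i j, WD j (u i) (u' i j)) : ∑ i, bil (R.quad S i) (u i)
      = -((1 / 2 : ℂ) * (∑ i : Fin n, ∑ j : Fin n,
          (bil (cl (R.c i.succ * S.c j.succ)) (u' i j)
            + bil (cl (R.c j.succ * S.c i.succ)) (u' i j)))
        + (1 / 2 : ℂ) * ∑ i, bil (cl (R.c 0 * S.c 0)) (u' i i)) := by
  rw [← mul_add, ← Finset.sum_add_distrib, ← mul_neg, ← Finset.sum_neg_distrib, Finset.mul_sum]
  refine Finset.sum_congr rfl fun i _ => ?_
  rw [quad, ContinuousLinearMap.map_smul, smul_apply, smul_eq_mul, map_add, map_sum,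
    add_apply, sum_apply, R.bil_prodDeriv S 0 0 i (hu i i), neg_add,
    ← Finset.sum_neg_distrib]
  congr 2
  refine Finset.sum_congr rfl fun j _ => ?_
  rw [map_add, add_apply, R.bil_prodDeriv S _ _ j (hu i j), R.bil_prodDeriv S _ _ j (hu i j),
    neg_add]

variable {k : ℕ} (P : Density n k)

theorem cl_g (j : Fin n) : cl (P.r * R.c j.succ) = P.g j U := by
  rw [← cont_smul_cl, R.cl_c, P.g_apply]

theorem exists_wd_g (R : Rep U) (hk : 1 ≤ k) : ∃ e : Fin n → Fin n → ScalarL2 n,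
    ∀ l j, WD l (P.g j U) (e l j) := by
  choose r' hr' _ using P.contDeriv_r.mono hk
  exact ⟨fun l j => P.r • R.d l j.succ + r' l • comp j.succ U,
    fun l j => (hr' l).wd.cont_smul (R.wd l j.succ)⟩

theorem exists_wd_s (R : Rep U) (hk : 1 ≤ k) : ∃ f : Fin n → ScalarL2 n,
    ∀ j : Fin n, WD j (P.s • comp j.succ U) (f j) := by
  choose s' hs' _ using P.contDeriv_s.mono hk
  exact ⟨fun j => P.s • R.d j j.succ + s' j • comp j.succ U,
    fun j => (hs' j).wd.cont_smul (R.wd j j.succ)⟩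

variable {P} {α β γ : ℝ}

theorem curl_free (hU : U ∈ P.acoustic) {e : Fin n → Fin n → ScalarL2 n}
    (he : ∀ l j, WD l (P.g j U) (e l j)) (l j : Fin n) : e l j = e j l := by
  obtain ⟨w, hw⟩ := hU
  exact WD.comm (hw j) (hw l) (he l j) (he j l)

/-- `div (h_U ⊗ h_V)` for an acoustic state `U` and an eigenvector `V`. -/
theorem sum_prodDeriv (hk : 1 ≤ k) (hU : U ∈ P.acoustic) (hV : V ∈ P.eigen β)
    {e : Fin n → Fin n → ScalarL2 n} (he : ∀ l j, WD l (P.g j U) (e l j)) (i : Fin n) :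
    ∑ j : Fin n, R.prodDeriv S i.succ j.succ j
      = (-(Complex.I * (β : ℂ))) • (S.c 0 • P.g i U)
        + P.s • P.s • ∑ j : Fin n, (P.r * S.c j.succ) • e i j := by
  obtain ⟨f, hf⟩ := S.exists_wd_s P hk
  have hdiv : ∑ j, f j = -((Complex.I * (β : ℂ)) • comp 0 V) := by
    rw [← ContinuousLinearMap.map_smul]
    exact (WDiv.of_WD hf).unique hV.2.1
  have hterm : ∀ j : Fin n, R.prodDeriv S i.succ j.succ j
      = (P.r * R.c i.succ) • f j + P.s • P.s • (P.r * S.c j.succ) • e i j := fun j => by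
    -- The product is split as `g_U · √ρ h_V`: the derivative of the second factor sums to a known
    -- divergence, and that of the first is symmetric because `g_U` is curl-free.
    have h1 : R.c i.succ * S.c j.succ = (P.r * R.c i.succ) * (P.s * S.c j.succ) := by
      calc R.c i.succ * S.c j.succ = (P.s * P.r) * (R.c i.succ * S.c j.succ) := by
            rw [P.s_mul_r, one_mul]
        _ = _ := by ring
    have h2 : WD j (cl (P.r * R.c i.succ)) (e j i) := by
      rw [R.cl_g P]; exact he j i
    have h3 : WD j (cl (P.s * S.c j.succ)) (f j) := by
      rw [← cont_smul_cl, S.cl_c]; exact hf j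
    have h4 := R.wd_prodDeriv S i.succ j.succ j
    rw [h1] at h4
    rw [h4.unique (h2.mul h3), curl_free hU he j i, ← mul_smul, ← mul_smul]
    congr 2
    calc P.s * S.c j.succ = P.s * (P.s * P.r) * S.c j.succ := by rw [P.s_mul_r, mul_one]
      _ = _ := by ring
  simp only [hterm]
  rw [Finset.sum_add_distrib, ← Finset.smul_sum, ← Finset.smul_sum, ← Finset.smul_sum, hdiv,
    smul_neg, cont_smul_smul, ← S.cl_c, cont_smul_cl_comm, R.cl_g P, neg_smul]

/-- The quadratic term of two eigenvectors is resonant up to a weighted gradient. -/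
theorem exists_quad_eq (hk : 1 ≤ k) (hU : U ∈ P.eigen α) (hV : V ∈ P.eigen β) :
    ∃ G : Fin n → ScalarL2 n,
      (∀ i, WD i (cl (∑ j : Fin n, (P.r * R.c j.succ) * (P.r * S.c j.succ))) (G i)) ∧
      ∀ i, R.quad S i = (-(Complex.I / 2 * ((α : ℂ) + β))) • (S.c 0 • P.g i U + R.c 0 • P.g i V)
        + (1 / 2 : ℂ) • (P.s • P.s • G i) := by
  obtain ⟨e, he⟩ := R.exists_wd_g P hk
  obtain ⟨f, hf⟩ := S.exists_wd_g P hk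
  -- This is `∇(g_U · g_V)` by the product rule.
  refine ⟨fun i => ∑ j : Fin n, ((P.r * R.c j.succ) • f i j + (P.r * S.c j.succ) • e i j),
    fun i => ?_, fun i => ?_⟩
  · rw [map_sum]
    refine WD.sum _ fun j _ => WD.mul ?_ ?_
    · rw [R.cl_g P]; exact he i j
    · rw [S.cl_g P]; exact hf i j
  -- The gradient of `φ_U φ_V` supplies the terms with `α` and `β` exchanged relative to the
  -- divergence part, so the common factor `α + β` appears.
  · have h0 : R.prodDeriv S 0 0 i = (-(Complex.I * (β : ℂ))) • (R.c 0 • P.g i V)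
        + (-(Complex.I * (α : ℂ))) • (S.c 0 • P.g i U) := by
      rw [prodDeriv, (S.wd i 0).unique (hV.2.2 i), (R.wd i 0).unique (hU.2.2 i),
        ContinuousLinearMap.map_smul, ContinuousLinearMap.map_smul, ← neg_smul, ← neg_smul,
        cont_smul_smul, cont_smul_smul]
    have h1 := R.sum_prodDeriv S hk hU.1 hV he i
    have h2 := S.sum_prodDeriv R hk hV.1 hU hf i
    simp only [S.prodDeriv_comm R] at h2
    rw [quad, Finset.sum_add_distrib, h0, h1, h2]
    beta_reduce
    rw [Finset.sum_add_distrib, smul_add P.s, smul_add P.s]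
    generalize P.s • P.s • ∑ j : Fin n, (P.r * S.c j.succ) • e i j = Y₁
    generalize P.s • P.s • ∑ j : Fin n, (P.r * R.c j.succ) • f i j = Y₂
    generalize S.c 0 • P.g i U = X₁
    generalize R.c 0 • P.g i V = X₂
    module

theorem sum_bil_weighted_grad {q : ScalarL2 n} {G F : Fin n → ScalarL2 n} {c : ScalarL2 n}
    (hG : ∀ i, WD i q (G i)) (hF : WDiv (fun i => P.s • P.s • F i) c) :
    ∑ i, bil (P.s • P.s • G i) (F i) = -bil q c := by
  rw [bil_comm, ← hF.pair hG]
  refine Finset.sum_congr rfl fun i _ => ?_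
  rw [bil_smul, bil_smul, bil_comm]

/-- Resonant quadratic terms are orthogonal to the fields `u` with `div (ρ u) = 0`. -/
theorem sum_bil_quad_eq_zero (hk : 1 ≤ k) (hU : U ∈ P.eigen α) (hV : V ∈ P.eigen β)
    (h : α + β = 0) {u : Fin n → ScalarL2 n} (hu : WDiv (fun i => P.s • P.s • u i) 0) :
    ∑ i, bil (R.quad S i) (u i) = 0 := by
  obtain ⟨G, hG, hq⟩ := R.exists_quad_eq S hk hU hV
  have h1 : (α : ℂ) + β = 0 := by exact_mod_cast h
  simp only [hq, h1, mul_zero, neg_zero, zero_smul, zero_add, ContinuousLinearMap.map_smul,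
    smul_apply]
  rw [← Finset.smul_sum, sum_bil_weighted_grad hG hu, map_zero, neg_zero, smul_zero]

/-- The cubic interaction of three eigenvectors. -/
theorem sum_bil_quad_g (hk : 1 ≤ k) (hU : U ∈ P.eigen α) (hV : V ∈ P.eigen β)
    (hW : W ∈ P.eigen γ) (h : α + β + γ = 0) : ∑ i, bil (R.quad S i) (P.g i W)
      = Complex.I / 2 * γ * (∑ i, (bil (comp 0 V) ((P.r * R.c i.succ) • P.g i W)
        + bil (comp 0 U) ((P.r * S.c i.succ) • P.g i W))
        + ∑ i, bil (comp 0 W) ((P.r * R.c i.succ) • P.g i V)) := by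
  obtain ⟨G, hG, hq⟩ := R.exists_quad_eq S hk hU hV
  -- The coefficient `-(i/2)(α + β)` becomes `(i/2)γ`, the factor that also comes from `div(ρ g_W) =
  -- -iγ φ_W` in the gradient term.
  have h1 : (α : ℂ) + β = -γ := by
    have : α + β = -γ := by linarith
    exact_mod_cast this
  have hdiv : WDiv (fun i => P.s • P.s • P.g i W) (-comp 0 ((Complex.I * (γ : ℂ)) • W)) := by
    simpa only [P.s_smul_g] using hW.2.1
  have h2 := sum_bil_weighted_grad hG hdiv
  rw [map_neg, neg_neg, ContinuousLinearMap.map_smul, ContinuousLinearMap.map_smul,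
    smul_eq_mul, bil_comm, map_sum, map_sum] at h2
  have h3 : ∀ i : Fin n, bil (S.c 0 • P.g i U) (P.g i W)
      = bil (comp 0 V) ((P.r * R.c i.succ) • P.g i W) := fun i => by
    rw [← R.cl_g P, cont_smul_cl_comm, S.cl_c, bil_smul]
  have h4 : ∀ i : Fin n, bil (R.c 0 • P.g i V) (P.g i W)
      = bil (comp 0 U) ((P.r * S.c i.succ) • P.g i W) := fun i => by
    rw [← S.cl_g P, cont_smul_cl_comm, R.cl_c, bil_smul]
  have h5 : ∀ i : Fin n, cl ((P.r * R.c i.succ) * (P.r * S.c i.succ))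
      = (P.r * R.c i.succ) • P.g i V := fun i => by
    rw [← cont_smul_cl, S.cl_g P]
  simp only [h5] at h2
  simp only [hq, map_add, add_apply, ContinuousLinearMap.map_smul, smul_apply, smul_eq_mul, h3, h4,
    Finset.sum_add_distrib, ← Finset.mul_sum, h2, h1]
  ring

/-- The cubic interactions of resonant triples cancel. -/
theorem sum_bil_quad_cyclic (hk : 1 ≤ k) (hU : U ∈ P.eigen α) (hV : V ∈ P.eigen β)
    (hW : W ∈ P.eigen γ) (h : α + β + γ = 0) : ∑ i, bil (R.quad S i) (P.g i W)
      + ∑ i, bil (S.quad T i) (P.g i U) + ∑ i, bil (T.quad R i) (P.g i V) = 0 := by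
  rw [R.sum_bil_quad_g S hk hU hV hW h, S.sum_bil_quad_g T hk hV hW hU (by linarith),
    T.sum_bil_quad_g R hk hW hU hV (by linarith)]
  -- Symmetry of `g_X · g_Y` identifies the brackets in the three rotations; only the factors `γ`,
  -- `α`, `β` differ, and these sum to zero.
  have hs : ∀ {X Y : State n} (A : Rep X) (B : Rep Y) (i : Fin n),
      (P.r * A.c i.succ) • P.g i Y = (P.r * B.c i.succ) • P.g i X := fun A B i => by
    rw [← A.cl_g P, ← B.cl_g P, cont_smul_cl_comm]
  simp only [Finset.sum_add_distrib, hs S R, hs T S, hs T R]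
  have h1 : (γ : ℂ) = -α - β := by
    have : γ = -α - β := by linarith
    exact_mod_cast this
  rw [h1]
  ring

end Rep

end

/-! ### Bounded multilinear forms for smoothed states -/

section

set_option maxSynthPendingDepth 3

section ClosedGraph

variable {E F G : Type*} [NormedAddCommGroup E] [NormedSpace ℂ E] [CompleteSpace E]
  [NormedAddCommGroup F] [NormedSpace ℂ F] [CompleteSpace F]
  [AddCommGroup G] [Module ℂ G] [TopologicalSpace G] [T2Space G]

/-- A linear map that takes values in the range of an injective operator factors through a bounded
operator, by the closed graph theorem. -/
theorem exists_lift (A : E →L[ℂ] G) (B : F →L[ℂ] G) (hB : Function.Injective B)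
    (h : ∀ x, ∃ y, B y = A x) : ∃ T : E →L[ℂ] F, ∀ x, B (T x) = A x := by
  choose f hf using h
  let T : E →ₗ[ℂ] F :=
    { toFun := f
      map_add' := fun x y => hB (by rw [map_add, hf, hf, hf, map_add])
      map_smul' := fun a x => hB (by
        rw [RingHom.id_apply, ContinuousLinearMap.map_smul, hf, hf, ContinuousLinearMap.map_smul]) }
  have hT : IsClosed (T.graph : Set (E × F)) := by
    have : (T.graph : Set (E × F)) = {p | B p.2 = A p.1} := by
      ext p
      rw [SetLike.mem_coe, LinearMap.mem_graph_iff]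
      exact ⟨fun h => by rw [Set.mem_ofPred_eq, h]; exact hf _, fun h => hB (h.trans (hf _).symm)⟩
    rw [this]
    exact isClosed_eq (B.continuous.comp continuous_snd) (A.continuous.comp continuous_fst)
  exact ⟨⟨T, T.continuous_of_isClosed_graph hT⟩, hf⟩

end ClosedGraph

variable {k : ℕ} (P : Density n k) (hk : n < 2 * k)

/-- Sobolev embedding gives a representative state by state; linearity and boundedness come from the
closed graph theorem. -/
theorem Density.exists_smoothC (hk : n < 2 * k) (a : Fin (n + 1)) :
    ∃ T : State n →L[ℂ] Cont n, ∀ Z, cl (T Z) = comp a (P.smoothing Z) :=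
  exists_lift ((comp a).comp P.smoothing) cl cl_injective fun Z =>
    (P.smoothing_sob Z a).exists_cl hk

/-- The comparison space is the product of all Fourier coefficients, where the derivative of any
square integrable function makes sense. Only its Hausdorff property matters. -/
theorem Density.exists_smoothD (hk : n < 2 * k) (j : Fin n) (a : Fin (n + 1)) :
    ∃ T : State n →L[ℂ] ScalarL2 n, ∀ Z, WD j (comp a (P.smoothing Z)) (T Z) := by
  obtain ⟨T, hT⟩ := exists_lift
    (ContinuousLinearMap.pi fun m => freq m j • (fc m).comp ((comp a).comp P.smoothing))
    (ContinuousLinearMap.pi fun m => fc (n := n) m) (fun f g h => fc_ext fun m => congrFun h m)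
    (fun Z => by
      obtain ⟨g, hg, -⟩ := (P.smoothing_sob Z a).mono (show 0 + 1 ≤ k by omega) j
      exact ⟨g, funext fun m => hg m⟩)
  exact ⟨T, fun Z m => congrFun (hT Z) m⟩

/-- The continuous representatives of the smoothed states. -/
def Density.smoothC (a : Fin (n + 1)) : State n →L[ℂ] Cont n := (P.exists_smoothC hk a).choose

/-- The weak derivatives of the smoothed states. -/
def Density.smoothD (j : Fin n) (a : Fin (n + 1)) : State n →L[ℂ] ScalarL2 n :=
  (P.exists_smoothD hk j a).choose

/-- Smoothed states are continuous with square integrable derivatives. -/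
def Density.rep (Z : State n) : Rep (P.smoothing Z) where
  c a := P.smoothC hk a Z
  d j a := P.smoothD hk j a Z
  cl_c a := (P.exists_smoothC hk a).choose_spec Z
  wd j a := (P.exists_smoothD hk j a).choose_spec Z

/-- The product rule for smoothed states as a bounded bilinear map. -/
def Density.prodDerivL (a b : Fin (n + 1)) (j : Fin n) :
    State n →L[ℂ] State n →L[ℂ] ScalarL2 n :=
  mulL.bilinearComp (P.smoothC hk a) (P.smoothD hk j b)
    + (mulL.bilinearComp (P.smoothC hk b) (P.smoothD hk j a)).flip

theorem Density.prodDerivL_apply (a b : Fin (n + 1)) (j : Fin n) (Y Z : State n) :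
    P.prodDerivL hk a b j Y Z = (P.rep hk Y).prodDeriv (P.rep hk Z) a b j := rfl

/-- The quadratic term of smoothed states as a bounded bilinear map. -/
def Density.quadL (i : Fin n) : State n →L[ℂ] State n →L[ℂ] ScalarL2 n :=
  (1 / 2 : ℂ) • (∑ j : Fin n, (P.prodDerivL hk i.succ j.succ j + P.prodDerivL hk j.succ i.succ j)
    + P.prodDerivL hk 0 0 i)

theorem Density.quadL_apply (i : Fin n) (Y Z : State n) :
    P.quadL hk i Y Z = (P.rep hk Y).quad (P.rep hk Z) i := by
  simp only [Density.quadL, Rep.quad, smul_apply, add_apply, sum_apply, P.prodDerivL_apply]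

/-- Composition of a bilinear map with a linear one. -/
def postcomp {X Y : Type*} [NormedAddCommGroup X] [NormedSpace ℂ X] [NormedAddCommGroup Y]
    [NormedSpace ℂ Y] (A : X →L[ℂ] Y) (K : State n →L[ℂ] State n →L[ℂ] X) :
    State n →L[ℂ] State n →L[ℂ] Y :=
  (ContinuousLinearMap.compL ℂ (State n) X Y A).comp K

theorem postcomp_apply {X Y : Type*} [NormedAddCommGroup X] [NormedSpace ℂ X]
    [NormedAddCommGroup Y] [NormedSpace ℂ Y] (A : X →L[ℂ] Y)
    (K : State n →L[ℂ] State n →L[ℂ] X) (U V : State n) : postcomp A K U V = A (K U V) := rfl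

/-- The field of quadratic terms. -/
def Density.fieldL : State n →L[ℂ] State n →L[ℂ] VectorL2 n n :=
  ∑ i, postcomp (emb i) (P.quadL hk i)

theorem Density.comp_fieldL (i : Fin n) (Y Z : State n) :
    comp i (P.fieldL hk Y Z) = P.quadL hk i Y Z := by
  simp [Density.fieldL, sum_apply, postcomp_apply, map_sum, comp_emb]

/-- The state `(0, ρ^{-1/2} f)`. -/
def Density.lift : VectorL2 n n →L[ℂ] State n :=
  ∑ i : Fin n, (emb i.succ).comp ((mulL P.r).comp (comp i))

theorem Density.comp_zero_lift (f : VectorL2 n n) : comp 0 (P.lift f) = 0 := by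
  simp [Density.lift, sum_apply, map_sum, comp_emb, (Fin.succ_ne_zero _).symm]

theorem Density.comp_succ_lift (f : VectorL2 n n) (i : Fin n) :
    comp i.succ (P.lift f) = P.r • comp i f := by
  simp [Density.lift, sum_apply, map_sum, comp_emb, cont_smul_def]

theorem Density.dotL_lift (f : VectorL2 n n) (V : State n) :
    dotL (P.lift f) V = ∑ i, bil (comp i f) (P.g i V) := by
  rw [dotL_state, P.comp_zero_lift, map_zero, zero_apply, zero_add]
  refine Finset.sum_congr rfl fun i _ => ?_
  rw [P.comp_succ_lift, bil_smul, P.g_apply]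

/-- The quadratic term paired with a square integrable field. -/
def Density.fieldForm : VectorL2 n n →L[ℂ] State n →L[ℂ] State n →L[ℂ] ℂ :=
  ((ContinuousLinearMap.compL ℂ (State n) (State n →L[ℂ] VectorL2 n n)
    (State n →L[ℂ] ℂ)).flip (P.fieldL hk)).comp
      ((ContinuousLinearMap.compL ℂ (State n) (VectorL2 n n) ℂ).comp dotL)

theorem Density.fieldForm_apply (u : VectorL2 n n) (Y Z : State n) :
    P.fieldForm hk u Y Z = ∑ i, bil (P.quadL hk i Y Z) (comp i u) := by
  change dotL u (P.fieldL hk Y Z) = _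
  rw [dotL_comm, dotL_apply]
  simp only [P.comp_fieldL]

theorem Density.fieldForm_eq_zero {u : VectorL2 n n}
    (hu : WDiv (fun i => P.s • P.s • comp i u) 0) {α β : ℝ} (h : α + β = 0) {Y Z : State n}
    (hY : Y ∈ P.eigen α) (hZ : Z ∈ P.eigen β) : P.fieldForm hk u Y Z = 0 := by
  simp only [P.fieldForm_apply, P.quadL_apply]
  exact Rep.sum_bil_quad_eq_zero _ _ (by omega) (P.smoothing_eigen_mem hY)
    (P.smoothing_eigen_mem hZ) h hu

/-- The cubic interaction of smoothed states. -/
def Density.cubic : State n →L[ℂ] State n →L[ℂ] State n →L[ℂ] ℂ :=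
  (ContinuousLinearMap.compL ℂ (State n) (VectorL2 n n) (State n →L[ℂ] ℂ)
    (((dotL (n := n)).bilinearComp P.lift P.smoothing))).comp (P.fieldL hk)

end

/-! ### Mean values of the quadratic and cubic terms -/

section

set_option maxSynthPendingDepth 3

variable {k : ℕ} (P : Density n k) (hk : n < 2 * k)

theorem Density.cubic_apply (X Y Z : State n) :
    P.cubic hk X Y Z = dotL (P.lift (P.fieldL hk X Y)) (P.smoothing Z) := rfl

theorem Density.cubic_eq (X Y Z : State n) : P.cubic hk X Y Z
    = ∑ i, bil ((P.rep hk X).quad (P.rep hk Y) i) (P.g i (P.smoothing Z)) := by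
  simp only [P.cubic_apply, P.dotL_lift, P.comp_fieldL, P.quadL_apply]

/-- Cyclic rotation of the arguments of a trilinear form. -/
def rot (T : State n →L[ℂ] State n →L[ℂ] State n →L[ℂ] ℂ) :
    State n →L[ℂ] State n →L[ℂ] State n →L[ℂ] ℂ :=
  ((ContinuousLinearMap.flipₗᵢ ℂ (State n) (State n) ℂ).toLinearIsometry.toContinuousLinearMap.comp
    T).flip

theorem rot_apply (T : State n →L[ℂ] State n →L[ℂ] State n →L[ℂ] ℂ) (X Y Z : State n) :
    rot T X Y Z = T Y Z X := rfl

/-- The cyclic sum of the cubic interactions has mean zero along the wave group. -/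
theorem Density.hasMean_cubic {X Y Z : State n} (hX : X ∈ P.acoustic) (hY : Y ∈ P.acoustic)
    (hZ : Z ∈ P.acoustic) :
    HasMean (fun s => P.cubic hk (P.group s X) (P.group s Y) (P.group s Z)
      + P.cubic hk (P.group s Y) (P.group s Z) (P.group s X)
      + P.cubic hk (P.group s Z) (P.group s X) (P.group s Y)) 0 := by
  refine P.hasMean_trilinear_group (P.cubic hk + rot (P.cubic hk) + rot (rot (P.cubic hk)))
    (fun α β γ h U hU V hV W hW => ?_) hX hY hZ
  simp only [add_apply, rot_apply, P.cubic_eq]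
  exact Rep.sum_bil_quad_cyclic _ _ _ (by omega) (P.smoothing_eigen_mem hU)
    (P.smoothing_eigen_mem hV) (P.smoothing_eigen_mem hW) h

/-- The form `∫ c U_a V_b`. -/
def weighted (a b : Fin (n + 1)) : Cont n →L[ℂ] State n →L[ℂ] State n →L[ℂ] ℂ :=
  (ContinuousLinearMap.compL ℂ (State n) (ScalarL2 n) (State n →L[ℂ] ℂ)
    (((ContinuousLinearMap.compL ℂ (State n) (ScalarL2 n) ℂ).flip (comp b)).comp bil)).comp
    (((ContinuousLinearMap.compL ℂ (State n) (ScalarL2 n) (ScalarL2 n)).flip (comp a)).comp mulL)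

theorem weighted_apply (a b : Fin (n + 1)) (c : Cont n) (U V : State n) :
    weighted a b c U V = bil (c • comp a U) (comp b V) := rfl

/-- An entry of a matrix of continuous functions. -/
def entry (i j : Fin n) : (Fin n → Fin n → Cont n) →L[ℂ] Cont n :=
  (ContinuousLinearMap.proj (R := ℂ) (φ := fun _ : Fin n => Cont n) j).comp
    (ContinuousLinearMap.proj (R := ℂ) (φ := fun _ : Fin n => Fin n → Cont n) i)

theorem entry_apply (i j : Fin n) (a : Fin n → Fin n → Cont n) : entry i j a = a i j := rfl

/-- The quadratic term as a distribution, with the derivatives `∂ⱼ uᵢ` of the test field as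
parameters. -/
def derivForm : (Fin n → Fin n → Cont n) →L[ℂ] State n →L[ℂ] State n →L[ℂ] ℂ :=
  -((1 / 2 : ℂ) • ∑ i : Fin n, ∑ j : Fin n,
      (weighted i.succ j.succ + weighted j.succ i.succ).comp (entry i j)
    + (1 / 2 : ℂ) • ∑ i : Fin n, (weighted 0 0).comp (entry i i))

theorem derivForm_apply (a : Fin n → Fin n → Cont n) (U V : State n) : derivForm a U V
    = -((1 / 2 : ℂ) * (∑ i : Fin n, ∑ j : Fin n,
          (bil (a i j • comp i.succ U) (comp j.succ V)
            + bil (a i j • comp j.succ U) (comp i.succ V)))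
        + (1 / 2 : ℂ) * ∑ i, bil (a i i • comp 0 U) (comp 0 V)) := by
  simp only [derivForm, neg_apply, add_apply, smul_apply, sum_apply, smul_eq_mul,
    ContinuousLinearMap.comp_apply, entry_apply, weighted_apply]

theorem Rep.derivForm_eq {U V : State n} (R : Rep U) (S : Rep V) {a : Fin n → Fin n → Cont n}
    {u : Fin n → ScalarL2 n} (hu : ∀ i j, WD j (u i) (cl (a i j))) :
    derivForm a U V = ∑ i, bil (R.quad S i) (u i) := by
  simp only [R.sum_bil_quad S hu, derivForm_apply, ← R.cl_c, ← S.cl_c, bil_cont_smul_cl]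

/-- The form is bounded on `L²`, but resonance is tested on eigenvectors only. These are smoothings
of eigenvectors, so the derivatives may be moved back from `u`. -/
theorem Density.derivForm_eq_zero (hk : n < 2 * k) {a : Fin n → Fin n → Cont n}
    {u : Fin n → ScalarL2 n} (hu : ∀ i j, WD j (u i) (cl (a i j)))
    (hdiv : WDiv (fun i => P.s • P.s • u i) 0) {α β : ℝ} (h : α + β = 0) {Y Z : State n}
    (hY : Y ∈ P.eigen α) (hZ : Z ∈ P.eigen β) : derivForm a Y Z = 0 := by
  obtain ⟨Y', hY', rfl⟩ : ∃ Y' ∈ P.eigen α, P.smoothing Y' = Y :=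
    ⟨_, Submodule.smul_mem _ _ hY, (P.eq_smul_smoothing hY).symm⟩
  obtain ⟨Z', hZ', rfl⟩ : ∃ Z' ∈ P.eigen β, P.smoothing Z' = Z :=
    ⟨_, Submodule.smul_mem _ _ hZ, (P.eq_smul_smoothing hZ).symm⟩
  rw [(P.rep hk Y').derivForm_eq (P.rep hk Z') hu]
  exact Rep.sum_bil_quad_eq_zero _ _ (by omega) hY hZ h hdiv

theorem Density.derivForm_smoothing (hk : n < 2 * k) {a : Fin n → Fin n → Cont n}
    {u : Fin n → ScalarL2 n} (hu : ∀ i j, WD j (u i) (cl (a i j))) (Y Z : State n) :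
    derivForm a (P.smoothing Y) (P.smoothing Z) = ∑ i, bil (comp i (P.fieldL hk Y Z)) (u i) := by
  simp only [(P.rep hk Y).derivForm_eq (P.rep hk Z) hu, P.comp_fieldL, P.quadL_apply]

/-- The averaged quadratic terms exist. -/
theorem Density.exists_hasMean_quadratic {Y Z : State n} (hY : Y ∈ P.acoustic)
    (hZ : Z ∈ P.acoustic) : ∃ l, HasMean (fun s => P.group (-s)
      (P.lift (P.fieldL hk (P.group s Y) (P.group s Z)))) l :=
  P.exists_hasMean_group_bilinear (postcomp P.lift (P.fieldL hk)) hY hZ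

theorem Density.continuous_quadratic (Y Z : State n) : Continuous fun s => P.group (-s)
    (P.lift (P.fieldL hk (P.group s Y) (P.group s Z))) :=
  P.continuous_group_apply continuous_neg
    (P.continuous_bilinear_group (postcomp P.lift (P.fieldL hk)) Y Z)

/-- Pairing with the averaged quadratic term is the mean of the cubic interaction. -/
theorem Density.hasMean_cubic_of_hasMean {X Y Z l : State n} (hl : HasMean (fun s => P.group (-s)
    (P.lift (P.fieldL hk (P.group s X) (P.group s Y)))) l) :
    HasMean (fun s => P.cubic hk (P.group s X) (P.group s Y) (P.group s Z))
      (dotL l (P.smoothing Z)) := by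
  have h := hl.map (P.continuous_quadratic hk X Y) (dotL.flip (P.smoothing Z))
  refine h.congr fun τ => ?_
  -- The transposed group moves onto the third argument and commutes with the smoothing there.
  simp only [ContinuousLinearMap.flip_apply, P.dotL_group _ _ (P.smoothing_mem Z), P.cubic_apply,
    P.smoothing_group]

theorem Density.continuous_cubic (X Y Z : State n) : Continuous fun s =>
    P.cubic hk (P.group s X) (P.group s Y) (P.group s Z) :=
  (P.continuous_bilinear_group (P.cubic hk) X Y).clm_apply (P.continuous_group Z)

theorem Density.cubic_comm (X Y Z : State n) : P.cubic hk X Y Z = P.cubic hk Y X Z := by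
  simp only [P.cubic_eq, Rep.quad_comm (P.rep hk X)]

/-- The cancellation of the averaged cubic interactions. -/
theorem Density.dotL_mean_add {Y Z l m : State n} (hY : Y ∈ P.acoustic) (hZ : Z ∈ P.acoustic)
    (hl : HasMean (fun s => P.group (-s)
      (P.lift (P.fieldL hk (P.group s Y) (P.group s Y)))) l)
    (hm : HasMean (fun s => P.group (-s)
      (P.lift (P.fieldL hk (P.group s Y) (P.group s Z)))) m) :
    dotL l (P.smoothing Z) + 2 * dotL m (P.smoothing Y) = 0 := by
  have h1 := P.hasMean_cubic_of_hasMean hk (Z := Z) hl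
  have h2 := P.hasMean_cubic_of_hasMean hk (Z := Y) hm
  -- The cyclic sum for `(Y, Y, Z)` contains the mean of `(Y, Z, Y)` twice, once in the form `(Z, Y,
  -- Y)`. Uniqueness of the mean gives the identity.
  have h3 := (h1.add h2 (P.continuous_cubic hk Y Y Z) (P.continuous_cubic hk Y Z Y)).add h2
    ((P.continuous_cubic hk Y Y Z).add (P.continuous_cubic hk Y Z Y)) (P.continuous_cubic hk Y Z Y)
  have h4 := P.hasMean_cubic hk hY hY hZ
  have h5 : ∀ s, P.cubic hk (P.group s Z) (P.group s Y) (P.group s Y)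
      = P.cubic hk (P.group s Y) (P.group s Z) (P.group s Y) := fun s => P.cubic_comm hk _ _ _
  simp only [h5] at h4
  have := tendsto_nhds_unique h3 h4
  rw [← this]
  ring

end

/-! ### Agreement with the definitions of the statement -/

section

set_option maxSynthPendingDepth 3

section Fields

variable {m : ℕ}

theorem integral_sum_mul_eq (b : VectorL2 n m) {w : Torus n → Fin m → ℂ} {F : Fin m → ScalarL2 n}
    (h : ∀ i, (fun x => w x i) =ᵐ[volume] F i) :
    ∫ x, ∑ i, b x i * w x i = ∑ i, bil (comp i b) (F i) := by
  simp only [bil_eq]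
  rw [← integral_finsetSum _ fun i _ => integrable_mul _ _]
  refine integral_congr_ae ?_
  have h1 : ∀ᵐ x : Torus n, ∀ i, comp i b x = b x i := ae_all_iff.mpr fun i => comp_coeFn i b
  have h2 : ∀ᵐ x : Torus n, ∀ i, w x i = F i x := ae_all_iff.mpr h
  filter_upwards [h1, h2] with x h1 h2
  simp only [h1, h2]

theorem coeFn_cl_rc {f : Torus n → ℝ} (hf : Continuous f) :
    (fun x => (f x : ℂ)) =ᵐ[volume] cl (rc f) := by
  filter_upwards [cl_coeFn (rc f)] with x h
  rw [h, rc_apply hf]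

theorem integral_sum_mul_real (b : VectorL2 n m) {u : Torus n → Fin m → ℝ}
    (h : ∀ i, Continuous fun x => u x i) :
    ∫ x, ∑ i, b x i * ((u x i : ℝ) : ℂ) = ∑ i, bil (comp i b) (cl (rc fun x => u x i)) :=
  integral_sum_mul_eq b fun i => coeFn_cl_rc (h i)

theorem weighted_coeFn (c : Cont n) (a b : Fin m) (U V : VectorL2 n m) :
    (fun x => (c • comp a U) x * comp b V x) =ᵐ[volume] fun x => U x a * V x b * c x := by
  filter_upwards [cont_smul_coeFn c (comp a U), comp_coeFn a U, comp_coeFn b V] with x h1 h2 h3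
  rw [h1, h2, h3]
  ring

theorem integrable_weighted (c : Cont n) (a b : Fin m) (U V : VectorL2 n m) :
    Integrable (fun x => U x a * V x b * c x) volume :=
  (integrable_mul (c • comp a U) (comp b V)).congr (weighted_coeFn c a b U V)

theorem integral_weighted (c : Cont n) (a b : Fin m) (U V : VectorL2 n m) :
    ∫ x, U x a * V x b * c x = bil (c • comp a U) (comp b V) := by
  rw [bil_eq]
  exact (integral_congr_ae (weighted_coeFn c a b U V)).symm

/-- Square integrable functions are determined by their pairings with smooth functions. -/
theorem eq_of_bil_smooth {f g : ScalarL2 n}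
    (h : ∀ η : Torus n → ℝ, IsSmooth η → bil f (cl (rc η)) = bil g (cl (rc η))) : f = g := by
  refine fc_ext fun m => ?_
  rw [fc_def, fc_def, bil_comm _ f, bil_comm _ g, ← rc_re_add_im (mFourier (-m)), map_add,
    ContinuousLinearMap.map_smul, map_add, map_add, ContinuousLinearMap.map_smul,
    ContinuousLinearMap.map_smul, h _ (isCk_re_mFourier (-m) _), h _ (isCk_im_mFourier (-m) _)]

theorem toL2_eq {f : Torus n → EuclideanSpace ℂ (Fin m)} {F : VectorL2 n m}
    (h : f =ᵐ[volume] F) : toL2 f = F := by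
  have hf : MemLp f 2 volume := (Lp.memLp F).ae_eq h.symm
  rw [toL2, dif_pos hf]
  refine Lp.ext ?_
  filter_upwards [hf.coeFn_toLp, h] with x h1 h2
  rw [h1, h2]

/-- The complexification of a real field. -/
def complexify : Lp (EuclideanSpace ℝ (Fin m)) 2 (volume : Measure (Torus n)) →L[ℝ] VectorL2 n m :=
  ∑ i, ((emb i).restrictScalars ℝ).comp (ContinuousLinearMap.compLpL 2 volume
    (Complex.ofRealCLM.comp (EuclideanSpace.proj (𝕜 := ℝ) i)))

theorem complexify_coeFn (i : Fin m)
    (u : Lp (EuclideanSpace ℝ (Fin m)) 2 (volume : Measure (Torus n))) :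
    (fun x => ((u x i : ℝ) : ℂ)) =ᵐ[volume] comp i (complexify u) := by
  have h : complexify u = ofComp fun i => ContinuousLinearMap.compLpL 2 volume
      (Complex.ofRealCLM.comp (EuclideanSpace.proj (𝕜 := ℝ) i)) u := by
    simp [complexify, ofComp, sum_apply]
  rw [h, comp_ofComp]
  exact (ContinuousLinearMap.coeFn_compLpL
    (Complex.ofRealCLM.comp (EuclideanSpace.proj (𝕜 := ℝ) i)) u).symm

/-- Currying turns joint continuity into continuity in time for the sup norm over the torus. -/
theorem continuousOn_rc {S : Set ℝ} {f : ℝ → Torus n → ℝ}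
    (hf : ContinuousOn (fun p : ℝ × Torus n => f p.1 p.2) (S ×ˢ univ)) :
    ContinuousOn (fun s => rc (f s)) S := by
  have h : Continuous fun p : S × Torus n => f p.1 p.2 :=
    hf.comp_continuous (f := fun p : S × Torus n => ((p.1 : ℝ), p.2)) (by fun_prop)
      fun p => ⟨p.1.2, mem_univ _⟩
  let F : C(S × Torus n, ℂ) := ⟨fun p => (f p.1 p.2 : ℂ), Complex.continuous_ofReal.comp h⟩
  rw [continuousOn_iff_continuous_domRestrict]
  have : S.domRestrict (fun s => rc (f s)) = F.curry := by
    ext s x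
    exact rc_apply (h.comp (Continuous.prodMk_right s)) x
  rw [this]
  exact F.curry.continuous

end Fields

section Bridge

variable {k : ℕ} {ρ : Torus n → ℝ} (hρ : IsCk (k : WithTop ℕ∞) ρ) (hpos : ∀ x, 0 < ρ x)

theorem s_of_apply (x : Torus n) : (Density.of ρ hρ hpos).s x = ((Real.sqrt (ρ x) : ℝ) : ℂ) :=
  rc_apply (Real.continuous_sqrt.comp hρ.continuous) x

theorem r_of_apply (x : Torus n) : (Density.of ρ hρ hpos).r x = ((Real.sqrt (ρ x) : ℝ) : ℂ)⁻¹ := by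
  have h := congrArg (fun c : Cont n => c x) (Density.of ρ hρ hpos).s_mul_r
  simp only [ContinuousMap.mul_apply, ContinuousMap.one_apply] at h
  rw [← s_of_apply hρ hpos]
  exact eq_inv_of_mul_eq_one_right h

theorem div_sqrt_coeFn {m : ℕ} (V : VectorL2 n m) (j : Fin m) :
    (fun x => V x j / ((Real.sqrt (ρ x) : ℝ) : ℂ))
      =ᵐ[volume] ((Density.of ρ hρ hpos).r • comp j V : ScalarL2 n) := by
  filter_upwards [cont_smul_coeFn (Density.of ρ hρ hpos).r (comp j V), comp_coeFn j V]
    with x h1 h2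
  rw [h1, h2, r_of_apply, div_eq_mul_inv, mul_comm]

theorem mem_acousticSpace_iff {V : State n} :
    V ∈ acousticSpace ρ ↔ V ∈ (Density.of ρ hρ hpos).acoustic :=
  exists_congr fun _ => forall_congr' fun j =>
    hasWeakPartial_iff (EventuallyEq.refl _ _) (div_sqrt_coeFn hρ hpos V j.succ)

theorem isWaveOperator_iff {V W : State n} :
    IsWaveOperator ρ V W ↔ (Density.of ρ hρ hpos).Wave V W := by
  refine and_congr (mem_acousticSpace_iff hρ hpos) (and_congr ?_ (forall_congr' fun j => ?_))
  · rw [wdiv_iff_test]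
    refine forall₂_congr fun η hη => ?_
    have hη1 : IsCk 1 η := hη.mono (by norm_cast)
    have hpd : ∀ j, Continuous (pd j η) := fun j => (hη1.pd (k := 0) (by simp) j).continuous
    have h1 : ∫ x, ∑ j : Fin n, ((Real.sqrt (ρ x) : ℝ) : ℂ) * V x j.succ * ((pd j η x : ℝ) : ℂ)
        = ∑ j : Fin n, bil ((Density.of ρ hρ hpos).s • comp j.succ V) (cl (rc (pd j η))) := by
      have h2 : ∀ j : Fin n, (fun x => ((Real.sqrt (ρ x) : ℝ) : ℂ) * V x j.succ
          * ((pd j η x : ℝ) : ℂ)) =ᵐ[volume]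
          fun x => ((Density.of ρ hρ hpos).s • comp j.succ V) x * ((pd j η x : ℝ) : ℂ) := by
        intro j
        filter_upwards [cont_smul_coeFn (Density.of ρ hρ hpos).s (comp j.succ V),
          comp_coeFn j.succ V] with x e1 e2
        rw [e1, e2, s_of_apply]
      rw [integral_finsetSum _ fun j _ => (integrable_mul_real _ (hpd j)).congr (h2 j).symm]
      refine Finset.sum_congr rfl fun j _ => ?_
      rw [integral_congr_ae (h2 j), integral_mul_real _ (hpd j)]
    have h3 : ∫ x, W x 0 * ((η x : ℝ) : ℂ) = bil (comp 0 W) (cl (rc η)) := by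
      rw [← integral_mul_real _ hη1.continuous]
      refine integral_congr_ae ?_
      filter_upwards [comp_coeFn 0 W] with x h
      rw [h]
    rw [h1, h3, map_neg, neg_apply, neg_neg]
  · refine hasWeakPartial_iff (comp_coeFn 0 V).symm ?_
    filter_upwards [div_sqrt_coeFn hρ hpos W j.succ,
      Lp.coeFn_neg ((Density.of ρ hρ hpos).g j W)] with x h1 h2
    rw [h2, Pi.neg_apply, h1]
    rfl

/-- The weak eigenvectors already form a closed subspace, so span and closure add nothing. -/
theorem eigenspace_eq (μ : ℝ) : eigenspace ρ μ = (Density.of ρ hρ hpos).eigen μ := by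
  have h : {V : State n | IsWaveOperator ρ V ((Complex.I * (μ : ℂ)) • V)}
      = ((Density.of ρ hρ hpos).eigen μ : Set (State n)) :=
    Set.ext fun V => isWaveOperator_iff hρ hpos
  rw [eigenspace, h, Submodule.span_eq]
  exact ((Density.of ρ hρ hpos).isClosed_eigen μ).submodule_topologicalClosure_eq

theorem starProjection_congr {E : Type*} [NormedAddCommGroup E] [InnerProductSpace ℂ E]
    {K L : Submodule ℂ E} [K.HasOrthogonalProjection] [L.HasOrthogonalProjection] (h : K = L)
    (v : E) : K.starProjection v = L.starProjection v := by
  subst h; rfl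

theorem waveGroup_eq (s : ℝ) (V : State n) :
    waveGroup ρ s V = (Density.of ρ hρ hpos).group s V := by
  rw [waveGroup, Density.group_apply]
  refine tsum_congr fun μ => ?_
  rw [starProjection_congr (eigenspace_eq hρ hpos μ)]
  rfl

theorem stateMemSobolev_iff {V : State n} : StateMemSobolev k V ↔ StateSob k V :=
  forall_congr' fun i => memSobolev_iff (comp_coeFn i V).symm

theorem wdiv_of_weightedDivFree {u : Torus n → Fin n → ℝ} (h : WeightedDivFree ρ u)
    {F : Fin n → ScalarL2 n} (hF : ∀ i, (fun x => ((u x i : ℝ) : ℂ)) =ᵐ[volume] F i) :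
    WDiv (fun i => (Density.of ρ hρ hpos).s • (Density.of ρ hρ hpos).s • F i) 0 := by
  rw [wdiv_iff_test]
  intro η hη
  have hη1 : IsCk 1 η := hη.mono (by norm_cast)
  have hpd : ∀ j, Continuous (pd j η) := fun j => (hη1.pd (k := 0) (by simp) j).continuous
  have h2 : ∀ j : Fin n, (fun x => ((Density.of ρ hρ hpos).s • (Density.of ρ hρ hpos).s • F j) x
      * ((pd j η x : ℝ) : ℂ)) =ᵐ[volume] fun x => ((ρ x * u x j * pd j η x : ℝ) : ℂ) := by
    intro j
    filter_upwards [cont_smul_coeFn (Density.of ρ hρ hpos).s ((Density.of ρ hρ hpos).s • F j),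
      cont_smul_coeFn (Density.of ρ hρ hpos).s (F j), hF j] with x e1 e2 e3
    rw [e1, e2, ← e3, s_of_apply, ← mul_assoc, ← Complex.ofReal_mul, Real.mul_self_sqrt (hpos x).le]
    push_cast
    ring
  have h3 : ∀ j, bil ((Density.of ρ hρ hpos).s • (Density.of ρ hρ hpos).s • F j)
      (cl (rc (pd j η))) = ∫ x, ((ρ x * u x j * pd j η x : ℝ) : ℂ) := fun j => by
    rw [← integral_congr_ae (h2 j), integral_mul_real _ (hpd j)]
  simp only [h3]
  rw [← integral_finsetSum _ fun j _ => (integrable_mul_real _ (hpd j)).congr (h2 j), map_zero,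
    zero_apply, neg_zero]
  have h4 := h η hη
  have h5 : ∫ x, ((∑ j, ρ x * u x j * pd j η x : ℝ) : ℂ) = 0 := by
    rw [integral_complex_ofReal, h4, Complex.ofReal_zero]
  rw [← h5]
  refine integral_congr_ae (ae_of_all _ fun x => ?_)
  push_cast
  rfl

theorem B2pair_eq (s : ℝ) (V₁ V₂ : State n) {u : Torus n → Fin n → ℝ}
    (hu : ∀ i, IsCk 1 fun x => u x i) : B2pair ρ s V₁ V₂ u
      = derivForm (fun i j => rc (pd j fun x => u x i)) ((Density.of ρ hρ hpos).group s V₁)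
        ((Density.of ρ hρ hpos).group s V₂) := by
  have hpd : ∀ i j, Continuous (pd j fun x => u x i) :=
    fun i j => ((hu i).pd (k := 0) (by simp) j).continuous
  rw [B2pair, derivForm_apply]
  simp only [waveGroup_eq hρ hpos, ← integral_weighted]
  generalize (Density.of ρ hρ hpos).group s V₁ = U
  generalize (Density.of ρ hρ hpos).group s V₂ = V
  congr 1
  have hint := fun a b i j => integrable_weighted (rc (pd j fun x => u x i)) a b U V
  simp only [← integral_add (hint _ _ _ _) (hint _ _ _ _)]
  have hint2 := fun i j : Fin n => (hint i.succ j.succ i j).add (hint j.succ i.succ i j)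
  simp only [Pi.add_def] at hint2
  have hint3 := fun i : Fin n => integrable_finsetSum Finset.univ fun j _ => hint2 i j
  simp only [← integral_finsetSum Finset.univ fun j _ => hint2 _ j,
    ← integral_finsetSum Finset.univ fun i _ => hint3 i,
    ← integral_finsetSum Finset.univ fun i _ => hint 0 0 i i, ← integral_const_mul]
  rw [← integral_add ((integrable_finsetSum _ fun i _ => hint3 i).const_mul _)
    ((integrable_finsetSum _ fun i _ => hint 0 0 i i).const_mul _)]
  refine integral_congr_ae (ae_of_all _ fun x => ?_)
  simp only [rc_apply (hpd _ _), Finset.mul_sum]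
  congr 1
  · refine Finset.sum_congr rfl fun i _ => Finset.sum_congr rfl fun j _ => ?_
    ring
  · refine Finset.sum_congr rfl fun i _ => ?_
    ring

end Bridge

end

/-! ### Helmholtz projection and the averaged quadratic term -/

section

set_option maxSynthPendingDepth 3

variable {k : ℕ} {P : Density n k}

/-- The weighted gradient part of a field, through the projection on the acoustic states. -/
theorem Density.starProjection_lift {f g : VectorL2 n n}
    (hg : ∃ w, ∀ j, WD j w (P.r • P.r • comp j g))
    (h : WDiv (fun j => comp j f - comp j g) 0) :
    P.acoustic.starProjection (P.lift f) = P.lift g := by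
  refine Submodule.eq_starProjection_of_mem_of_inner_eq_zero ?_ fun V hV => ?_
  · obtain ⟨w, hw⟩ := hg
    refine ⟨w, fun j => ?_⟩
    rw [P.g_apply, P.comp_succ_lift]
    exact hw j
  · obtain ⟨w, hw⟩ := P.conjV_mem_acoustic hV
    have h1 := h.pair hw
    rw [map_zero, zero_apply, neg_zero] at h1
    rw [← map_sub, ← inner_conj_symm, inner_eq_dotL, dotL_comm, P.dotL_lift]
    simp only [map_sub] at h1 ⊢
    rw [h1, map_zero]

/-- The weighted Helmholtz decomposition exists. -/
theorem Density.exists_gradient_part (f : VectorL2 n n) : ∃ g : VectorL2 n n,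
    (∃ w, ∀ j, WD j w (P.r • P.r • comp j g)) ∧ WDiv (fun j => comp j f - comp j g) 0 := by
  -- In the variables `h = ρ^{-1/2} f` the weighted decomposition is the orthogonal one, so the
  -- gradient part is `√ρ` times the projected `h`.
  let X := P.acoustic.starProjection (P.lift f)
  refine ⟨ofComp fun j => P.s • comp j.succ X, ?_, ?_⟩
  · obtain ⟨w, hw⟩ := Submodule.starProjection_apply_mem P.acoustic (P.lift f)
    refine ⟨w, fun j => ?_⟩
    rw [comp_ofComp, ← mul_smul P.r P.s, P.r_mul_s, one_smul]
    exact hw j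
  · rw [wdiv_iff_test]
    intro η hη
    have hη1 : IsCk 1 η := hη.mono (by norm_cast)
    -- The state `(0, √ρ∇η)` is acoustic, and orthogonality to it is the weak equation tested with
    -- `η`.
    let Y : State n := ofComp (Fin.cons 0 fun j => P.s • cl (rc (pd j η)))
    have hY0 : comp 0 Y = 0 := by simp [Y, comp_ofComp]
    have hYs : ∀ j : Fin n, comp j.succ Y = P.s • cl (rc (pd j η)) := fun j => by
      simp [Y, comp_ofComp]
    have hY : Y ∈ P.acoustic := ⟨cl (rc η), fun j => by
      rw [P.g_apply, hYs, ← mul_smul, P.r_mul_s, one_smul]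
      exact (hη1.hasPD j).wd⟩
    have h1 := P.dotL_of_orthogonal (Submodule.sub_starProjection_mem_orthogonal (P.lift f)) hY
    rw [dotL_state, hY0, map_zero, zero_add] at h1
    rw [map_zero, zero_apply, neg_zero, ← h1]
    refine Finset.sum_congr rfl fun j _ => ?_
    rw [comp_ofComp, hYs, ← bil_smul, map_sub (comp j.succ), smul_sub, P.comp_succ_lift,
      ← mul_smul P.s P.r, P.s_mul_r, one_smul]

section Bridge

variable {ρ : Torus n → ℝ} (hρ : IsCk (k : WithTop ℕ∞) ρ) (hpos : ∀ x, 0 < ρ x)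

theorem isHelmholtzPerp_iff {f g : Field n} : IsHelmholtzPerp ρ f g ↔
    (∃ w, ∀ j, WD j w ((Density.of ρ hρ hpos).r • (Density.of ρ hρ hpos).r • comp j g)) ∧
      WDiv (fun j => comp j f - comp j g) 0 := by
  refine and_congr (exists_congr fun w => forall_congr' fun j =>
    hasWeakPartial_iff (EventuallyEq.refl _ _) ?_) ?_
  · filter_upwards [cont_smul_coeFn (Density.of ρ hρ hpos).r
      ((Density.of ρ hρ hpos).r • comp j g), cont_smul_coeFn (Density.of ρ hρ hpos).r (comp j g),
      comp_coeFn j g] with x h1 h2 h3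
    rw [h1, h2, h3, r_of_apply, ← mul_assoc, ← mul_inv, ← Complex.ofReal_mul,
      Real.mul_self_sqrt (hpos x).le, div_eq_mul_inv, mul_comm]
  · rw [wdiv_iff_test]
    refine forall₂_congr fun η hη => ?_
    have hη1 : IsCk 1 η := hη.mono (by norm_cast)
    have hpd : ∀ j, Continuous (pd j η) := fun j => (hη1.pd (k := 0) (by simp) j).continuous
    have h1 := fun b : Field n => integral_sum_mul_real b (u := fun x j => pd j η x) hpd
    rw [h1, h1, map_zero, zero_apply, neg_zero, eq_comm, ← sub_eq_zero, ← Finset.sum_sub_distrib]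
    simp only [map_sub, sub_apply]

theorem isHelmholtzPerp_helmholtzPerp (hρ : IsCk (k : WithTop ℕ∞) ρ) (hpos : ∀ x, 0 < ρ x)
    (f : Field n) :
    IsHelmholtzPerp ρ f (helmholtzPerp ρ f) := by
  have h : ∃ g, IsHelmholtzPerp ρ f g := by
    obtain ⟨g, hg⟩ := (Density.of ρ hρ hpos).exists_gradient_part f
    exact ⟨g, (isHelmholtzPerp_iff hρ hpos).mpr hg⟩
  rw [helmholtzPerp, dif_pos h]
  exact h.choose_spec

/-- The Helmholtz projection becomes the projection onto the acoustic space, which the wave group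
performs by itself; it therefore disappears from the averaged integrand. -/
theorem forcing_eq (f : Field n) : forcing ρ f
    = (Density.of ρ hρ hpos).acoustic.starProjection ((Density.of ρ hρ hpos).lift f) := by
  have h := (isHelmholtzPerp_iff hρ hpos).mp (isHelmholtzPerp_helmholtzPerp hρ hpos f)
  rw [Density.starProjection_lift h.1 h.2]
  refine toL2_eq ?_
  have h1 : ∀ᵐ x : Torus n, ∀ i, comp i ((Density.of ρ hρ hpos).lift (helmholtzPerp ρ f)) x
      = (Density.of ρ hρ hpos).lift (helmholtzPerp ρ f) x i :=
    ae_all_iff.mpr fun i => comp_coeFn i _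
  have h2 : ∀ᵐ x : Torus n, ∀ j, helmholtzPerp ρ f x j / ((Real.sqrt (ρ x) : ℝ) : ℂ)
      = ((Density.of ρ hρ hpos).r • comp j (helmholtzPerp ρ f) : ScalarL2 n) x :=
    ae_all_iff.mpr fun j => div_sqrt_coeFn hρ hpos _ j
  filter_upwards [h1, h2, Lp.coeFn_zero ℂ 2 (volume : Measure (Torus n))] with x h1 h2 h3
  ext i
  refine Fin.cases ?_ (fun j => ?_) i
  · rw [← h1, Density.comp_zero_lift, h3]
    rfl
  · rw [← h1, Density.comp_succ_lift, ← h2]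
    rfl

variable (hk : n < 2 * k)

theorem isB2_fieldL (s : ℝ) (Y Z : State n) :
    IsB2 ρ s ((Density.of ρ hρ hpos).smoothing Y) ((Density.of ρ hρ hpos).smoothing Z)
      ((Density.of ρ hρ hpos).fieldL hk ((Density.of ρ hρ hpos).group s Y)
        ((Density.of ρ hρ hpos).group s Z)) := by
  intro u hu
  have hu1 : ∀ i, IsCk 1 fun x => u x i := fun i => (hu i).mono (by norm_cast)
  rw [B2pair_eq hρ hpos s _ _ hu1, integral_sum_mul_real _ fun i => (hu1 i).continuous,
    ← Density.smoothing_group, ← Density.smoothing_group, Density.derivForm_smoothing _ hk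
      fun i j => ((hu1 i).hasPD j).wd]

theorem IsB2.unique {s : ℝ} {V₁ V₂ : State n} {b b' : Field n} (h : IsB2 ρ s V₁ V₂ b)
    (h' : IsB2 ρ s V₁ V₂ b') : b = b' := by
  refine comp_ext fun i => eq_of_bil_smooth fun η hη => ?_
  let u : Torus n → Fin n → ℝ := fun x j => if j = i then η x else 0
  have hu : ∀ j, IsSmooth fun x => u x j := fun j => by
    by_cases hj : j = i
    · simpa only [u, if_pos hj] using hη
    · simp only [u, if_neg hj]
      exact contDiff_const
  have hη1 : IsCk 1 η := hη.mono (by norm_cast)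
  have e : ∀ c : Field n, ∫ x, ∑ j, c x j * ((u x j : ℝ) : ℂ) = bil (comp i c) (cl (rc η)) := by
    intro c
    rw [← integral_mul_real _ hη1.continuous]
    refine integral_congr_ae ?_
    filter_upwards [comp_coeFn i c] with x hx
    rw [hx, Finset.sum_eq_single i (fun j _ hj => by simp [u, hj]) (by simp)]
    simp [u]
  rw [← e, ← e, h u hu, h' u hu]

theorem B2_eq (s : ℝ) (Y Z : State n) :
    B2 ρ s ((Density.of ρ hρ hpos).smoothing Y) ((Density.of ρ hρ hpos).smoothing Z)
      = (Density.of ρ hρ hpos).fieldL hk ((Density.of ρ hρ hpos).group s Y)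
        ((Density.of ρ hρ hpos).group s Z) := by
  have h := isB2_fieldL hρ hpos hk s Y Z
  rw [B2, dif_pos ⟨_, h⟩]
  exact IsB2.unique (Exists.choose_spec (⟨_, h⟩ : ∃ b, IsB2 ρ s _ _ b)) h

theorem Q2integrand_eq (Y Z : State n) :
    Q2integrand ρ ((Density.of ρ hρ hpos).smoothing Y) ((Density.of ρ hρ hpos).smoothing Z)
      = fun s => (Density.of ρ hρ hpos).group (-s) ((Density.of ρ hρ hpos).lift
        ((Density.of ρ hρ hpos).fieldL hk ((Density.of ρ hρ hpos).group s Y)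
          ((Density.of ρ hρ hpos).group s Z))) := by
  funext s
  rw [Q2integrand, B2_eq hρ hpos hk, forcing_eq hρ hpos, waveGroup_eq hρ hpos, Density.group_proj]

/-- Convergence of the averages is what makes the value of `limUnder` meaningful. -/
theorem hasMean_Q2 (hk : n < 2 * k) {Y Z : State n} (hY : Y ∈ (Density.of ρ hρ hpos).acoustic)
    (hZ : Z ∈ (Density.of ρ hρ hpos).acoustic) :
    HasMean (Q2integrand ρ ((Density.of ρ hρ hpos).smoothing Y)
      ((Density.of ρ hρ hpos).smoothing Z))
      (Q2 ρ ((Density.of ρ hρ hpos).smoothing Y) ((Density.of ρ hρ hpos).smoothing Z)) := by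
  have h := (Density.of ρ hρ hpos).exists_hasMean_quadratic hk hY hZ
  rw [← Q2integrand_eq hρ hpos hk] at h
  exact tendsto_nhds_limUnder h

end Bridge

end

end Anelastic

end

/-! ### Assembly of the theorem -/

open Anelastic

theorem proposition3p5 {n k : ℕ} (hk : n < 2 * k)
    (ρ : Anelastic.Torus n → ℝ) (hρ : Anelastic.IsCk (k : WithTop ℕ∞) ρ) (hpos : ∀ x, 0 < ρ x) :
    -- the limit of `∫₀ᵗ ∫ B₂(V₁,V₂) · u` for `V₁, V₂` in `L²` and `u` of class `C¹` in space
    (∀ t : ℝ, 0 ≤ t → ∀ V₁ V₂ : ℝ → Anelastic.State n,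
      ContinuousOn V₁ (Icc 0 t) → ContinuousOn V₂ (Icc 0 t) →
      (∀ s ∈ Icc 0 t, V₁ s ∈ Anelastic.acousticSpace ρ) →
      (∀ s ∈ Icc 0 t, V₂ s ∈ Anelastic.acousticSpace ρ) →
      ∀ u : ℝ → Anelastic.Torus n → Fin n → ℝ,
      (∀ s ∈ Icc 0 t, ∀ i, Anelastic.IsCk 1 (fun x => u s x i)) →
      (∀ i, ContinuousOn (fun p : ℝ × Anelastic.Torus n => u p.1 p.2 i) (Icc 0 t ×ˢ univ)) →
      (∀ i j, ContinuousOn (fun p : ℝ × Anelastic.Torus n =>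
        Anelastic.pd j (fun x => u p.1 x i) p.2) (Icc 0 t ×ˢ univ)) →
      (∀ s ∈ Icc 0 t, Anelastic.WeightedDivFree ρ (u s)) →
      Tendsto (fun ε : ℝ => ∫ s in (0 : ℝ)..t, Anelastic.B2pair ρ (s / ε) (V₁ s) (V₂ s) (u s))
        (𝓝[>] 0) (𝓝 0)) ∧
    -- for `V₁, V₂` in `H^k`, `B₂(V₁,V₂)` is an `L²` field and `𝒬₂(V₁,V₂)` exists as an `L²` limit
    (∀ V₁ V₂ : Anelastic.State n,
      V₁ ∈ Anelastic.acousticSpace ρ → V₂ ∈ Anelastic.acousticSpace ρ →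
      Anelastic.StateMemSobolev k V₁ → Anelastic.StateMemSobolev k V₂ →
      (∀ s, Anelastic.IsB2 ρ s V₁ V₂ (Anelastic.B2 ρ s V₁ V₂)) ∧
      (∀ τ : ℝ, IntervalIntegrable (Anelastic.Q2integrand ρ V₁ V₂) volume 0 τ) ∧
      Tendsto (Anelastic.Q2average ρ V₁ V₂) atTop (𝓝 (Anelastic.Q2 ρ V₁ V₂))) ∧
    -- the same limit for `V₁, V₂` in `H^k` and `u` in `L²`
    (∀ V₁ V₂ : Anelastic.State n,
      V₁ ∈ Anelastic.acousticSpace ρ → V₂ ∈ Anelastic.acousticSpace ρ →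
      Anelastic.StateMemSobolev k V₁ → Anelastic.StateMemSobolev k V₂ →
      ∀ t : ℝ, 0 ≤ t →
      ∀ u : ℝ → Lp (EuclideanSpace ℝ (Fin n)) 2 (volume : Measure (Anelastic.Torus n)),
      ContinuousOn u (Icc 0 t) →
      (∀ s ∈ Icc 0 t, Anelastic.WeightedDivFree ρ (fun x i => u s x i)) →
      Tendsto (fun ε : ℝ => ∫ s in (0 : ℝ)..t,
          ∫ x, ∑ i, Anelastic.B2 ρ (s / ε) V₁ V₂ x i * ((u s x i : ℝ) : ℂ))
        (𝓝[>] 0) (𝓝 0)) ∧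
    (∀ V : Anelastic.State n, V ∈ Anelastic.acousticSpace ρ → Anelastic.StateMemSobolev k V →
      Anelastic.dotInt (Anelastic.Q2 ρ V V) V = 0) ∧
    (∀ V₁ V₂ : Anelastic.State n,
      V₁ ∈ Anelastic.acousticSpace ρ → V₂ ∈ Anelastic.acousticSpace ρ →
      Anelastic.StateMemSobolev k V₁ → Anelastic.StateMemSobolev k V₂ →
      Anelastic.dotInt (Anelastic.Q2 ρ V₁ V₁) V₂
        + 2 * Anelastic.dotInt (Anelastic.Q2 ρ V₁ V₂) V₁ = 0) := by
  let P := Density.of ρ hρ hpos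
  have hsm : ∀ V : State n, V ∈ acousticSpace ρ → StateMemSobolev k V →
      ∃ Z ∈ P.acoustic, P.smoothing Z = V := fun V hV hVk =>
    P.exists_smoothing_eq ((mem_acousticSpace_iff hρ hpos).mp hV) (stateMemSobolev_iff.mp hVk)
  have hcubic : ∀ V₁ V₂ : State n, V₁ ∈ acousticSpace ρ → V₂ ∈ acousticSpace ρ →
      StateMemSobolev k V₁ → StateMemSobolev k V₂ →
      dotInt (Q2 ρ V₁ V₁) V₂ + 2 * dotInt (Q2 ρ V₁ V₂) V₁ = 0 := by
    intro V₁ V₂ h1 h2 h1k h2k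
    obtain ⟨Y, hY, rfl⟩ := hsm V₁ h1 h1k
    obtain ⟨Z, hZ, rfl⟩ := hsm V₂ h2 h2k
    rw [dotInt_eq_dotL, dotInt_eq_dotL]
    refine P.dotL_mean_add hk hY hZ ?_ ?_
    · rw [← Q2integrand_eq hρ hpos hk]
      exact hasMean_Q2 hρ hpos hk hY hY
    · rw [← Q2integrand_eq hρ hpos hk]
      exact hasMean_Q2 hρ hpos hk hY hZ
  refine ⟨?_, ?_, ?_, ?_, hcubic⟩
  · intro t ht V₁ V₂ hc1 hc2 ha1 ha2 u hu huc hdu hdiv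
    -- The slow parameter is the matrix of derivatives of `u` in the sup norm, for which the form is
    -- bounded on `L²` states.
    have hd : ContinuousOn (fun s => fun i j => rc (pd j fun x => u s x i)) (Icc 0 t) :=
      continuousOn_pi.mpr fun i => continuousOn_pi.mpr fun j => continuousOn_rc (hdu i j)
    refine (P.tendsto_integral_orbit derivForm ht hd hc1 hc2
      (fun s hs => (mem_acousticSpace_iff hρ hpos).mp (ha1 s hs))
      (fun s hs => (mem_acousticSpace_iff hρ hpos).mp (ha2 s hs))
      fun s hs α β h X hX Y hY => P.derivForm_eq_zero hk
        (fun i j => ((hu s hs i).hasPD j).wd)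
        (wdiv_of_weightedDivFree hρ hpos (hdiv s hs) fun i => coeFn_cl_rc (hu s hs i).continuous)
        h hX hY).congr fun ε => intervalIntegral.integral_congr fun s hs => ?_
    rw [uIcc_of_le ht] at hs
    exact (B2pair_eq hρ hpos _ _ _ (hu s hs)).symm
  · intro V₁ V₂ h1 h2 h1k h2k
    obtain ⟨Y, hY, rfl⟩ := hsm V₁ h1 h1k
    obtain ⟨Z, hZ, rfl⟩ := hsm V₂ h2 h2k
    refine ⟨fun s => ?_, fun τ => ?_, hasMean_Q2 hρ hpos hk hY hZ⟩
    · rw [B2_eq hρ hpos hk]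
      exact isB2_fieldL hρ hpos hk s Y Z
    · rw [Q2integrand_eq hρ hpos hk]
      exact (P.continuous_quadratic hk Y Z).intervalIntegrable _ _
  · intro V₁ V₂ h1 h2 h1k h2k t ht u hu hdiv
    obtain ⟨Y, hY, rfl⟩ := hsm V₁ h1 h1k
    obtain ⟨Z, hZ, rfl⟩ := hsm V₂ h2 h2k
    -- Here the slow parameter is `u` itself in `L²`, since the smoothed quadratic term is an `L²`
    -- field.
    have hd : ContinuousOn (fun s => complexify (u s)) (Icc 0 t) :=
      complexify.continuous.comp_continuousOn hu
    refine (P.tendsto_integral_orbit (P.fieldForm hk) ht hd continuousOn_const continuousOn_const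
      (fun _ _ => hY) (fun _ _ => hZ) fun s hs α β h X hX W hW => P.fieldForm_eq_zero hk
        (wdiv_of_weightedDivFree hρ hpos (hdiv s hs) fun i => complexify_coeFn i (u s)) h hX
        hW).congr fun ε => intervalIntegral.integral_congr fun s hs => ?_
    beta_reduce
    rw [B2_eq hρ hpos hk, integral_sum_mul_eq _ fun i => complexify_coeFn i (u s),
      P.fieldForm_apply]
    simp only [← P.comp_fieldL hk]
    rfl
  · intro V hV hVk
    have := hcubic V V hV hV hVk hVk
    -- With both states equal the cubic identity is three times the required integral.
    rw [show ∀ z : ℂ, z + 2 * z = 3 * z from fun z => by ring] at this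
    simpa using this
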